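/- Notation. For $\mathbf r\in\mathbb R^2$ let $r=|\mathbf r|$, for $\mathbf k\in\mathbb R^2\setminus\{0\}$ let $k=|\mathbf k|$, $\hat k_j=k_j/k$, and write $\widehat f(\mathbf k)=\int_{\mathbb R^2} f(\mathbf r)e^{-i\mathbf k\cdot\mathbf r}\,d\mathbf r$. For non-integrable $f$ the transform is understood in the sense of tempered distributions away from $\mathbf k=0$, i.e. tested against Schwartz functions that vanish near $0$. Let $E_1(x)=\int_x^\infty e^{-t}t^{-1}dt$. The 2D Stokeslet and stresslet are $$G_{jl}(\mathbf r)=\frac1{4\pi}\Big(-\delta_{jl}\log r+\frac{r_jr_l}{r^2}\Big),\qquad T_{jlm}(\mathbf r)=-\frac1{\pi}\frac{r_jr_lr_m}{r^4},$$ and $B(\mathbf r)=-\frac1{8\pi}r^2(\log r-\tfrac32)$, $L(\mathbf r)=-\frac1{2\pi}\log r$ are the biharmonic and Laplace Green's functions. For $\mathbf r\ne0$, $G_{jl}=\delta_{jl}\Delta B-\partial_j\partial_lB$ and $T_{jlm}=(\delta_{jl}\partial_m+\delta_{jm}\partial_l+\delta_{lm}\partial_j)\Delta B-2\partial_j\partial_l\partial_mB$.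 For $\xi>0$ the Hasimoto screening function is $\gamma(\mathbf r,\xi)=\frac{\xi^2}{\pi}e^{-\xi^2r^2}(2-\xi^2r^2)$; it is integrable and $\widehat\gamma(\mathbf k,\xi)=(1+\frac{k^2}{4\xi^2})e^{-k^2/4\xi^2}$. Theorem. (1) Let $\xi>0$, $B^R=B-B*\gamma$ and $L^R=L-L*\gamma$. Then $$B^R=\frac{1}{16\pi\xi^2}\big(\xi^2r^2E_1(\xi^2r^2)-e^{-\xi^2r^2}\big),\qquad L^R=\frac1{4\pi}\big(E_1(\xi^2r^2)-e^{-\xi^2r^2}\big)$$ (the first also at $\mathbf r=0$ by continuity, the second for $\mathbf r\neq0$). Both are smooth off $0$ and $\Delta B^R=L^R$ there. Define, for $\mathbf r\ne 0$, $$G^R_{jl}=\delta_{jl}L^R-\partial_j\partial_lB^R,\qquad T^R_{jlm}=(\delta_{jl}\partial_m+\delta_{jm}\partial_l+\delta_{lm}\partial_j)L^R-2\partial_j\partial_l\partial_mB^R .$$ For each pair $(K,K^R)$ among $(B,B^R)$, $(L,L^R)$, $(G_{jl},G^R_{jl})$, $(T_{jlm},T^R_{jlm})$, the convolution $K*\gamma$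 exists everywhere, $K=K^R+K*\gamma$ off $0$, $K$ and $K*\gamma$ have Fourier transforms $\widehat K$ and $\widehat K^F=\widehat\gamma\,\widehat K$ away from $\mathbf k=0$, and $K^R$ is integrable with $\widehat{K^R}=\widehat K-\widehat K^F$ for $\mathbf k\neq0$. Here $\widehat B=-1/k^4$, $\widehat L=1/k^2$, $\widehat G_{jl}=(\delta_{jl}-\hat k_j\hat k_l)/k^2$, $\widehat T_{jlm}=i(\delta_{jl}\hat k_m+\delta_{jm}\hat k_l+\delta_{lm}\hat k_j-2\hat k_j\hat k_l\hat k_m)/k$, so that $$\widehat B^F=-\frac1{k^4}\Big(1+\frac{k^2}{4\xi^2}\Big)e^{-k^2/4\xi^2},\qquad \widehat L^F=\frac1{k^2}\Big(1+\frac{k^2}{4\xi^2}\Big)e^{-k^2/4\xi^2},$$ $$\widehat G^F_{jl}=(\delta_{jl}-\hat k_j\hat k_l)\Big(1+\frac{k^2}{4\xi^2}\Big)\frac{e^{-k^2/4\xi^2}}{k^2},$$ $$\widehat T^F_{jlm}=i\Big(1+\frac{k^2}{4\xi^2}\Big)\big(\delta_{jl}\hat k_m+\delta_{jm}\hat k_l+\delta_{lm}\hat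 k_j-2\hat k_j\hat k_l\hat k_m\big)\frac{e^{-k^2/4\xi^2}}{k}.$$ Moreover, for $\mathbf r\ne0$, $$G^R_{jl}=\frac1{4\pi}\Big[\delta_{jl}\big(\tfrac12E_1(\xi^2r^2)-e^{-\xi^2r^2}\big)+\frac{r_jr_l}{r^2}e^{-\xi^2r^2}\Big],$$ $$T^R_{jlm}=\frac{e^{-\xi^2r^2}}{2\pi}\Big[\xi^2(\delta_{jl}r_m+\delta_{jm}r_l+\delta_{lm}r_j)-2(1+\xi^2r^2)\frac{r_jr_lr_m}{r^4}\Big].$$ Both $T^R_{jlm}$ and $\widehat T^F_{jlm}$ are symmetric under all permutations of $j,l,m$. As $\mathbf r\to0$, $G^R_{jl}-G_{jl}\to c(\xi)\delta_{jl}$ with $c(\xi)=-\frac1{4\pi}(\frac{\gamma_E}{2}+\log\xi+1)$, where $\gamma_E$ is Euler's constant, and $T^R_{jlm}-T_{jlm}\to0$. (2) Let $L_1,L_2>0$, $V=L_1L_2$, $\tau(\mathbf p)=(p_1L_1,p_2L_2)$ for $\mathbf p\in\mathbb Z^2$, let $\mathbf x_1,\dots,\mathbf x_N\in\mathbb R^2$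 be points and $\mathbf f_n,\boldsymbol\nu_n\in\mathbb R^2$ ($1\le n\le N$). Consider the doubly periodic sums (summation over repeated $l,m$) $$u^G_j(\mathbf x)=\sum^*_{\mathbf p\in\mathbb Z^2}\sum_{n}G_{jl}(\mathbf x-\mathbf x_n-\tau(\mathbf p))f_{n,l},\qquad u^T_j(\mathbf x)=\sum^*_{\mathbf p\in\mathbb Z^2}\sum_{n}T_{jlm}(\mathbf x-\mathbf x_n-\tau(\mathbf p))f_{n,l}\nu_{n,m}.$$ Each is understood as the $\tau(\mathbb Z^2)$-periodic, locally integrable function $u$ with mean zero over the periodic box such that, for every Schwartz function whose Fourier transform vanishes near $0$, the sum over $\mathbf p$ of the integrals of the $\mathbf p$-th term against it converges unconditionally to the integral of $u$ against it; $u$ is continuous away from the points $\mathbf x_n+\tau(\mathbf p)$, and its value at such a point $\mathbf x$ is the limit at $\mathbf x$ of $u$ minus the terms singular at $\mathbf x$ (this is the meaning of the asterisk). These conditions determine $u^G_j$ and $u^T_j$ uniquely, such functions exist, and for every $\xi>0$ and every $\mathbf x\in\mathbb R^2$ $$u^G_j(\mathbf x)=\sum^*_{\mathbf p}\sum_nG^R_{jl}(\mathbf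 x-\mathbf x_n-\tau(\mathbf p))f_{n,l}+\frac1V\sum_{\mathbf k\ne0}\widehat G^F_{jl}(\mathbf k)\sum_nf_{n,l}e^{i\mathbf k\cdot(\mathbf x-\mathbf x_n)}+c(\xi)\sum_{n:\,\mathbf x-\mathbf x_n\in\tau(\mathbb Z^2)}f_{n,j},$$ $$u^T_j(\mathbf x)=\sum^*_{\mathbf p}\sum_nT^R_{jlm}(\mathbf x-\mathbf x_n-\tau(\mathbf p))f_{n,l}\nu_{n,m}+\frac1V\sum_{\mathbf k\ne0}\widehat T^F_{jlm}(\mathbf k)\sum_nf_{n,l}\nu_{n,m}e^{i\mathbf k\cdot(\mathbf x-\mathbf x_n)},$$ where $\mathbf k$ runs over $2\pi(q_1/L_1,q_2/L_2)$, $\mathbf q\in\mathbb Z^2\setminus\{0\}$, the asterisk on the right omits the terms with $\mathbf x-\mathbf x_n-\tau(\mathbf p)=0$, and all series converge absolutely. -/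

import Mathlib

open scoped ContDiff

namespace Ewald2D

noncomputable section

/-- The Euclidean plane. -/
abbrev Plane : Type := EuclideanSpace ℝ (Fin 2)

/-- Kronecker delta. -/
def kd (j l : Fin 2) : ℝ := if j = l then 1 else 0

/-- Partial derivative in the direction of the `j`-th coordinate. -/
def pd (j : Fin 2) (f : Plane → ℝ) (r : Plane) : ℝ :=
  fderiv ℝ f r (EuclideanSpace.single j 1)

/-- Laplacian. -/
def lap (f : Plane → ℝ) (r : Plane) : ℝ := pd 0 (pd 0 f) r + pd 1 (pd 1 f) r

/-- The exponential integral `E₁(x) = ∫_x^∞ e^{-t}/t dt` (for `x > 0`). -/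
def expInt (x : ℝ) : ℝ := ∫ t in Set.Ioi x, Real.exp (-t) / t

/-! ### The kernels -/

/-- The biharmonic Green's function, `-Δ²B = δ`. -/
def biharm (r : Plane) : ℝ := -(1 / (8 * Real.pi)) * (‖r‖ ^ 2 * (Real.log ‖r‖ - 3 / 2))

/-- The Laplace Green's function, `-ΔL = δ`. -/
def lapl (r : Plane) : ℝ := -(1 / (2 * Real.pi)) * Real.log ‖r‖

/-- The 2D Stokeslet. -/
def stokeslet (j l : Fin 2) (r : Plane) : ℝ :=
  1 / (4 * Real.pi) * (-(kd j l) * Real.log ‖r‖ + r j * r l / ‖r‖ ^ 2)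

/-- The 2D stresslet. -/
def stresslet (j l m : Fin 2) (r : Plane) : ℝ :=
  1 / (4 * Real.pi) * (-4 * (r j * r l * r m / ‖r‖ ^ 4))

/-! ### Screening -/

/-- The Hasimoto screening function in the plane. -/
def hasimoto (ξ : ℝ) (r : Plane) : ℝ :=
  ξ ^ 2 / Real.pi * Real.exp (-(ξ ^ 2 * ‖r‖ ^ 2)) * (2 - ξ ^ 2 * ‖r‖ ^ 2)

/-- The function `(1 + k²/4ξ²) e^{-k²/4ξ²}`, which is shown to be the Fourier transform of `γ(·, ξ)`. -/
def hasimotoHat (ξ : ℝ) (k : Plane) : ℝ :=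
  (1 + ‖k‖ ^ 2 / (4 * ξ ^ 2)) * Real.exp (-(‖k‖ ^ 2 / (4 * ξ ^ 2)))

/-- The convolution `K ∗ γ(·, ξ)` of a kernel with the Hasimoto screening function. -/
def screened (ξ : ℝ) (K : Plane → ℝ) (r : Plane) : ℝ := ∫ s, K (r - s) * hasimoto ξ s

/-- Real-space part of the biharmonic Green's function: `B^R = B - B ∗ γ`. -/
def biharmR (ξ : ℝ) (r : Plane) : ℝ := biharm r - screened ξ biharm r

/-- Real-space part of the Laplace Green's function: `L^R = L - L ∗ γ`. -/
def laplR (ξ : ℝ) (r : Plane) : ℝ := lapl r - screened ξ lapl r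

/-- Real-space part of the Stokeslet: `δ_{jl} L^R - ∂_j ∂_l B^R`. -/
def stokesletR (ξ : ℝ) (j l : Fin 2) (r : Plane) : ℝ :=
  kd j l * laplR ξ r - pd j (pd l (biharmR ξ)) r

/-- Real-space part of the stresslet:
`(δ_{jl} ∂_m + δ_{jm} ∂_l + δ_{lm} ∂_j) L^R - 2 ∂_j ∂_l ∂_m B^R`. -/
def stressletR (ξ : ℝ) (j l m : Fin 2) (r : Plane) : ℝ :=
  kd j l * pd m (laplR ξ) r + kd j m * pd l (laplR ξ) r + kd l m * pd j (laplR ξ) r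
    - 2 * pd j (pd l (pd m (biharmR ξ))) r

/-! ### Fourier-space expressions -/

/-- `B̂ = -1/k⁴`. -/
def biharmHat (k : Plane) : ℂ := ((-1 / ‖k‖ ^ 4 : ℝ) : ℂ)

/-- `B̂^F = -(1 + k²/4ξ²) e^{-k²/4ξ²} / k⁴`. -/
def biharmFHat (ξ : ℝ) (k : Plane) : ℂ :=
  ((-1 / ‖k‖ ^ 4 * (1 + ‖k‖ ^ 2 / (4 * ξ ^ 2)) *
    Real.exp (-(‖k‖ ^ 2 / (4 * ξ ^ 2))) : ℝ) : ℂ)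

/-- `L̂ = 1/k²`. -/
def laplHat (k : Plane) : ℂ := ((1 / ‖k‖ ^ 2 : ℝ) : ℂ)

/-- `L̂^F = (1 + k²/4ξ²) e^{-k²/4ξ²} / k²`. -/
def laplFHat (ξ : ℝ) (k : Plane) : ℂ :=
  ((1 / ‖k‖ ^ 2 * (1 + ‖k‖ ^ 2 / (4 * ξ ^ 2)) *
    Real.exp (-(‖k‖ ^ 2 / (4 * ξ ^ 2))) : ℝ) : ℂ)

/-- Component of the normalised wave vector `k̂ = k / |k|`. -/
def unitComp (k : Plane) (j : Fin 2) : ℝ := k j / ‖k‖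

/-- `Ĝ_{jl} = (δ_{jl} - k̂_j k̂_l) / k²`. -/
def stokesletHat (j l : Fin 2) (k : Plane) : ℂ :=
  (((kd j l - unitComp k j * unitComp k l) / ‖k‖ ^ 2 : ℝ) : ℂ)

/-- `Ĝ^F_{jl} = (δ_{jl} - k̂_j k̂_l) (1 + k²/4ξ²) e^{-k²/4ξ²} / k²`. -/
def stokesletFHat (ξ : ℝ) (j l : Fin 2) (k : Plane) : ℂ :=
  (((kd j l - unitComp k j * unitComp k l) * (1 + ‖k‖ ^ 2 / (4 * ξ ^ 2)) *
    Real.exp (-(‖k‖ ^ 2 / (4 * ξ ^ 2))) / ‖k‖ ^ 2 : ℝ) : ℂ)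

/-- `δ_{jl} k̂_m + δ_{jm} k̂_l + δ_{lm} k̂_j - 2 k̂_j k̂_l k̂_m`. -/
def stressletSymbol (j l m : Fin 2) (k : Plane) : ℝ :=
  kd j l * unitComp k m + kd j m * unitComp k l + kd l m * unitComp k j
    - 2 * unitComp k j * unitComp k l * unitComp k m

/-- `T̂_{jlm} = i (δ_{jl} k̂_m + δ_{jm} k̂_l + δ_{lm} k̂_j - 2 k̂_j k̂_l k̂_m) / k`. -/
def stressletHat (j l m : Fin 2) (k : Plane) : ℂ :=
  Complex.I * ((stressletSymbol j l m k / ‖k‖ : ℝ) : ℂ)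

/-- `T̂^F_{jlm} = i (1 + k²/4ξ²) (δ_{jl} k̂_m + δ_{jm} k̂_l + δ_{lm} k̂_j - 2 k̂_j k̂_l k̂_m)
e^{-k²/4ξ²} / k`. -/
def stressletFHat (ξ : ℝ) (j l m : Fin 2) (k : Plane) : ℂ :=
  Complex.I * (((1 + ‖k‖ ^ 2 / (4 * ξ ^ 2)) * stressletSymbol j l m k *
    Real.exp (-(‖k‖ ^ 2 / (4 * ξ ^ 2))) / ‖k‖ : ℝ) : ℂ)

/-! ### Fourier transforms -/

/-- The Fourier transform `f̂(k) = ∫ f(r) e^{-i k·r} dr`. -/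
def planeFourier (f : Plane → ℂ) (k : Plane) : ℂ :=
  ∫ r, f r * Complex.exp (-(Complex.I * ((inner ℝ k r : ℝ) : ℂ)))

/-- `F` is the Fourier transform of the (possibly growing) function `f`, as a tempered
distribution away from the zero wave vector: `∫ f φ̂ = ∫ F φ` for each Schwartz function `φ`
that vanishes near `0`. -/
def HasFourierAwayFromZero (f : Plane → ℝ) (F : Plane → ℂ) : Prop :=
  ∀ φ : SchwartzMap Plane ℂ, (0 : Plane) ∉ tsupport (φ : Plane → ℂ) →
    MeasureTheory.Integrable (fun r => (f r : ℂ) * planeFourier φ r) ∧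
    MeasureTheory.Integrable (fun k => F k * φ k) ∧
    ∫ r, (f r : ℂ) * planeFourier φ r = ∫ k, F k * φ k

/-- `K = K^R + K ∗ γ` is the Hasimoto split of the kernel `K`, where `K` has Fourier transform
`Khat`, `K ∗ γ` has Fourier transform `KFhat = γ̂ Khat`, and `K^R` is integrable with Fourier
transform `Khat - KFhat`. -/
structure IsHasimotoSplit (ξ : ℝ) (K KR : Plane → ℝ) (Khat KFhat : Plane → ℂ) : Prop where
  convolution_exists : ∀ r, MeasureTheory.Integrable (fun s => K (r - s) * hasimoto ξ s)
  split : ∀ r, r ≠ 0 → K r = KR r + screened ξ K r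
  fourier : HasFourierAwayFromZero K Khat
  fourier_screened : HasFourierAwayFromZero (screened ξ K) KFhat
  multiplier : ∀ k, k ≠ 0 → KFhat k = (hasimotoHat ξ k : ℂ) * Khat k
  real_integrable : MeasureTheory.Integrable KR
  fourier_real : ∀ k, k ≠ 0 → planeFourier (fun r => (KR r : ℂ)) k = Khat k - KFhat k

/-! ### Doubly periodic sums -/

/-- The lattice vector `τ(p) = (p₁ L₁, p₂ L₂)`. -/
def latticeVec (L : Fin 2 → ℝ) (p : Fin 2 → ℤ) : Plane :=
  WithLp.toLp 2 (fun i => (p i : ℝ) * L i)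

/-- The wave vector `2π (q₁ / L₁, q₂ / L₂)`. -/
def waveVec (L : Fin 2 → ℝ) (q : Fin 2 → ℤ) : Plane :=
  WithLp.toLp 2 (fun i => 2 * Real.pi * (q i : ℝ) / L i)

/-- The periodic box. -/
def box (L : Fin 2 → ℝ) : Set Plane := {r | ∀ i, r i ∈ Set.Ico 0 (L i)}

/-- `a` and `b` differ by a lattice vector. -/
def Congruent (L : Fin 2 → ℝ) (a b : Plane) : Prop := ∃ p, a - b = latticeVec L p

open Classical in
/-- `U` is the doubly periodic sum `U(x) = ∑*_p ∑_n K_n(x - x_n - τ(p))`, normalised to have mean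
zero over a period, where `K_n` is singular at most at `0`.

For kernels such as the Stokeslet or the stresslet the series does not converge pointwise; it
converges as a distribution, tested against those Schwartz functions whose Fourier transform
vanishes near `0` (so that all their moments vanish). This determines a periodic function up to
an additive constant, which the mean fixes. At a point `x` that is congruent to some of the `x_n`
the value `U(x)` is that of the sum without its singular terms (the asterisk in the sum); at all
other points the last clause says that `U` is continuous. -/
structure IsDoublyPeriodicSum {N : ℕ} (L : Fin 2 → ℝ) (x : Fin N → Plane)
    (K : Fin N → Plane → ℝ) (U : Plane → ℝ) : Prop where
  periodic : ∀ y p, U (y + latticeVec L p) = U y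
  locallyIntegrable : MeasureTheory.LocallyIntegrable U
  mean_zero : ∫ y in box L, U y = 0
  lattice_sum : ∀ φ : SchwartzMap Plane ℂ, (0 : Plane) ∉ tsupport (φ : Plane → ℂ) →
    HasSum
      (fun p : Fin 2 → ℤ =>
        ∫ y, ((∑ n, K n (y - x n - latticeVec L p) : ℝ) : ℂ) * planeFourier φ y)
      (∫ y, (U y : ℂ) * planeFourier φ y)
  starred_value : ∀ y, Filter.Tendsto
    (fun z => U z - ∑ n, if Congruent L y (x n) then K n (z - y) else 0)
    (nhdsWithin y {y}ᶜ) (nhds (U y))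

open Classical in
/-- The Ewald formula: for each `y`,
`U(y) = ∑*_p ∑_n K^R_n(y - x_n - τ(p)) + V⁻¹ ∑_{k ≠ 0} ∑_n K̂^F_n(k) e^{i k·(y - x_n)} + self`,
with `V = L₁ L₂`, both series being absolutely convergent; the term with
`y - x_n - τ(p) = 0` is left out of the first sum and `self` is the sum of `S n` over those `n`
with `x_n` congruent to `y`. -/
def EwaldFormula {N : ℕ} (L : Fin 2 → ℝ) (x : Fin N → Plane)
    (KR : Fin N → Plane → ℝ) (KFhat : Fin N → Plane → ℂ) (S : Fin N → ℝ)
    (U : Plane → ℝ) : Prop :=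
  ∀ y : Plane,
    (∀ n, Summable fun p : Fin 2 → ℤ =>
      if y - x n - latticeVec L p = 0 then 0 else KR n (y - x n - latticeVec L p)) ∧
    (∀ n, Summable fun q : {q : Fin 2 → ℤ // q ≠ 0} =>
      KFhat n (waveVec L q) *
        Complex.exp (Complex.I * ((inner ℝ (waveVec L q) (y - x n) : ℝ) : ℂ))) ∧
    (U y : ℂ) =
      ((∑' p : Fin 2 → ℤ, ∑ n,
        if y - x n - latticeVec L p = 0 then 0 else KR n (y - x n - latticeVec L p) : ℝ) : ℂ)
      + 1 / ((L 0 * L 1 : ℝ) : ℂ) * ∑' q : {q : Fin 2 → ℤ // q ≠ 0}, ∑ n,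
          KFhat n (waveVec L q) *
            Complex.exp (Complex.I * ((inner ℝ (waveVec L q) (y - x n) : ℝ) : ℂ))
      + ((∑ n, if Congruent L y (x n) then S n else 0 : ℝ) : ℂ)

/-- The number `c(ξ)` for which `G^R_{jl}(r) - G_{jl}(r) → c(ξ) δ_{jl}` as `r → 0`. -/
def selfConst (ξ : ℝ) : ℝ :=
  -(1 / (4 * Real.pi)) * (Real.eulerMascheroniConstant / 2 + Real.log ξ + 1)

end

end Ewald2D

open Ewald2D

/-!
Each of the four kernels `K` (biharmonic, Laplace, Stokeslet, stresslet) has a Fourier transform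
`P(k) / |k|⁴` with `P` a polynomial, and is formally a superposition `∫₀^∞ Φ_τ dτ` of Gaussians
`Φ_τ = P(-i∇) e^{-τ|r|²}`, up to a weight in `τ`. The closed forms for `K^R` in the theorem are
the part of that superposition with `τ ≥ ξ²` (`isGaussianTail_biharm`, `isGaussianTail_lapl`,
`isGaussianTail_stokeslet`, `isGaussianTail_stresslet`). They are integrable, and integrating the
Fourier transforms of the Gaussians over `τ ≥ ξ²` gives
`(1 - γ̂_ξ(k)) P(k) / |k|⁴` (`IsGaussianTail.fourier_tail`). No regularization is needed here.

The full superposition diverges for all but the stresslet, so the identity `K = K^R + K * γ` is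
obtained by a limit. Let `R_ξ` be the closed form with parameter `ξ`. Comparing Fourier transforms,
`R_η - R_η * γ_ξ = R_ξ - R_ξ * γ_η` (`ScreenedKernel.sub_screened_symm`). As `η → 0` the term
`R_ξ * γ_η` vanishes, while `R_η` minus a polynomial `a(η) + b(η) |r|²` tends to `K`, by the
expansion `E₁(x) = -log x - γ_E + o(1)`. Convolution with `γ_ξ` fixes `1` and `|r|²`, since
`γ̂_ξ(k) = 1 + O(|k|⁴)`, so the polynomial drops out and `K = R_ξ + K * γ_ξ` remains
(`ScreenedKernel.eq_add_screened_of_limit`). The same limit gives `K̂ = P / |k|⁴` away from `k = 0`,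
where the Fourier transforms of polynomials vanish (`ScreenedKernel.hasFourier`). That `G^R` and `T^R`,
defined by derivatives of `B^R` and `L^R`, are given by the closed forms is a computation with
radial functions (`HasJet`).

For the periodic sums, Poisson summation (`poisson_summation`) shows that a periodic function of
mean zero satisfies the defining condition of the doubly periodic sum of `K` as soon as its Fourier
coefficients are `V⁻¹ K̂(k)` for `k ≠ 0`. The Ewald sum for the parameter `ξ` has these
coefficients: the sum of the translates of `K^R` contributes `V⁻¹ (K̂ - K̂^F)` and the wave sum
`V⁻¹ K̂^F` (`boxCoeff_ewaldSum`, `EwaldKernel.isPeriodicSum`). Its value at a source is corrected by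
the limit of `K^R - K` at the origin, which is `c(ξ) δ_{jl}` for the Stokeslet and `0` for the
stresslet. Sums over the points with their strengths follow by linearity
(`isDoublyPeriodicSum_superposition`, `ewaldFormula_superposition`). The conditions determine the
Fourier coefficients, hence the function almost everywhere, hence everywhere by continuity off the
sources and the prescription at the sources (`IsDoublyPeriodicSum.unique`).
-/

namespace Ewald2D

noncomputable section

open MeasureTheory Set Filter Topology SchwartzMap FourierTransform

/-! ### The exponential integral -/

lemma integrableOn_exp_neg_div {x : ℝ} (hx : 0 < x) :
    IntegrableOn (fun t => Real.exp (-t) / t) (Ioi x) := by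
  have h : IntegrableOn (fun t => x⁻¹ * Real.exp (-t)) (Ioi x) :=
    (integrableOn_exp_neg_Ioi x).const_mul _
  refine Integrable.mono' h ?_ ?_
  · exact (by fun_prop : Measurable fun t : ℝ => Real.exp (-t) / t).aestronglyMeasurable
  · refine (ae_restrict_iff' measurableSet_Ioi).2 (ae_of_all _ fun t ht => ?_)
    have ht : x < t := ht
    have ht0 : 0 < t := hx.trans ht
    rw [Real.norm_of_nonneg (by positivity), div_eq_inv_mul]
    gcongr

lemma hasDerivAt_expInt {x : ℝ} (hx : 0 < x) :
    HasDerivAt expInt (-(Real.exp (-x) / x)) x := by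
  have h1 : ∀ᶠ y in 𝓝 x, expInt y = expInt (x / 2) - ∫ t in (x / 2)..y, Real.exp (-t) / t := by
    filter_upwards [lt_mem_nhds (half_lt_self hx)] with y hy
    rw [← intervalIntegral.integral_Ioi_sub_Ioi (integrableOn_exp_neg_div (half_pos hx)) hy.le]
    simp [expInt]
  refine HasDerivAt.congr_of_eventuallyEq ?_ h1
  refine HasDerivAt.const_sub _ ?_
  have hc : ContinuousOn (fun t : ℝ => Real.exp (-t) / t) (Ioi 0) :=
    ContinuousOn.div (by fun_prop) (by fun_prop) fun t ht => (ne_of_gt ht)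
  refine intervalIntegral.integral_hasDerivAt_right ?_ ?_ ?_
  · refine (hc.mono ?_).intervalIntegrable
    intro t ht
    rw [uIcc_of_le (by linarith)] at ht
    exact lt_of_lt_of_le (half_pos hx) ht.1
  · exact hc.stronglyMeasurableAtFilter isOpen_Ioi x hx
  · exact hc.continuousAt (Ioi_mem_nhds hx)

lemma expInt_nonneg {x : ℝ} (hx : 0 < x) : 0 ≤ expInt x :=
  setIntegral_nonneg measurableSet_Ioi fun t ht => by
    have : 0 < t := hx.trans ht
    positivity

lemma expInt_le {x : ℝ} (hx : 0 < x) : expInt x ≤ Real.exp (-x) / x := by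
  have : expInt x ≤ ∫ t in Ioi x, x⁻¹ * Real.exp (-t) := by
    refine setIntegral_mono_on (integrableOn_exp_neg_div hx)
      ((integrableOn_exp_neg_Ioi x).const_mul _) measurableSet_Ioi fun t ht => ?_
    have ht : x < t := ht
    have ht0 : 0 < t := hx.trans ht
    rw [div_eq_inv_mul]
    gcongr
  rwa [integral_const_mul, integral_exp_neg_Ioi, ← div_eq_inv_mul] at this

/-- The value `Γ'(1) = -γ`. The integral is nonzero, so it is not a junk value, which yields
integrability. -/
lemma integral_log_mul_exp_neg :
    IntegrableOn (fun t => Real.log t * Real.exp (-t)) (Ioi 0) ∧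
      ∫ t in Ioi (0 : ℝ), Real.log t * Real.exp (-t) = -Real.eulerMascheroniConstant := by
  have h0 : (0 : ℝ) < (1 : ℂ).re := by simp
  have e1 : ∀ t : ℝ, (t : ℂ) ^ ((1 : ℂ) - 1) * ((Real.log t : ℂ) * (Real.exp (-t) : ℂ)) =
      ((Real.log t * Real.exp (-t) : ℝ) : ℂ) := by
    intro t; simp
  have hd := Complex.hasDerivAt_GammaIntegral h0
  simp only [e1] at hd
  rw [integral_complex_ofReal] at hd
  have hG : HasDerivAt Complex.GammaIntegral (-(Real.eulerMascheroniConstant : ℂ)) 1 := by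
    refine Complex.hasDerivAt_Gamma_one.congr_of_eventuallyEq ?_
    have : ∀ᶠ s : ℂ in 𝓝 1, 0 < s.re :=
      (Complex.continuous_re.continuousAt (x := (1 : ℂ))).eventually (lt_mem_nhds (by simp))
    filter_upwards [this] with s hs
    exact (Complex.Gamma_eq_integral hs).symm
  have hI : ∫ t in Ioi (0 : ℝ), Real.log t * Real.exp (-t) = -Real.eulerMascheroniConstant := by
    have := hd.unique hG
    exact_mod_cast this
  refine ⟨?_, hI⟩
  by_contra hn
  rw [integral_undef hn] at hI
  have := Real.one_half_lt_eulerMascheroniConstant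
  linarith

/-- The complementary exponential integral `E₁(x) + log x + γ = ∫₀ˣ (1 - e^{-t})/t dt`. -/
def ein (x : ℝ) : ℝ := expInt x + Real.log x + Real.eulerMascheroniConstant

lemma expInt_add_exp_neg_mul_log {x : ℝ} (hx : 0 < x) :
    expInt x + Real.exp (-x) * Real.log x = ∫ t in Ioi x, Real.log t * Real.exp (-t) := by
  have hi := integral_log_mul_exp_neg.1.mono_set (Ioi_subset_Ioi hx.le)
  have key : ∫ t in Ioi x, (Real.exp (-t) / t - Real.log t * Real.exp (-t)) =
      0 - Real.log x * Real.exp (-x) := by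
    refine integral_Ioi_of_hasDerivAt_of_tendsto' (f := fun t => Real.log t * Real.exp (-t))
      (fun t ht => ?_) ((integrableOn_exp_neg_div hx).sub hi) ?_
    · have ht0 : t ≠ 0 := (hx.trans_le ht).ne'
      have := (Real.hasDerivAt_log ht0).mul ((hasDerivAt_neg t).exp)
      convert! this using 1
      field_simp
      ring
    · have h1 : Tendsto (fun t : ℝ => t * Real.exp (-t)) atTop (𝓝 0) := by
        simpa using Real.tendsto_pow_mul_exp_neg_atTop_nhds_zero 1
      refine squeeze_zero_norm' ?_ h1
      filter_upwards [eventually_ge_atTop 1] with t ht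
      rw [Real.norm_of_nonneg (mul_nonneg (Real.log_nonneg ht) (Real.exp_nonneg _))]
      gcongr
      exact (Real.log_le_sub_one_of_pos (by linarith)).trans (by linarith)
  rw [integral_sub (integrableOn_exp_neg_div hx) hi] at key
  rw [expInt]
  linarith

/-- The expansion `E₁(x) = -log x - γ + o(1)` at `0`; this is where Euler's constant enters. -/
lemma tendsto_ein_zero : Tendsto ein (𝓝[>] 0) (𝓝 0) := by
  obtain ⟨hi, hI⟩ := integral_log_mul_exp_neg
  have h1 : Tendsto (fun x : ℝ => ∫ t in Ioi x, Real.log t * Real.exp (-t)) (𝓝[>] 0)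
      (𝓝 (-Real.eulerMascheroniConstant)) := by
    have h2 : ∀ x ∈ Ioi (0:ℝ), ∫ t in Ioi x, Real.log t * Real.exp (-t) =
        -Real.eulerMascheroniConstant - ∫ t in (0:ℝ)..x, Real.log t * Real.exp (-t) := by
      intro x hx
      rw [← hI, ← intervalIntegral.integral_Ioi_sub_Ioi hi (le_of_lt hx)]
      ring
    refine Tendsto.congr' (eventuallyEq_nhdsWithin_of_eqOn fun x hx => (h2 x hx).symm) ?_
    have h3 : ContinuousOn (fun x => ∫ t in (0:ℝ)..x, Real.log t * Real.exp (-t)) (uIcc 0 1) := by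
      refine intervalIntegral.continuousOn_primitive_interval (μ := volume) ?_
      rw [uIcc_of_le zero_le_one]
      exact (integrableOn_Icc_iff_integrableOn_Ioc (μ := volume)).2
        (hi.mono_set Ioc_subset_Ioi_self)
    rw [uIcc_of_le zero_le_one] at h3
    have h4 := (h3 0 (by simp)).tendsto
    rw [intervalIntegral.integral_same] at h4
    have h5 : 𝓝[>] (0:ℝ) ≤ 𝓝[Icc 0 1] 0 := by
      rw [← nhdsWithin_Ioc_eq_nhdsGT zero_lt_one]
      exact nhdsWithin_mono _ Ioc_subset_Icc_self
    simpa using (h4.mono_left h5).const_sub (-Real.eulerMascheroniConstant)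
  have h2 : Tendsto (fun x : ℝ => Real.log x * (1 - Real.exp (-x))) (𝓝[>] 0) (𝓝 0) := by
    have h3 : Tendsto (fun x : ℝ => Real.log x * x) (𝓝[>] 0) (𝓝 0) := by
      simpa only [Real.rpow_one] using tendsto_log_mul_rpow_nhdsGT_zero zero_lt_one
    have h3' := h3.norm
    rw [norm_zero] at h3'
    refine squeeze_zero_norm' ?_ h3'
    filter_upwards [self_mem_nhdsWithin] with x hx
    have hx : 0 < x := hx
    rw [norm_mul, norm_mul]
    gcongr
    rw [Real.norm_of_nonneg (by simp [hx.le]), Real.norm_of_nonneg hx.le]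
    linarith [Real.add_one_le_exp (-x)]
  have h3 := (h1.add h2).add_const Real.eulerMascheroniConstant
  simp only [add_zero, neg_add_cancel] at h3
  refine h3.congr' (eventuallyEq_nhdsWithin_of_eqOn fun x hx => ?_)
  rw [← expInt_add_exp_neg_mul_log hx, ein]
  ring

lemma hasDerivAt_ein {x : ℝ} (hx : 0 < x) :
    HasDerivAt ein ((1 - Real.exp (-x)) / x) x := by
  have := ((hasDerivAt_expInt hx).add (Real.hasDerivAt_log hx.ne')).add_const
    Real.eulerMascheroniConstant
  convert! this using 1
  field_simp
  ring

lemma ein_nonneg {x : ℝ} (hx : 0 < x) : 0 ≤ ein x := by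
  have hm : MonotoneOn ein (Ioi 0) := by
    refine monotoneOn_of_deriv_nonneg (convex_Ioi 0)
      (fun y hy => (hasDerivAt_ein hy).continuousAt.continuousWithinAt) ?_ ?_
    · rw [interior_Ioi]
      exact fun y hy => (hasDerivAt_ein hy).differentiableAt.differentiableWithinAt
    · rw [interior_Ioi]
      intro y hy
      have hy : 0 < y := hy
      rw [(hasDerivAt_ein hy).deriv]
      have : Real.exp (-y) ≤ 1 := by simp [hy.le]
      exact div_nonneg (by linarith) hy.le
  refine le_of_tendsto tendsto_ein_zero ?_
  filter_upwards [Ioo_mem_nhdsGT hx] with y hy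
  exact hm hy.1 hx hy.2.le

lemma ein_le {x : ℝ} (hx : 0 < x) : ein x ≤ x := by
  have hm : MonotoneOn (fun y => y - ein y) (Ioi 0) := by
    have hd : ∀ y : ℝ, 0 < y → HasDerivAt (fun y => y - ein y) (1 - (1 - Real.exp (-y)) / y) y :=
      fun y hy => (hasDerivAt_id y).sub (hasDerivAt_ein hy)
    refine monotoneOn_of_deriv_nonneg (convex_Ioi 0)
      (fun y hy => (hd y hy).continuousAt.continuousWithinAt) ?_ ?_
    · rw [interior_Ioi]
      exact fun y hy => (hd y hy).differentiableAt.differentiableWithinAt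
    · rw [interior_Ioi]
      intro y hy
      have hy : 0 < y := hy
      rw [(hd y hy).deriv, sub_nonneg, div_le_one hy]
      linarith [Real.add_one_le_exp (-y)]
  have h0 : Tendsto (fun y => y - ein y) (𝓝[>] 0) (𝓝 0) := by
    have : Tendsto (fun y : ℝ => y) (𝓝[>] 0) (𝓝 0) := tendsto_nhdsWithin_of_tendsto_nhds tendsto_id
    simpa using this.sub tendsto_ein_zero
  have : 0 ≤ x - ein x := by
    refine le_of_tendsto h0 ?_
    filter_upwards [Ioo_mem_nhdsGT hx] with y hy
    exact hm hy.1 hx hy.2.le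
  linarith

lemma expInt_eq {x : ℝ} : expInt x = ein x - Real.log x - Real.eulerMascheroniConstant := by
  rw [ein]; ring

/-! ### Partial derivatives of radial functions -/

lemma norm_sq_eq (r : Plane) : ‖r‖ ^ 2 = r 0 ^ 2 + r 1 ^ 2 := by
  rw [EuclideanSpace.real_norm_sq_eq, Fin.sum_univ_two]

lemma kd_comm (j l : Fin 2) : kd j l = kd l j := by simp [kd, eq_comm]

lemma pd_congr {f g : Plane → ℝ} {r : Plane} (h : f =ᶠ[𝓝 r] g) (j : Fin 2) : pd j f r = pd j g r := by
  rw [pd, pd, h.fderiv_eq]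

lemma pd_eventuallyEq {f g : Plane → ℝ} (h : ∀ r, r ≠ 0 → f r = g r) {r : Plane} (hr : r ≠ 0)
    (j : Fin 2) : pd j f r = pd j g r :=
  pd_congr (by filter_upwards [isOpen_ne.mem_nhds hr] with s hs using h s hs) j

lemma pd_mul {f g : Plane → ℝ} {r : Plane} (hf : DifferentiableAt ℝ f r)
    (hg : DifferentiableAt ℝ g r) (j : Fin 2) :
    pd j (fun s => f s * g s) r = f r * pd j g r + g r * pd j f r := by
  simp [pd, fderiv_fun_mul hf hg]

lemma pd_add {f g : Plane → ℝ} {r : Plane} (hf : DifferentiableAt ℝ f r)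
    (hg : DifferentiableAt ℝ g r) (j : Fin 2) :
    pd j (fun s => f s + g s) r = pd j f r + pd j g r := by
  simp [pd, fderiv_fun_add hf hg]

lemma pd_const_mul {g : Plane → ℝ} {r : Plane} (c : ℝ) (hg : DifferentiableAt ℝ g r) (j : Fin 2) :
    pd j (fun s => c * g s) r = c * pd j g r := by
  simp [pd, fderiv_const_mul hg]

lemma differentiableAt_coord (l : Fin 2) (r : Plane) : DifferentiableAt ℝ (fun s : Plane => s l) r :=
  (EuclideanSpace.proj (𝕜 := ℝ) l).differentiableAt

lemma pd_coord (j l : Fin 2) (r : Plane) : pd j (fun s => s l) r = kd j l := by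
  have : (fun s : Plane => s l) = EuclideanSpace.proj (𝕜 := ℝ) l := rfl
  rw [pd, this, ContinuousLinearMap.fderiv]
  simp [kd, eq_comm]

lemma hasFDerivAt_radial {F : ℝ → ℝ} {F' : ℝ} {r : Plane} (hF : HasDerivAt F F' (‖r‖ ^ 2)) :
    HasFDerivAt (fun s : Plane => F (‖s‖ ^ 2)) (F' • (2 • innerSL ℝ r)) r :=
  hF.comp_hasFDerivAt r (hasStrictFDerivAt_norm_sq r).hasFDerivAt

lemma pd_radial {F : ℝ → ℝ} {F' : ℝ} {r : Plane} (hF : HasDerivAt F F' (‖r‖ ^ 2)) (j : Fin 2) :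
    pd j (fun s => F (‖s‖ ^ 2)) r = 2 * (r j * F') := by
  rw [pd, (hasFDerivAt_radial hF).fderiv]
  simp [EuclideanSpace.inner_single_right]
  ring

/-- `F₁`, `F₂`, `F₃` are the first three derivatives of `F` at the points of the set `S`. -/
structure HasJet (S : Set ℝ) (F F₁ F₂ F₃ : ℝ → ℝ) : Prop where
  d1 : ∀ s ∈ S, HasDerivAt F (F₁ s) s
  d2 : ∀ s ∈ S, HasDerivAt F₁ (F₂ s) s
  d3 : ∀ s ∈ S, HasDerivAt F₂ (F₃ s) s

section Radial

variable {S : Set ℝ} {F F₁ F₂ F₃ : ℝ → ℝ}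

lemma HasJet.pd1 (h : HasJet S F F₁ F₂ F₃) {r : Plane} (hr : ‖r‖ ^ 2 ∈ S) (j : Fin 2) :
    pd j (fun s => F (‖s‖ ^ 2)) r = 2 * (r j * F₁ (‖r‖ ^ 2)) :=
  pd_radial (h.d1 _ hr) j

lemma pd_coord_mul_radial {G : ℝ → ℝ} {G' : ℝ} {r : Plane} (hG : HasDerivAt G G' (‖r‖ ^ 2))
    (j l : Fin 2) :
    pd j (fun s => s l * G (‖s‖ ^ 2)) r = kd j l * G (‖r‖ ^ 2) + 2 * (r j * r l * G') := by
  rw [pd_mul (differentiableAt_coord l r) (hasFDerivAt_radial hG).differentiableAt, pd_coord,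
    pd_radial hG]
  ring

lemma eventually_norm_sq_mem (hS : IsOpen S) {r : Plane} (hr : ‖r‖ ^ 2 ∈ S) :
    ∀ᶠ s : Plane in 𝓝 r, ‖s‖ ^ 2 ∈ S :=
  (by fun_prop : Continuous fun s : Plane => ‖s‖ ^ 2).continuousAt.eventually (hS.mem_nhds hr)

lemma HasJet.pd2 (h : HasJet S F F₁ F₂ F₃) (hS : IsOpen S) {r : Plane} (hr : ‖r‖ ^ 2 ∈ S)
    (j l : Fin 2) :
    pd j (pd l (fun s => F (‖s‖ ^ 2))) r
      = 2 * kd j l * F₁ (‖r‖ ^ 2) + 4 * (r j * r l) * F₂ (‖r‖ ^ 2) := by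
  have e : pd l (fun s => F (‖s‖ ^ 2)) =ᶠ[𝓝 r] fun s => 2 * (s l * F₁ (‖s‖ ^ 2)) := by
    filter_upwards [eventually_norm_sq_mem hS hr] with s hs using h.pd1 hs l
  rw [pd_congr e, pd_const_mul 2 ((differentiableAt_coord l r).fun_mul
    (hasFDerivAt_radial (h.d2 _ hr)).differentiableAt), pd_coord_mul_radial (h.d2 _ hr)]
  ring

lemma HasJet.pd3 (h : HasJet S F F₁ F₂ F₃) (hS : IsOpen S) {r : Plane} (hr : ‖r‖ ^ 2 ∈ S)
    (j l m : Fin 2) :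
    pd j (pd l (pd m (fun s => F (‖s‖ ^ 2)))) r
      = 4 * (kd j l * r m + kd j m * r l + kd l m * r j) * F₂ (‖r‖ ^ 2)
        + 8 * (r j * r l * r m) * F₃ (‖r‖ ^ 2) := by
  have e : pd l (pd m (fun s => F (‖s‖ ^ 2))) =ᶠ[𝓝 r]
      fun s => 2 * kd l m * F₁ (‖s‖ ^ 2) + 4 * (s l * (s m * F₂ (‖s‖ ^ 2))) := by
    filter_upwards [eventually_norm_sq_mem hS hr] with s hs
    rw [h.pd2 hS hs l m]
    ring
  have d1 := (hasFDerivAt_radial (h.d2 _ hr)).differentiableAt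
  have d2 := (differentiableAt_coord m r).fun_mul (hasFDerivAt_radial (h.d3 _ hr)).differentiableAt
  have d3 := (differentiableAt_coord l r).fun_mul d2
  rw [pd_congr e, pd_add (d1.const_mul (2 * kd l m)) (d3.const_mul 4), pd_const_mul _ d1, pd_const_mul _ d3,
    pd_radial (h.d2 _ hr), pd_mul (differentiableAt_coord l r) d2, pd_coord,
    pd_coord_mul_radial (h.d3 _ hr)]
  ring

lemma HasJet.lap (h : HasJet S F F₁ F₂ F₃) (hS : IsOpen S) {r : Plane} (hr : ‖r‖ ^ 2 ∈ S) :
    lap (fun s => F (‖s‖ ^ 2)) r = 4 * F₁ (‖r‖ ^ 2) + 4 * ‖r‖ ^ 2 * F₂ (‖r‖ ^ 2) := by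
  rw [Ewald2D.lap, h.pd2 hS hr, h.pd2 hS hr]
  simp only [kd, if_true]
  rw [norm_sq_eq]
  ring

lemma HasJet.pd_lap (h : HasJet S F F₁ F₂ F₃) (hS : IsOpen S) {r : Plane} (hr : ‖r‖ ^ 2 ∈ S)
    (m : Fin 2) :
    pd m (Ewald2D.lap (fun s => F (‖s‖ ^ 2))) r
      = r m * (16 * F₂ (‖r‖ ^ 2) + 8 * ‖r‖ ^ 2 * F₃ (‖r‖ ^ 2)) := by
  have e : Ewald2D.lap (fun s => F (‖s‖ ^ 2)) =ᶠ[𝓝 r]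
      fun s => (fun x => 4 * F₁ x + 4 * x * F₂ x) (‖s‖ ^ 2) := by
    filter_upwards [eventually_norm_sq_mem hS hr] with s hs using h.lap hS hs
  have hd : HasDerivAt (fun x => 4 * F₁ x + 4 * x * F₂ x)
      (8 * F₂ (‖r‖ ^ 2) + 4 * ‖r‖ ^ 2 * F₃ (‖r‖ ^ 2)) (‖r‖ ^ 2) := by
    have := ((h.d2 _ hr).const_mul 4).add
      (((hasDerivAt_id (‖r‖ ^ 2)).const_mul 4).mul (h.d3 _ hr))
    convert! this using 1
    simp
    ring
  rw [pd_congr e, pd_radial hd]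
  ring

end Radial

lemma norm_sq_mem_Ioi {r : Plane} (hr : r ≠ 0) : ‖r‖ ^ 2 ∈ Ioi (0 : ℝ) := by
  have : 0 < ‖r‖ := norm_pos_iff.2 hr
  exact mem_Ioi.2 (by positivity)

/-! ### The kernels as derivatives of the biharmonic Green's function -/

lemma biharm_eq : biharm = fun r => (fun s => -(1 / (16 * Real.pi)) * (s * Real.log s - 3 * s)) (‖r‖ ^ 2) := by
  funext r
  simp only [biharm, Real.log_pow]
  push_cast
  ring

lemma hasJet_biharm : HasJet (Ioi 0)
    (fun s => -(1 / (16 * Real.pi)) * (s * Real.log s - 3 * s))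
    (fun s => -(1 / (16 * Real.pi)) * (Real.log s - 2))
    (fun s => -(1 / (16 * Real.pi)) * s⁻¹)
    (fun s => (1 / (16 * Real.pi)) * (s ^ 2)⁻¹) where
  d1 s hs := by
    have hs : s ≠ 0 := ne_of_gt hs
    have := (((hasDerivAt_id s).mul (Real.hasDerivAt_log hs)).sub
      ((hasDerivAt_id s).const_mul 3)).const_mul (-(1 / (16 * Real.pi)))
    convert! this using 1
    simp [hs]
    ring
  d2 s hs := by
    have hs : s ≠ 0 := ne_of_gt hs
    exact ((Real.hasDerivAt_log hs).sub_const 2).const_mul _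
  d3 s hs := by
    have hs : s ≠ 0 := ne_of_gt hs
    have := (hasDerivAt_inv hs).const_mul (-(1 / (16 * Real.pi)))
    convert! this using 1
    ring

lemma stokeslet_eq_biharm (j l : Fin 2) {r : Plane} (hr : r ≠ 0) :
    stokeslet j l r = kd j l * lap biharm r - pd j (pd l biharm) r := by
  have hs := norm_sq_mem_Ioi hr
  have hn : ‖r‖ ≠ 0 := norm_ne_zero_iff.2 hr
  rw [biharm_eq, hasJet_biharm.lap isOpen_Ioi hs, hasJet_biharm.pd2 isOpen_Ioi hs, stokeslet,
    Real.log_pow]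
  push_cast
  field_simp
  ring

lemma stresslet_eq_biharm (j l m : Fin 2) {r : Plane} (hr : r ≠ 0) :
    stresslet j l m r = kd j l * pd m (lap biharm) r + kd j m * pd l (lap biharm) r
          + kd l m * pd j (lap biharm) r - 2 * pd j (pd l (pd m biharm)) r := by
  have hs := norm_sq_mem_Ioi hr
  have hn : ‖r‖ ≠ 0 := norm_ne_zero_iff.2 hr
  rw [biharm_eq, hasJet_biharm.pd_lap isOpen_Ioi hs, hasJet_biharm.pd_lap isOpen_Ioi hs,
    hasJet_biharm.pd_lap isOpen_Ioi hs, hasJet_biharm.pd3 isOpen_Ioi hs, stresslet]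
  field_simp
  ring

/-! ### The Fourier transform in angular-frequency normalisation -/

/-- The plane wave `r ↦ e^{i k·r}`. -/
def wave (k r : Plane) : ℂ := Complex.exp (Complex.I * ((inner ℝ k r : ℝ) : ℂ))

lemma wave_def (k r : Plane) : wave k r = Complex.exp (Complex.I * ((inner ℝ k r : ℝ) : ℂ)) := rfl

lemma wave_comm (k r : Plane) : wave k r = wave r k := by rw [wave, wave, real_inner_comm]

@[simp] lemma norm_wave (k r : Plane) : ‖wave k r‖ = 1 := by
  rw [wave, mul_comm, Complex.norm_exp_ofReal_mul_I]

lemma wave_add_right (k r s : Plane) : wave k (r + s) = wave k r * wave k s := by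
  rw [wave, wave, wave, ← Complex.exp_add, inner_add_right]; push_cast; ring_nf

lemma wave_neg_left (k r : Plane) : wave (-k) r = Complex.exp (-(Complex.I * ((inner ℝ k r : ℝ) : ℂ))) := by
  rw [wave, inner_neg_left]; push_cast; ring_nf

lemma wave_neg_comm (k r : Plane) : wave (-k) r = wave k (-r) := by
  rw [wave, wave, inner_neg_left, inner_neg_right]

@[simp] lemma wave_zero_left (r : Plane) : wave 0 r = 1 := by simp [wave]

@[simp] lemma wave_zero_right (r : Plane) : wave r 0 = 1 := by simp [wave]

lemma wave_mul_neg (k r : Plane) : wave k r * wave (-k) r = 1 := by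
  rw [wave_neg_comm, ← wave_add_right]; simp

lemma conj_wave (k r : Plane) : (starRingEnd ℂ) (wave k r) = wave (-k) r := by
  rw [wave, ← Complex.exp_conj, wave_neg_left]
  simp

lemma continuous_wave : Continuous fun p : Plane × Plane => wave p.1 p.2 := by
  unfold wave
  fun_prop

lemma continuous_wave_right (k : Plane) : Continuous (wave k) :=
  continuous_wave.comp (by fun_prop : Continuous fun r : Plane => (k, r))

lemma continuous_wave_left (r : Plane) : Continuous fun k => wave k r :=
  continuous_wave.comp (by fun_prop : Continuous fun k : Plane => (k, r))

lemma integrable_mul_wave {f : Plane → ℂ} (hf : Integrable f) (k : Plane) :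
    Integrable fun r => f r * wave k r := by
  refine hf.mul_bdd (c := 1) (continuous_wave_right k).aestronglyMeasurable ?_
  simp

lemma planeFourier_eq (f : Plane → ℂ) (k : Plane) :
    planeFourier f k = ∫ r, f r * wave (-k) r := by
  simp only [planeFourier, wave_neg_left]

lemma planeFourier_eq_fourier (f : Plane → ℂ) (k : Plane) :
    planeFourier f k = 𝓕 f ((2 * Real.pi)⁻¹ • k) := by
  rw [planeFourier, Real.fourier_eq']
  refine integral_congr_ae (ae_of_all _ fun r => ?_)
  simp only [smul_eq_mul]
  rw [mul_comm, inner_smul_right, real_inner_comm]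
  congr 2
  push_cast
  field_simp

lemma fourier_eq_planeFourier (f : Plane → ℂ) (k : Plane) :
    𝓕 f k = planeFourier f ((2 * Real.pi) • k) := by
  rw [planeFourier_eq_fourier, smul_smul, inv_mul_cancel₀ Real.two_pi_pos.ne', one_smul]

lemma norm_planeFourier_le (f : Plane → ℂ) (k : Plane) : ‖planeFourier f k‖ ≤ ∫ r, ‖f r‖ := by
  rw [planeFourier_eq]
  refine (norm_integral_le_integral_norm _).trans (le_of_eq ?_)
  simp

lemma continuous_planeFourier {f : Plane → ℂ} (hf : Integrable f) : Continuous (planeFourier f) := by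
  have : planeFourier f = fun k => ∫ r, f r * wave (-k) r := by
    funext k; exact planeFourier_eq f k
  rw [this]
  refine continuous_of_dominated (bound := fun r => ‖f r‖) ?_ ?_ hf.norm ?_
  · exact fun k => (integrable_mul_wave hf _).aestronglyMeasurable
  · exact fun k => ae_of_all _ fun r => by simp
  · exact ae_of_all _ fun r => continuous_const.mul
      ((continuous_wave_left r).comp continuous_neg)

lemma planeFourier_add {f g : Plane → ℂ} (hf : Integrable f) (hg : Integrable g) (k : Plane) :
    planeFourier (fun r => f r + g r) k = planeFourier f k + planeFourier g k := by
  simp only [planeFourier_eq, add_mul]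
  exact integral_add (integrable_mul_wave hf _) (integrable_mul_wave hg _)

lemma planeFourier_sub {f g : Plane → ℂ} (hf : Integrable f) (hg : Integrable g) (k : Plane) :
    planeFourier (fun r => f r - g r) k = planeFourier f k - planeFourier g k := by
  simp only [planeFourier_eq, sub_mul]
  exact integral_sub (integrable_mul_wave hf _) (integrable_mul_wave hg _)

lemma planeFourier_const_mul (c : ℂ) (f : Plane → ℂ) (k : Plane) :
    planeFourier (fun r => c * f r) k = c * planeFourier f k := by
  simp only [planeFourier_eq, mul_assoc]
  exact integral_const_mul c _

lemma planeFourier_congr_ae {f g : Plane → ℂ} (h : f =ᵐ[volume] g) (k : Plane) :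
    planeFourier f k = planeFourier g k := by
  simp only [planeFourier_eq]
  exact integral_congr_ae (by filter_upwards [h] with r hr; rw [hr])

lemma integral_mul_planeFourier {f g : Plane → ℂ} (hf : Integrable f) (hg : Integrable g) :
    ∫ r, f r * planeFourier g r = ∫ k, planeFourier f k * g k := by
  have h : ∀ r : Plane, f r * planeFourier g r = ∫ k, f r * g k * wave (-r) k := by
    intro r
    rw [planeFourier_eq, ← integral_const_mul]
    simp only [mul_assoc]
  have h' : ∀ k : Plane, planeFourier f k * g k = ∫ r, f r * g k * wave (-r) k := by
    intro k
    rw [planeFourier_eq, ← integral_mul_const]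
    refine integral_congr_ae (ae_of_all _ fun r => ?_)
    simp only
    rw [wave_neg_comm, wave_comm k (-r)]
    ring
  simp only [h, h']
  refine integral_integral_swap ?_
  refine (hf.mul_prod hg).mul_bdd (c := 1) ?_ ?_
  · exact (continuous_wave.comp (by fun_prop :
      Continuous fun p : Plane × Plane => (-p.1, p.2))).aestronglyMeasurable
  · simp

/-- Derivatives become multiplication by `i k_j`. -/
lemma planeFourier_fderiv {f : Plane → ℂ} (hd : Differentiable ℝ f) (hf : Integrable f) (j : Fin 2)
    (hf' : Integrable fun r => fderiv ℝ f r (EuclideanSpace.single j 1)) (k : Plane) :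
    planeFourier (fun r => fderiv ℝ f r (EuclideanSpace.single j 1)) k
      = Complex.I * ((k j : ℝ) : ℂ) * planeFourier f k := by
  have hw : ∀ r, HasFDerivAt (wave (-k))
      ((wave (-k) r) • (Complex.I • (Complex.ofRealCLM.comp (innerSL ℝ (-k))))) r := by
    intro r
    have h1 : HasFDerivAt (fun r : Plane => ((inner ℝ (-k) r : ℝ) : ℂ))
        (Complex.ofRealCLM.comp (innerSL ℝ (-k))) r :=
      (Complex.ofRealCLM.comp (innerSL ℝ (-k))).hasFDerivAt
    exact (h1.const_mul Complex.I).cexp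
  have hw' : ∀ r, fderiv ℝ (wave (-k)) r (EuclideanSpace.single j 1)
      = -(Complex.I * ((k j : ℝ) : ℂ)) * wave (-k) r := by
    intro r
    rw [(hw r).fderiv]
    simp [EuclideanSpace.inner_single_right]
    ring
  have key := integral_mul_fderiv_eq_neg_fderiv_mul_of_integrable (𝕜 := ℂ) (μ := volume)
    (f := f) (g := wave (-k)) (v := EuclideanSpace.single j 1)
    (integrable_mul_wave hf' _) ?_ (integrable_mul_wave hf _) (fun x _ => hd x)
    (fun x _ => (hw x).differentiableAt)
  · simp only [hw'] at key
    rw [planeFourier_eq, planeFourier_eq, ← neg_eq_iff_eq_neg.2 key, ← integral_const_mul,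
      ← integral_neg]
    refine integral_congr_ae (ae_of_all _ fun r => ?_)
    simp only
    ring
  · simp only [hw']
    refine ((integrable_mul_wave hf (-k)).const_mul (-(Complex.I * ((k j : ℝ) : ℂ)))).congr ?_
    exact ae_of_all _ fun r => by simp only; ring

lemma planeFourier_pd {f : Plane → ℝ} (hd : Differentiable ℝ f) (hf : Integrable f) (j : Fin 2)
    (hf' : Integrable (pd j f)) (k : Plane) :
    planeFourier (fun r => ((pd j f r : ℝ) : ℂ)) k
      = Complex.I * ((k j : ℝ) : ℂ) * planeFourier (fun r => (f r : ℂ)) k := by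
  have e : ∀ r, fderiv ℝ (fun r => (f r : ℂ)) r (EuclideanSpace.single j 1) = ((pd j f r : ℝ) : ℂ) := by
    intro r
    have : HasFDerivAt (fun r => (f r : ℂ)) (Complex.ofRealCLM.comp (fderiv ℝ f r)) r :=
      Complex.ofRealCLM.hasFDerivAt.comp r (hd r).hasFDerivAt
    rw [this.fderiv]
    rfl
  have := planeFourier_fderiv (f := fun r => (f r : ℂ))
    (fun r => Complex.ofRealCLM.differentiableAt.comp r (hd r)) hf.ofReal j
    (by simp only [e]; exact hf'.ofReal) k
  simpa only [e] using this

lemma planeFourier_gaussian {t : ℝ} (ht : 0 < t) (k : Plane) :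
    planeFourier (fun r => ((Real.exp (-(t * ‖r‖ ^ 2)) : ℝ) : ℂ)) k
      = ((Real.pi / t * Real.exp (-(‖k‖ ^ 2 / (4 * t))) : ℝ) : ℂ) := by
  have h := fourier_gaussian_innerProductSpace (V := Plane) (b := (t : ℂ)) (by simpa using ht)
    ((2 * Real.pi)⁻¹ • k)
  have hp : (Real.pi : ℂ) ≠ 0 := by exact_mod_cast Real.pi_ne_zero
  have ht' : (t : ℂ) ≠ 0 := by exact_mod_cast ht.ne'
  have e : (fun r : Plane => ((Real.exp (-(t * ‖r‖ ^ 2)) : ℝ) : ℂ))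
      = fun r => Complex.exp (-(t : ℂ) * (‖r‖ : ℂ) ^ 2) := by
    funext r
    push_cast
    congr 1
    ring
  rw [planeFourier_eq_fourier, e, h, finrank_euclideanSpace, Fintype.card_fin, norm_smul]
  push_cast
  rw [div_self two_ne_zero, Complex.cpow_one]
  congr 2
  rw [norm_inv, Real.norm_of_nonneg Real.two_pi_pos.le]
  push_cast
  field_simp
  ring

/-! ### Schwartz functions on the plane -/

/-- Multiplication by `2π` as a linear automorphism of the plane. -/
def scaleTwoPi : Plane ≃L[ℝ] Plane :=
  ContinuousLinearEquiv.smulLeft (Units.mk0 ((2 * Real.pi)⁻¹) (inv_ne_zero Real.two_pi_pos.ne'))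

/-- The Fourier transform `φ̂` of a Schwartz function, as a Schwartz function. -/
def schwartzFourier (φ : 𝓢(Plane, ℂ)) : 𝓢(Plane, ℂ) :=
  compCLMOfContinuousLinearEquiv ℂ scaleTwoPi (𝓕 φ)

@[simp] lemma schwartzFourier_apply (φ : 𝓢(Plane, ℂ)) (r : Plane) :
    schwartzFourier φ r = planeFourier φ r := by
  rw [planeFourier_eq_fourier]
  rfl

lemma coe_schwartzFourier (φ : 𝓢(Plane, ℂ)) : ⇑(schwartzFourier φ) = planeFourier φ :=
  funext fun r => schwartzFourier_apply φ r

lemma integrable_planeFourier (φ : 𝓢(Plane, ℂ)) : Integrable (planeFourier φ) := by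
  rw [← coe_schwartzFourier]
  exact (schwartzFourier φ).integrable

/-- Fourier inversion in angular-frequency normalisation. -/
lemma integral_planeFourier_mul_wave (φ : 𝓢(Plane, ℂ)) (k : Plane) :
    ∫ r, planeFourier φ r * wave k r = (2 * Real.pi) ^ 2 * φ k := by
  have h1 : 𝓕⁻ (𝓕 (φ : Plane → ℂ)) k = φ k := by
    have := congrFun (φ.continuous.fourierInv_fourier_eq φ.integrable (𝓕 φ).integrable) k
    exact this
  rw [Real.fourierInv_eq'] at h1
  have h2 : ∀ v : Plane, Complex.exp (((2 * Real.pi * inner ℝ v k : ℝ) : ℂ) * Complex.I) •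
      𝓕 (φ : Plane → ℂ) v = (fun r => planeFourier φ r * wave k r) ((2 * Real.pi) • v) := by
    intro v
    simp only [fourier_eq_planeFourier, smul_eq_mul, wave]
    rw [mul_comm, inner_smul_right, real_inner_comm, mul_comm Complex.I]
  simp only [h2] at h1
  rw [Measure.integral_comp_smul volume (fun r => planeFourier φ r * wave k r), finrank_euclideanSpace, Fintype.card_fin] at h1
  rw [← h1, abs_of_nonneg (by positivity), Complex.real_smul]
  have hp : (Real.pi : ℂ) ≠ 0 := by exact_mod_cast Real.pi_ne_zero
  push_cast
  field_simp

lemma integral_planeFourier (φ : 𝓢(Plane, ℂ)) :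
    ∫ r, planeFourier φ r = (2 * Real.pi) ^ 2 * φ 0 := by
  simpa using integral_planeFourier_mul_wave φ 0

lemma eventually_eq_zero_of_notMem_tsupport {f : Plane → ℂ} (h : (0 : Plane) ∉ tsupport f) :
    ∃ ε > 0, ∀ k : Plane, ‖k‖ < ε → f k = 0 := by
  have := notMem_tsupport_iff_eventuallyEq.1 h
  obtain ⟨ε, hε, h⟩ := Metric.eventually_nhds_iff.1 this
  exact ⟨ε, hε, fun k hk => h (by simpa using hk)⟩

open LineDeriv in
lemma exists_schwartz_deriv (φ : 𝓢(Plane, ℂ)) (j : Fin 2) : ∃ ψ : 𝓢(Plane, ℂ),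
    (tsupport (ψ : Plane → ℂ) ⊆ tsupport (φ : Plane → ℂ)) ∧
    ∀ r, planeFourier ψ r = Complex.I * ((r j : ℝ) : ℂ) * planeFourier φ r := by
  let ψ : 𝓢(Plane, ℂ) := ∂_{(EuclideanSpace.single j (1 : ℝ) : Plane)} φ
  have hψ : ⇑ψ = fun x => fderiv ℝ φ x (EuclideanSpace.single j 1) := rfl
  refine ⟨ψ, ?_, fun r => ?_⟩
  · rw [hψ]
    exact tsupport_fderiv_apply_subset ℝ _
  · have := ψ.integrable (μ := volume)
    rw [hψ] at this ⊢
    exact planeFourier_fderiv φ.differentiable φ.integrable j this r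

/-- The second moments of `φ̂` vanish if `φ` vanishes near `0`. -/
lemma integral_norm_sq_mul_planeFourier (φ : 𝓢(Plane, ℂ)) (h : (0 : Plane) ∉ tsupport (φ : Plane → ℂ)) :
    Integrable (fun r : Plane => ((‖r‖ ^ 2 : ℝ) : ℂ) * planeFourier φ r) ∧
      ∫ r : Plane, ((‖r‖ ^ 2 : ℝ) : ℂ) * planeFourier φ r = 0 := by
  have key : ∀ j : Fin 2, Integrable (fun r : Plane => ((r j : ℝ) : ℂ) ^ 2 * planeFourier φ r) ∧
      ∫ r : Plane, ((r j : ℝ) : ℂ) ^ 2 * planeFourier φ r = 0 := by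
    intro j
    obtain ⟨ψ, hψ, e1⟩ := exists_schwartz_deriv φ j
    obtain ⟨χ, hχ, e2⟩ := exists_schwartz_deriv ψ j
    have e : ∀ r : Plane, ((r j : ℝ) : ℂ) ^ 2 * planeFourier φ r = -planeFourier χ r := by
      intro r
      rw [e2, e1]
      linear_combination (((r j : ℝ) : ℂ) ^ 2 * planeFourier φ r) * Complex.I_sq
    simp only [e]
    refine ⟨(integrable_planeFourier χ).neg, ?_⟩
    rw [integral_neg, integral_planeFourier,
      image_eq_zero_of_notMem_tsupport (fun hh => h (hψ (hχ hh)))]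
    simp
  have e : ∀ r : Plane, ((‖r‖ ^ 2 : ℝ) : ℂ) * planeFourier φ r =
      ((r 0 : ℝ) : ℂ) ^ 2 * planeFourier φ r + ((r 1 : ℝ) : ℂ) ^ 2 * planeFourier φ r := by
    intro r
    rw [norm_sq_eq]; push_cast; ring
  simp only [e]
  refine ⟨(key 0).1.add (key 1).1, ?_⟩
  rw [integral_add (key 0).1 (key 1).1, (key 0).2, (key 1).2, add_zero]

/-- Modulation of a Schwartz function translates its Fourier transform. -/
lemma exists_schwartz_modulation (φ : 𝓢(Plane, ℂ)) (a : Plane) : ∃ ψ : 𝓢(Plane, ℂ),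
    (∀ k, ψ k = wave (-a) k * φ k) ∧ ∀ r, planeFourier ψ r = planeFourier φ (r + a) := by
  have h2 : (2 * Real.pi) ≠ 0 := Real.two_pi_pos.ne'
  set b : Plane := (2 * Real.pi)⁻¹ • a with hb
  set ψ : 𝓢(Plane, ℂ) := 𝓕⁻ ((𝓕 φ).compSubConstCLM ℂ (-b)) with hψ
  have e : ∀ r, planeFourier ψ r = planeFourier φ (r + a) := by
    intro r
    have h1 : 𝓕 ψ = (𝓕 φ).compSubConstCLM ℂ (-b) := by
      rw [hψ, FourierTransform.fourier_fourierInv_eq]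
    have h3 : planeFourier ψ r = (𝓕 ψ : 𝓢(Plane, ℂ)) ((2 * Real.pi)⁻¹ • r) :=
      planeFourier_eq_fourier ψ r
    rw [h3, h1, compSubConstCLM_apply, sub_neg_eq_add, hb, ← smul_add, planeFourier_eq_fourier]
    rfl
  refine ⟨ψ, fun k => ?_, e⟩
  have h1 := integral_planeFourier_mul_wave ψ k
  have h3 := integral_planeFourier_mul_wave φ k
  simp only [e] at h1
  have h4 : ∀ r, planeFourier φ (r + a) * wave k r
      = (fun r => wave (-a) k * (planeFourier φ r * wave k r)) (r + a) := by
    intro r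
    have := wave_mul_neg k a
    simp only [wave_add_right]
    rw [wave_neg_comm a k, wave_comm a]
    linear_combination (-planeFourier φ (r + a) * wave k r) * this
  simp only [h4] at h1
  rw [integral_add_right_eq_self (μ := volume) (fun r => wave (-a) k * (planeFourier φ r * wave k r)) a,
    integral_const_mul, h3] at h1
  have hp : ((2 : ℂ) * Real.pi) ^ 2 ≠ 0 := by
    have : (Real.pi : ℂ) ≠ 0 := by exact_mod_cast Real.pi_ne_zero
    exact pow_ne_zero 2 (mul_ne_zero two_ne_zero this)
  refine mul_left_cancel₀ hp ?_
  rw [← h1]; ring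

/-- The reciprocal of a function of temperate growth that is bounded below by a positive constant
has temperate growth. -/
lemma hasTemperateGrowth_inv {f : Plane → ℝ} (hf : f.HasTemperateGrowth) {c : ℝ} (hc : 0 < c)
    (h : ∀ k, c < f k) : (fun k => (f k)⁻¹).HasTemperateGrowth := by
  have hu : UniqueDiffOn ℝ (Ioi c) := isOpen_Ioi.uniqueDiffOn
  have hd : ContDiffOn ℝ ∞ (fun x : ℝ => x⁻¹) (Ioi c) := fun x hx =>
    (contDiffAt_inv ℝ (hc.trans hx).ne').contDiffWithinAt
  refine Function.HasTemperateGrowth.comp' (g := fun x : ℝ => x⁻¹) (t := Ioi c) ?_ hu hd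
    (fun N => ?_) hf
  · rintro _ ⟨k, rfl⟩
    exact h k
  · refine ⟨0, ∑ n ∈ Finset.range (N + 1), (n.factorial : ℝ) * (c⁻¹) ^ (n + 1), by positivity, ?_⟩
    intro n hn x hx
    have hx0 : 0 < x := hc.trans hx
    rw [norm_iteratedFDerivWithin_eq_norm_iteratedDerivWithin,
      iteratedDerivWithin_eq_iteratedDeriv hu ((contDiffAt_inv ℝ hx0.ne').of_le le_top) hx,
      iteratedDeriv_eq_iterate, iter_deriv_inv]
    have e : ‖(-1 : ℝ) ^ n * (n.factorial : ℝ) * x ^ (-1 - n : ℤ)‖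
        = (n.factorial : ℝ) * (x⁻¹) ^ (n + 1) := by
      rw [norm_mul, norm_mul, norm_pow, norm_neg, norm_one, one_pow, one_mul,
        Real.norm_of_nonneg (by positivity), Real.norm_of_nonneg (by positivity)]
      congr 1
      rw [show (-1 - n : ℤ) = -((n + 1 : ℕ) : ℤ) by push_cast; ring, zpow_neg, zpow_natCast,
        inv_pow]
    rw [e, pow_zero, mul_one]
    have h1 : (n.factorial : ℝ) * (x⁻¹) ^ (n + 1) ≤ (n.factorial : ℝ) * (c⁻¹) ^ (n + 1) := by
      have : c ≤ x := le_of_lt hx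
      gcongr
    refine h1.trans (Finset.single_le_sum (f := fun n : ℕ => (n.factorial : ℝ) * (c⁻¹) ^ (n + 1))
      (fun _ _ => by positivity) (Finset.mem_range.2 (by omega)))

/-- Away from the origin a Schwartz function may be divided by `|k|⁴` and multiplied by a function
of temperate growth. -/
lemma exists_schwartz_div_norm_pow_four {P : Plane → ℂ} (hP : P.HasTemperateGrowth) (φ : 𝓢(Plane, ℂ))
    (h : (0 : Plane) ∉ tsupport (φ : Plane → ℂ)) :
    ∃ ψ : 𝓢(Plane, ℂ), ∀ k, ψ k = P k / ((‖k‖ ^ 4 : ℝ) : ℂ) * φ k := by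
  obtain ⟨ε, hε, hφ⟩ := eventually_eq_zero_of_notMem_tsupport h
  -- a bump function added to the denominator removes its zero outside the support of `φ`
  let b : ContDiffBump (0 : Plane) := ⟨ε / 2, ε, by positivity, by linarith⟩
  have hb : (b : Plane → ℝ).HasTemperateGrowth :=
    b.hasCompactSupport.hasTemperateGrowth b.contDiff
  have hf : (fun k : Plane => (‖k‖ ^ 2) ^ 2 + b k).HasTemperateGrowth :=
    ((Function.hasTemperateGrowth_norm_sq Plane).pow 2).add hb
  set c : ℝ := min 1 ((ε / 2) ^ 4) / 2 with hc
  have hc0 : 0 < c := by positivity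
  have hlow : ∀ k : Plane, c < (‖k‖ ^ 2) ^ 2 + b k := by
    intro k
    by_cases hk : ‖k‖ ≤ ε / 2
    · have h1 : b k = 1 := b.one_of_mem_closedBall (by simpa using hk)
      have : min 1 ((ε / 2) ^ 4) ≤ 1 := min_le_left _ _
      rw [h1]
      have : 0 ≤ (‖k‖ ^ 2) ^ 2 := by positivity
      linarith
    · have h1 : 0 ≤ b k := b.nonneg
      have h2 : (ε / 2) ^ 4 ≤ ‖k‖ ^ 4 := by
        have := (not_le.1 hk).le
        gcongr
      have : min 1 ((ε / 2) ^ 4) ≤ (ε / 2) ^ 4 := min_le_right _ _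
      have : 0 < (ε / 2) ^ 4 := by positivity
      nlinarith
  have hg : (fun k : Plane => P k * (((((‖k‖ ^ 2) ^ 2 + b k)⁻¹ : ℝ)) : ℂ)).HasTemperateGrowth :=
    hP.mul (Function.Complex.hasTemperateGrowth_ofReal.comp (hasTemperateGrowth_inv hf hc0 hlow))
  refine ⟨smulLeftCLM ℂ (fun k : Plane => P k * (((((‖k‖ ^ 2) ^ 2 + b k)⁻¹ : ℝ)) : ℂ)) φ, fun k => ?_⟩
  rw [smulLeftCLM_apply_apply hg]
  by_cases hk : ‖k‖ < ε
  · simp [hφ k hk]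
  · have : b k = 0 := b.zero_of_le_dist (by simpa using not_lt.1 hk)
    rw [this, add_zero, smul_eq_mul, div_eq_mul_inv]
    push_cast
    ring

/-! ### Gaussians and their derivatives -/

lemma integrable_ofReal {f : Plane → ℝ} (hf : Integrable f) :
    Integrable fun r => ((f r : ℝ) : ℂ) := hf.ofReal

/-- The Gaussian `e^{-t|r|²}`. -/
def gauss (t : ℝ) (r : Plane) : ℝ := Real.exp (-(t * ‖r‖ ^ 2))

lemma gauss_pos (t : ℝ) (r : Plane) : 0 < gauss t r := Real.exp_pos _

lemma contDiff_gauss (t : ℝ) : ContDiff ℝ ∞ (gauss t) := by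
  unfold gauss
  exact (contDiff_const.mul (contDiff_norm_sq ℝ)).neg.exp

lemma contDiff_pd {f : Plane → ℝ} (hf : ContDiff ℝ ∞ f) (j : Fin 2) : ContDiff ℝ ∞ (pd j f) :=
  (hf.fderiv_right (m := ∞) (by simp)).clm_apply contDiff_const

lemma integrable_norm_pow_mul_gauss (n : ℕ) {t : ℝ} (ht : 0 < t) :
    Integrable fun r : Plane => ‖r‖ ^ n * gauss t r := by
  have h := integrable_fun_norm_addHaar (volume : Measure Plane)
    (f := fun y : ℝ => y ^ n * Real.exp (-(t * y ^ 2)))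
  rw [finrank_euclideanSpace, Fintype.card_fin] at h
  refine h.2 ?_
  have h2 := integrableOn_rpow_mul_exp_neg_mul_sq ht (s := ((n + 1 : ℕ) : ℝ))
    (by push_cast; have : (0 : ℝ) ≤ n := n.cast_nonneg; linarith)
  refine h2.congr_fun (fun y hy => ?_) measurableSet_Ioi
  simp only [Real.rpow_natCast, smul_eq_mul, neg_mul]
  ring

lemma integrable_gauss {t : ℝ} (ht : 0 < t) : Integrable (gauss t) := by
  simpa using integrable_norm_pow_mul_gauss 0 ht

lemma integrable_norm_inv_mul_gauss {t : ℝ} (ht : 0 < t) :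
    Integrable fun r : Plane => ‖r‖⁻¹ * gauss t r := by
  have h := integrable_fun_norm_addHaar (volume : Measure Plane)
    (f := fun y : ℝ => y⁻¹ * Real.exp (-(t * y ^ 2)))
  rw [finrank_euclideanSpace, Fintype.card_fin] at h
  refine h.2 ?_
  have h2 := integrableOn_rpow_mul_exp_neg_mul_sq ht (s := 0) (by norm_num)
  refine h2.congr_fun (fun y hy => ?_) measurableSet_Ioi
  have hy : y ≠ 0 := ne_of_gt hy
  simp only [Real.rpow_zero, smul_eq_mul, neg_mul]
  field_simp
  simp

/-- The weight `|r|⁻¹ + |r|⁴` dominates all kernels. -/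
def weight (r : Plane) : ℝ := ‖r‖⁻¹ + ‖r‖ ^ 4

lemma weight_nonneg (r : Plane) : 0 ≤ weight r := by unfold weight; positivity

lemma measurable_weight : Measurable weight := by unfold weight; fun_prop

lemma integrable_weight_mul_gauss {t : ℝ} (ht : 0 < t) :
    Integrable fun r : Plane => weight r * gauss t r := by
  simp only [weight, add_mul]
  exact (integrable_norm_inv_mul_gauss ht).add (integrable_norm_pow_mul_gauss 4 ht)

lemma abs_coord_le (r : Plane) (j : Fin 2) : |r j| ≤ ‖r‖ := PiLp.norm_apply_le r j

lemma abs_kd_le (j l : Fin 2) : |kd j l| ≤ 1 := by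
  unfold kd; split_ifs <;> simp

lemma hasJet_gauss (t : ℝ) : HasJet univ (fun s => Real.exp (-(t * s)))
    (fun s => -t * Real.exp (-(t * s))) (fun s => t ^ 2 * Real.exp (-(t * s)))
    (fun s => -t ^ 3 * Real.exp (-(t * s))) := by
  have h : ∀ s, HasDerivAt (fun s => Real.exp (-(t * s))) (-t * Real.exp (-(t * s))) s := by
    intro s
    have := ((hasDerivAt_id s).const_mul t).neg.exp
    convert! this using 1
    simp; ring
  refine ⟨fun s _ => h s, fun s _ => ?_, fun s _ => ?_⟩
  · convert! (h s).const_mul (-t) using 1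
    ring
  · convert! (h s).const_mul (t ^ 2) using 1
    ring

lemma pd_gauss (t : ℝ) (j : Fin 2) (r : Plane) : pd j (gauss t) r = -2 * t * r j * gauss t r := by
  have := (hasJet_gauss t).pd1 (mem_univ (‖r‖ ^ 2)) j
  unfold gauss
  rw [this]; ring

lemma pd_pd_gauss (t : ℝ) (j l : Fin 2) (r : Plane) :
    pd j (pd l (gauss t)) r = (-2 * t * kd j l + 4 * t ^ 2 * (r j * r l)) * gauss t r := by
  have := (hasJet_gauss t).pd2 isOpen_univ (mem_univ (‖r‖ ^ 2)) j l
  unfold gauss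
  rw [this]; ring

lemma pd_pd_pd_gauss (t : ℝ) (j l m : Fin 2) (r : Plane) :
    pd j (pd l (pd m (gauss t))) r = (4 * t ^ 2 * (kd j l * r m + kd j m * r l + kd l m * r j)
      - 8 * t ^ 3 * (r j * r l * r m)) * gauss t r := by
  have := (hasJet_gauss t).pd3 isOpen_univ (mem_univ (‖r‖ ^ 2)) j l m
  unfold gauss
  rw [this]; ring

lemma integrable_coord_mul_gauss {t : ℝ} (ht : 0 < t) (j : Fin 2) :
    Integrable fun r : Plane => r j * gauss t r := by
  refine (integrable_norm_pow_mul_gauss 1 ht).mono'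
    (by unfold gauss; fun_prop) (ae_of_all _ fun r => ?_)
  rw [norm_mul, Real.norm_of_nonneg (gauss_pos t r).le, pow_one]
  have := (gauss_pos t r).le
  gcongr
  exact abs_coord_le r j

lemma integrable_coord2_mul_gauss {t : ℝ} (ht : 0 < t) (j l : Fin 2) :
    Integrable fun r : Plane => r j * r l * gauss t r := by
  refine (integrable_norm_pow_mul_gauss 2 ht).mono'
    (by unfold gauss; fun_prop) (ae_of_all _ fun r => ?_)
  rw [norm_mul, norm_mul, Real.norm_of_nonneg (gauss_pos t r).le, pow_two]
  have := (gauss_pos t r).le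
  gcongr <;> exact abs_coord_le r _

lemma integrable_coord3_mul_gauss {t : ℝ} (ht : 0 < t) (j l m : Fin 2) :
    Integrable fun r : Plane => r j * r l * r m * gauss t r := by
  refine (integrable_norm_pow_mul_gauss 3 ht).mono'
    (by unfold gauss; fun_prop) (ae_of_all _ fun r => ?_)
  rw [norm_mul, norm_mul, norm_mul, Real.norm_of_nonneg (gauss_pos t r).le, pow_succ, pow_two]
  have := (gauss_pos t r).le
  gcongr <;> exact abs_coord_le r _

lemma integrable_pd_gauss {t : ℝ} (ht : 0 < t) (j : Fin 2) : Integrable (pd j (gauss t)) := by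
  have e : pd j (gauss t) = fun r => -2 * t * (r j * gauss t r) := by
    funext r; rw [pd_gauss]; ring
  rw [e]
  exact (integrable_coord_mul_gauss ht j).const_mul _

lemma integrable_pd_pd_gauss {t : ℝ} (ht : 0 < t) (j l : Fin 2) :
    Integrable (pd j (pd l (gauss t))) := by
  have e : pd j (pd l (gauss t))
      = fun r => -2 * t * kd j l * gauss t r + 4 * t ^ 2 * (r j * r l * gauss t r) := by
    funext r; rw [pd_pd_gauss]; ring
  rw [e]
  exact ((integrable_gauss ht).const_mul _).add ((integrable_coord2_mul_gauss ht j l).const_mul _)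

lemma integrable_pd_pd_pd_gauss {t : ℝ} (ht : 0 < t) (j l m : Fin 2) :
    Integrable (pd j (pd l (pd m (gauss t)))) := by
  have e : pd j (pd l (pd m (gauss t)))
      = fun r => 4 * t ^ 2 * kd j l * (r m * gauss t r) + 4 * t ^ 2 * kd j m * (r l * gauss t r)
        + 4 * t ^ 2 * kd l m * (r j * gauss t r) + -8 * t ^ 3 * (r j * r l * r m * gauss t r) := by
    funext r; rw [pd_pd_pd_gauss]; ring
  rw [e]
  exact ((((integrable_coord_mul_gauss ht m).const_mul _).add
    ((integrable_coord_mul_gauss ht l).const_mul _)).add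
    ((integrable_coord_mul_gauss ht j).const_mul _)).add
    ((integrable_coord3_mul_gauss ht j l m).const_mul _)

/-- The Fourier transform of `e^{-t|r|²}`. -/
def gaussHat (t : ℝ) (k : Plane) : ℝ := Real.pi / t * Real.exp (-(‖k‖ ^ 2 / (4 * t)))

lemma planeFourier_gauss {t : ℝ} (ht : 0 < t) (k : Plane) :
    planeFourier (fun r => ((gauss t r : ℝ) : ℂ)) k = (gaussHat t k : ℂ) :=
  planeFourier_gaussian ht k

lemma differentiable_of_contDiff {f : Plane → ℝ} (hf : ContDiff ℝ ∞ f) : Differentiable ℝ f :=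
  hf.differentiable (by simp)

lemma planeFourier_pd_pd_gauss {t : ℝ} (ht : 0 < t) (j l : Fin 2) (k : Plane) :
    planeFourier (fun r => ((pd j (pd l (gauss t)) r : ℝ) : ℂ)) k
      = ((-(k j * k l) * gaussHat t k : ℝ) : ℂ) := by
  rw [planeFourier_pd (differentiable_of_contDiff (contDiff_pd (contDiff_gauss t) l))
      (integrable_pd_gauss ht l) j (integrable_pd_pd_gauss ht j l),
    planeFourier_pd (differentiable_of_contDiff (contDiff_gauss t)) (integrable_gauss ht) l
      (integrable_pd_gauss ht l), planeFourier_gauss ht]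
  push_cast
  linear_combination ((k j : ℝ) : ℂ) * ((k l : ℝ) : ℂ) * (gaussHat t k : ℂ) * Complex.I_sq

lemma planeFourier_pd_pd_pd_gauss {t : ℝ} (ht : 0 < t) (j l m : Fin 2) (k : Plane) :
    planeFourier (fun r => ((pd j (pd l (pd m (gauss t))) r : ℝ) : ℂ)) k
      = Complex.I * ((-(k j * k l * k m) * gaussHat t k : ℝ) : ℂ) := by
  rw [planeFourier_pd (differentiable_of_contDiff (contDiff_pd (contDiff_pd (contDiff_gauss t) m) l))
      (integrable_pd_pd_gauss ht l m) j (integrable_pd_pd_pd_gauss ht j l m),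
    planeFourier_pd_pd_gauss ht]
  push_cast
  ring

/-! ### The Hasimoto screening function -/

lemma hasimoto_eq (ξ : ℝ) (r : Plane) :
    hasimoto ξ r = ξ ^ 2 / Real.pi * (2 * gauss (ξ ^ 2) r - ξ ^ 2 * (‖r‖ ^ 2 * gauss (ξ ^ 2) r)) := by
  rw [hasimoto, gauss]; ring

lemma continuous_hasimoto (ξ : ℝ) : Continuous (hasimoto ξ) := by unfold hasimoto; fun_prop

lemma integrable_hasimoto {ξ : ℝ} (hξ : 0 < ξ) : Integrable (hasimoto ξ) := by
  have h2 : 0 < ξ ^ 2 := by positivity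
  have e : hasimoto ξ = fun r => ξ ^ 2 / Real.pi *
      (2 * gauss (ξ ^ 2) r - ξ ^ 2 * (‖r‖ ^ 2 * gauss (ξ ^ 2) r)) := funext (hasimoto_eq ξ)
  rw [e]
  exact (((integrable_gauss h2).const_mul 2).sub
    ((integrable_norm_pow_mul_gauss 2 h2).const_mul _)).const_mul _

lemma hasimoto_neg (ξ : ℝ) (r : Plane) : hasimoto ξ (-r) = hasimoto ξ r := by
  simp [hasimoto]

lemma mul_exp_neg_le (x : ℝ) : x * Real.exp (-x) ≤ 1 := by
  have h1 := Real.add_one_le_exp x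
  have h2 : Real.exp x * Real.exp (-x) = 1 := by rw [← Real.exp_add]; simp
  have h3 := Real.exp_pos (-x)
  nlinarith

/-- `γ` is dominated by a Gaussian with half the exponent. -/
lemma abs_hasimoto_le {ξ : ℝ} (hξ : 0 < ξ) (r : Plane) :
    |hasimoto ξ r| ≤ 4 * ξ ^ 2 / Real.pi * gauss (ξ ^ 2 / 2) r := by
  set x := ξ ^ 2 * ‖r‖ ^ 2 with hx
  have hx0 : 0 ≤ x := by positivity
  have h1 : gauss (ξ ^ 2 / 2) r = Real.exp (-(x / 2)) := by rw [gauss, hx]; congr 1; ring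
  have h2 : Real.exp (-x) = Real.exp (-(x / 2)) * Real.exp (-(x / 2)) := by
    rw [← Real.exp_add]; congr 1; ring
  have h3 := mul_exp_neg_le (x / 2)
  have h4 := Real.exp_pos (-(x / 2))
  have h5 : Real.exp (-(x / 2)) ≤ 1 := by rw [Real.exp_le_one_iff]; linarith
  have h6 : |Real.exp (-x) * (2 - x)| ≤ 4 * Real.exp (-(x / 2)) := by
    rw [abs_le, h2]
    constructor <;> nlinarith
  have hp := Real.pi_pos
  rw [hasimoto, ← hx, mul_assoc, abs_mul, abs_of_pos (by positivity), h1]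
  calc ξ ^ 2 / Real.pi * |Real.exp (-x) * (2 - x)|
      ≤ ξ ^ 2 / Real.pi * (4 * Real.exp (-(x / 2))) := by gcongr
    _ = _ := by ring

lemma abs_hasimoto_le_const {ξ : ℝ} (hξ : 0 < ξ) (r : Plane) :
    |hasimoto ξ r| ≤ 4 * ξ ^ 2 / Real.pi := by
  have hp := Real.pi_pos
  refine (abs_hasimoto_le hξ r).trans (mul_le_of_le_one_right (by positivity) ?_)
  rw [gauss, Real.exp_le_one_iff, neg_nonpos]
  positivity

lemma planeFourier_hasimoto {ξ : ℝ} (hξ : 0 < ξ) (k : Plane) :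
    planeFourier (fun r => (hasimoto ξ r : ℂ)) k = (hasimotoHat ξ k : ℂ) := by
  have h2 : 0 < ξ ^ 2 := by positivity
  have hp := Real.pi_pos.ne'
  have hx := hξ.ne'
  have e : (fun r => (hasimoto ξ r : ℂ)) = fun r =>
      ((ξ ^ 2 / Real.pi : ℝ) : ℂ) * ((gauss (ξ ^ 2) r : ℝ) : ℂ)
      + ((-(1 / (4 * Real.pi)) : ℝ) : ℂ) * (((pd 0 (pd 0 (gauss (ξ ^ 2))) r : ℝ) : ℂ)
        + ((pd 1 (pd 1 (gauss (ξ ^ 2))) r : ℝ) : ℂ)) := by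
    funext r
    rw [hasimoto_eq, pd_pd_gauss, pd_pd_gauss, norm_sq_eq]
    simp only [← Complex.ofReal_mul, ← Complex.ofReal_add]
    congr 1
    simp only [kd, if_true]
    field_simp
    ring
  have i0 := integrable_ofReal (integrable_pd_pd_gauss h2 0 0)
  have i1 := integrable_ofReal (integrable_pd_pd_gauss h2 1 1)
  have i01 : Integrable fun r => ((pd 0 (pd 0 (gauss (ξ ^ 2))) r : ℝ) : ℂ)
      + ((pd 1 (pd 1 (gauss (ξ ^ 2))) r : ℝ) : ℂ) := i0.add i1
  have ig := integrable_ofReal (integrable_gauss h2)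
  rw [e, planeFourier_add (ig.const_mul _) (i01.const_mul _),
    planeFourier_const_mul, planeFourier_const_mul, planeFourier_add i0 i1,
    planeFourier_pd_pd_gauss h2, planeFourier_pd_pd_gauss h2, planeFourier_gauss h2]
  simp only [← Complex.ofReal_mul, ← Complex.ofReal_add]
  congr 1
  rw [hasimotoHat, gaussHat, norm_sq_eq]
  field_simp
  ring

lemma integral_hasimoto {ξ : ℝ} (hξ : 0 < ξ) : ∫ r, hasimoto ξ r = 1 := by
  have := planeFourier_hasimoto hξ 0
  rw [planeFourier_eq] at this
  simp only [neg_zero, wave_zero_left, mul_one] at this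
  rw [integral_complex_ofReal] at this
  have h2 : hasimotoHat ξ 0 = 1 := by simp [hasimotoHat]
  rw [h2] at this
  exact_mod_cast this

lemma integrable_norm_sq_mul_hasimoto {ξ : ℝ} (hξ : 0 < ξ) :
    Integrable fun r : Plane => ‖r‖ ^ 2 * hasimoto ξ r := by
  have h2 : 0 < ξ ^ 2 := by positivity
  have e : (fun r : Plane => ‖r‖ ^ 2 * hasimoto ξ r) = fun r => ξ ^ 2 / Real.pi *
      (2 * (‖r‖ ^ 2 * gauss (ξ ^ 2) r) - ξ ^ 2 * (‖r‖ ^ 4 * gauss (ξ ^ 2) r)) := by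
    funext r; rw [hasimoto_eq]; ring
  rw [e]
  exact (((integrable_norm_pow_mul_gauss 2 h2).const_mul 2).sub
    ((integrable_norm_pow_mul_gauss 4 h2).const_mul _)).const_mul _

/-- The second moment of `γ` vanishes. -/
lemma integral_norm_sq_mul_hasimoto {ξ : ℝ} (hξ : 0 < ξ) :
    ∫ r : Plane, ‖r‖ ^ 2 * hasimoto ξ r = 0 := by
  have h2 : 0 < ξ ^ 2 := by positivity
  have hi := integrable_norm_sq_mul_hasimoto hξ
  set F : ℝ → ℝ := fun y => y ^ 2 * (ξ ^ 2 / Real.pi * Real.exp (-(ξ ^ 2 * y ^ 2)) *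
    (2 - ξ ^ 2 * y ^ 2)) with hF
  have e : (fun r : Plane => ‖r‖ ^ 2 * hasimoto ξ r) = fun r => F ‖r‖ := by
    funext r; rw [hasimoto]
  rw [e] at hi ⊢
  rw [integrable_fun_norm_addHaar] at hi
  rw [integral_fun_norm_addHaar]
  rw [finrank_euclideanSpace, Fintype.card_fin] at *
  have key : ∫ y in Ioi (0 : ℝ), y ^ (2 - 1) • F y
      = 0 - ξ ^ 2 / (2 * Real.pi) * (0 ^ 4 * Real.exp (-(ξ ^ 2 * 0 ^ 2))) := by
    refine integral_Ioi_of_hasDerivAt_of_tendsto'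
      (f := fun y => ξ ^ 2 / (2 * Real.pi) * (y ^ 4 * Real.exp (-(ξ ^ 2 * y ^ 2))))
      (fun y _ => ?_) hi ?_
    · have h := ((hasDerivAt_pow 4 y).mul (((hasDerivAt_pow 2 y).const_mul (ξ ^ 2)).neg.exp)).const_mul
        (ξ ^ 2 / (2 * Real.pi))
      convert! h using 1
      simp only [hF, smul_eq_mul, Pi.neg_apply]
      push_cast
      field_simp
      ring
    · have h1 : Tendsto (fun x : ℝ => x ^ 2 * Real.exp (-x)) atTop (𝓝 0) :=
        Real.tendsto_pow_mul_exp_neg_atTop_nhds_zero 2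
      have h3 : Tendsto (fun y : ℝ => ξ ^ 2 * y ^ 2) atTop atTop :=
        (tendsto_pow_atTop two_ne_zero).const_mul_atTop h2
      have h4 := (h1.comp h3).const_mul (1 / (2 * Real.pi * ξ ^ 2))
      rw [mul_zero] at h4
      refine h4.congr fun y => ?_
      simp only [Function.comp]
      field_simp
  rw [key]
  simp

lemma integral_norm_sub_sq_mul_hasimoto {ξ : ℝ} (hξ : 0 < ξ) (r : Plane) :
    Integrable (fun s => ‖r - s‖ ^ 2 * hasimoto ξ s) ∧
      ∫ s, ‖r - s‖ ^ 2 * hasimoto ξ s = ‖r‖ ^ 2 := by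
  have i0 := (integrable_hasimoto hξ).const_mul (‖r‖ ^ 2)
  have i2 := integrable_norm_sq_mul_hasimoto hξ
  have e : ∀ s, ‖r - s‖ ^ 2 * hasimoto ξ s = (‖r‖ ^ 2 * hasimoto ξ s + ‖s‖ ^ 2 * hasimoto ξ s)
      + -2 * (inner ℝ r s * hasimoto ξ s) := by
    intro s; rw [norm_sub_sq_real]; ring
  have i1 : Integrable (fun s => inner ℝ r s * hasimoto ξ s) := by
    refine (i0.norm.add i2.norm).mono' (by unfold hasimoto; fun_prop) (ae_of_all _ fun s => ?_)
    simp only [Pi.add_apply, norm_mul, norm_pow, norm_norm]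
    rw [← add_mul]
    gcongr
    have := norm_inner_le_norm (𝕜 := ℝ) r s
    nlinarith [sq_nonneg (‖r‖ - ‖s‖), sq_nonneg ‖r‖, sq_nonneg ‖s‖]
  have z : ∫ s, inner ℝ r s * hasimoto ξ s = 0 := by
    have := integral_neg_eq_self (μ := volume) fun s => inner ℝ r s * hasimoto ξ s
    simp only [inner_neg_right, hasimoto_neg, neg_mul] at this
    rw [integral_neg] at this
    linarith
  have i02 : Integrable fun s => ‖r‖ ^ 2 * hasimoto ξ s + ‖s‖ ^ 2 * hasimoto ξ s := i0.add i2
  simp only [e]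
  refine ⟨i02.add (i1.const_mul _), ?_⟩
  rw [integral_add i02 (i1.const_mul _), integral_add i0 i2, integral_const_mul,
    integral_const_mul, integral_hasimoto hξ, integral_norm_sq_mul_hasimoto hξ, z]
  ring

lemma integrable_weight_mul_hasimoto {ξ : ℝ} (hξ : 0 < ξ) (r : Plane) :
    Integrable (fun s => weight (r - s) * hasimoto ξ s) := by
  have h4 : 0 < ξ ^ 2 / 4 := by positivity
  have h := ((integrable_weight_mul_gauss h4).comp_sub_left r).const_mul
    (4 * ξ ^ 2 / Real.pi * Real.exp (ξ ^ 2 / 2 * ‖r‖ ^ 2))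
  refine h.mono' ?_ (ae_of_all _ fun s => ?_)
  · exact ((measurable_weight.comp (measurable_const.sub measurable_id)).mul
      (continuous_hasimoto ξ).measurable).aestronglyMeasurable
  · rw [norm_mul, Real.norm_of_nonneg (weight_nonneg _)]
    have h1 : gauss (ξ ^ 2 / 2) s
        ≤ Real.exp (ξ ^ 2 / 2 * ‖r‖ ^ 2) * gauss (ξ ^ 2 / 4) (r - s) := by
      rw [gauss, gauss, ← Real.exp_add, Real.exp_le_exp]
      have h2 : ‖r - s‖ ^ 2 ≤ 2 * ‖r‖ ^ 2 + 2 * ‖s‖ ^ 2 := by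
        have h3 := norm_sub_le r s
        nlinarith [sq_nonneg (‖r‖ - ‖s‖), norm_nonneg (r - s)]
      have : 0 < ξ ^ 2 := by positivity
      nlinarith
    have hp := Real.pi_pos
    have hw := weight_nonneg (r - s)
    calc weight (r - s) * ‖hasimoto ξ s‖
        ≤ weight (r - s) * (4 * ξ ^ 2 / Real.pi *
          (Real.exp (ξ ^ 2 / 2 * ‖r‖ ^ 2) * gauss (ξ ^ 2 / 4) (r - s))) := by
          gcongr
          exact (abs_hasimoto_le hξ s).trans (by gcongr)
      _ = _ := by ring

lemma integrable_weight_mul_schwartz (φ : SchwartzMap Plane ℂ) :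
    Integrable (fun r => weight r * ‖φ r‖) := by
  have h4 := φ.integrable_pow_mul volume 4
  have h0 := φ.integrable_pow_mul volume 0
  simp only [pow_zero, one_mul] at h0
  obtain ⟨C, hC⟩ : ∃ C, ∀ r, ‖φ r‖ ≤ C :=
    ⟨_, fun r => SchwartzMap.norm_le_seminorm ℝ φ r⟩
  have hg := (integrable_norm_inv_mul_gauss (t := 1) one_pos).const_mul (C * Real.exp 1)
  refine ((h0.add hg).add h4).mono' ?_ (ae_of_all _ fun r => ?_)
  · exact (measurable_weight.mul φ.continuous.norm.measurable).aestronglyMeasurable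
  · rw [norm_mul, norm_norm, Real.norm_of_nonneg (weight_nonneg _), weight, add_mul]
    simp only [Pi.add_apply]
    gcongr
    have hC0 : 0 ≤ C := (norm_nonneg _).trans (hC 0)
    by_cases hr : 1 ≤ ‖r‖
    · have h1 : ‖r‖⁻¹ ≤ 1 := inv_le_one_of_one_le₀ hr
      have h2 : 0 ≤ C * Real.exp 1 * (‖r‖⁻¹ * gauss 1 r) := by
        have := (gauss_pos 1 r).le
        positivity
      nlinarith [norm_nonneg (φ r)]
    · have h1 : 1 ≤ Real.exp 1 * gauss 1 r := by
        rw [gauss, ← Real.exp_add, Real.one_le_exp_iff]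
        have : ‖r‖ ≤ 1 := (not_le.1 hr).le
        nlinarith [norm_nonneg r]
      have h2 : 0 ≤ ‖r‖⁻¹ := by positivity
      calc ‖r‖⁻¹ * ‖φ r‖ ≤ ‖r‖⁻¹ * C := by gcongr; exact hC r
        _ = ‖r‖⁻¹ * C * 1 := by ring
        _ ≤ ‖r‖⁻¹ * C * (Real.exp 1 * gauss 1 r) := by gcongr
        _ = C * Real.exp 1 * (‖r‖⁻¹ * gauss 1 r) := by ring
        _ ≤ _ := by linarith [norm_nonneg (φ r)]

/-! ### Convolution with the screening function -/

lemma ae_ne_zero : ∀ᵐ r : Plane, r ≠ 0 := by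
  simp [ae_iff]

section Screened

variable {f : Plane → ℝ} {ξ : ℝ}

lemma screened_eq_integral_sub (ξ : ℝ) (f : Plane → ℝ) (r : Plane) :
    screened ξ f r = ∫ s, f s * hasimoto ξ (r - s) := by
  have := integral_sub_left_eq_self (fun s => f s * hasimoto ξ (r - s)) volume r
  simp only [sub_sub_cancel] at this
  rw [← this, screened]

lemma continuous_screened (hξ : 0 < ξ) (hf : Integrable f) : Continuous (screened ξ f) := by
  have e : screened ξ f = fun r => ∫ s, f s * hasimoto ξ (r - s) :=
    funext (screened_eq_integral_sub ξ f)
  rw [e]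
  refine continuous_of_dominated (bound := fun s => ‖f s‖ * (4 * ξ ^ 2 / Real.pi)) ?_ ?_
    (hf.norm.mul_const _) ?_
  · exact fun r => hf.aestronglyMeasurable.mul
      ((continuous_hasimoto ξ).comp (continuous_const.sub continuous_id)).aestronglyMeasurable
  · refine fun r => ae_of_all _ fun s => ?_
    rw [norm_mul]
    gcongr
    exact abs_hasimoto_le_const hξ _
  · exact ae_of_all _ fun s => continuous_const.mul
      ((continuous_hasimoto ξ).comp (continuous_id.sub continuous_const))

lemma abs_screened_le (hξ : 0 < ξ) (hf : Integrable f) (r : Plane) :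
    |screened ξ f r| ≤ (∫ s, ‖f s‖) * (4 * ξ ^ 2 / Real.pi) := by
  rw [screened_eq_integral_sub, ← Real.norm_eq_abs, ← integral_mul_const]
  refine norm_integral_le_of_norm_le (hf.norm.mul_const _) (ae_of_all _ fun s => ?_)
  rw [norm_mul]
  gcongr
  exact abs_hasimoto_le_const hξ _

lemma screened_eq_convolution (ξ : ℝ) (f : Plane → ℝ) (r : Plane) :
    ((screened ξ f r : ℝ) : ℂ) = convolution (fun s => (hasimoto ξ s : ℂ)) (fun s => (f s : ℂ))
      (ContinuousLinearMap.mul ℂ ℂ) volume r := by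
  rw [screened, convolution_def, ← integral_complex_ofReal]
  refine integral_congr_ae (ae_of_all _ fun s => ?_)
  simp [mul_comm]

lemma integrable_screened_ofReal (hξ : 0 < ξ) (hf : Integrable f) :
    Integrable fun r => ((screened ξ f r : ℝ) : ℂ) := by
  simp only [screened_eq_convolution]
  exact (integrable_hasimoto hξ).ofReal.integrable_convolution _ hf.ofReal

lemma planeFourier_screened (hξ : 0 < ξ) (hf : Integrable f) (k : Plane) :
    planeFourier (fun r => ((screened ξ f r : ℝ) : ℂ)) k
      = (hasimotoHat ξ k : ℂ) * planeFourier (fun r => (f r : ℂ)) k := by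
  simp only [screened_eq_convolution]
  rw [← planeFourier_hasimoto hξ]
  simp only [planeFourier_eq_fourier]
  exact Real.fourier_mul_convolution_eq (integrable_hasimoto hξ).ofReal hf.ofReal _

end Screened

/-- The pointwise form of Fourier uniqueness used to compare functions given by integrals: it
needs no information at `k = 0`, and only continuity at the point in question. -/
lemma eq_zero_of_planeFourier_eq_zero {f : Plane → ℂ} (hf : Integrable f)
    (h : ∀ k, k ≠ 0 → planeFourier f k = 0) {r : Plane} (hr : ContinuousAt f r) : f r = 0 := by
  have h0 : FourierTransform.fourier f = 0 := by
    have h1 : planeFourier f = 0 := by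
      refine Continuous.ext_on (dense_compl_singleton (0 : Plane)) (continuous_planeFourier hf)
        continuous_zero fun k hk => h k hk
    funext k
    rw [fourier_eq_planeFourier, h1]
    rfl
  have := hf.fourierInv_fourier_eq (by rw [h0]; exact integrable_zero _ _ _) hr
  rw [← this, h0, Real.fourierInv_eq']
  simp

lemma hasimotoHat_nonneg (ξ : ℝ) (k : Plane) : 0 ≤ hasimotoHat ξ k := by
  unfold hasimotoHat; positivity

lemma hasimotoHat_le_one (ξ : ℝ) (k : Plane) : hasimotoHat ξ k ≤ 1 := by
  rw [hasimotoHat]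
  set a := ‖k‖ ^ 2 / (4 * ξ ^ 2)
  have h1 := Real.add_one_le_exp a
  have h2 : Real.exp a * Real.exp (-a) = 1 := by rw [← Real.exp_add]; simp
  have h3 := Real.exp_pos (-a)
  nlinarith

lemma tendsto_hasimotoHat_zero {k : Plane} (hk : k ≠ 0) :
    Tendsto (fun η => hasimotoHat η k) (𝓝[>] 0) (𝓝 0) := by
  have hk' : 0 < ‖k‖ := norm_pos_iff.2 hk
  have h1 : Tendsto (fun x : ℝ => (1 + x) * Real.exp (-x)) atTop (𝓝 0) := by
    have h2 := (Real.tendsto_pow_mul_exp_neg_atTop_nhds_zero 0).add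
      (Real.tendsto_pow_mul_exp_neg_atTop_nhds_zero 1)
    rw [add_zero] at h2
    exact h2.congr fun x => by ring
  refine h1.comp ?_
  have h3 : Tendsto (fun η : ℝ => 4 * η ^ 2) (𝓝[>] 0) (𝓝[>] 0) := by
    refine tendsto_nhdsWithin_iff.2 ⟨?_, ?_⟩
    · have : Tendsto (fun η : ℝ => 4 * η ^ 2) (𝓝 0) (𝓝 (4 * 0 ^ 2)) :=
        (by fun_prop : Continuous fun η : ℝ => 4 * η ^ 2).tendsto 0
      simpa using this.mono_left nhdsWithin_le_nhds
    · filter_upwards [self_mem_nhdsWithin] with η hη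
      have : 0 < η := hη
      exact mem_Ioi.2 (by positivity)
  have h4 : Tendsto (fun η : ℝ => ‖k‖ ^ 2 * (4 * η ^ 2)⁻¹) (𝓝[>] 0) atTop :=
    (tendsto_inv_nhdsGT_zero.comp h3).const_mul_atTop (by positivity)
  simpa only [div_eq_mul_inv] using h4

/-- A kernel `K` with Fourier transform `P(k) / |k|⁴`, together with candidates `R ξ` for its
real-space part: `R ξ` is integrable with Fourier transform `(1 - γ̂) P / |k|⁴`, and `R η` converges
to `K` as `η → 0` after subtraction of a polynomial `a(η) + b(η) |r|²`. Such polynomials are invisible both to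
convolution with `δ - γ` and to the Fourier transform away from `0`. -/
structure ScreenedKernel (K : Plane → ℝ) (R : ℝ → Plane → ℝ) (P : Plane → ℂ) (a b : ℝ → ℝ) :
    Prop where
  continuousOn : ∀ ξ, 0 < ξ → ContinuousOn (R ξ) {0}ᶜ
  integrable : ∀ ξ, 0 < ξ → Integrable (R ξ)
  decay : ∀ ξ, 0 < ξ → ∃ C, ∀ r, 1 ≤ ‖r‖ → |R ξ r| ≤ C / ‖r‖ ^ 4
  fourier : ∀ ξ, 0 < ξ → ∀ k, k ≠ 0 → planeFourier (fun r => (R ξ r : ℂ)) k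
    = ((1 - hasimotoHat ξ k : ℝ) : ℂ) * (P k / ((‖k‖ ^ 4 : ℝ) : ℂ))
  temperate : P.HasTemperateGrowth
  bound : ∃ C, ∀ η, 0 < η → η ≤ 1 → ∀ r, r ≠ 0 → |R η r - (a η + b η * ‖r‖ ^ 2)| ≤ C * weight r
  limit : ∀ r, r ≠ 0 → Tendsto (fun η => R η r - (a η + b η * ‖r‖ ^ 2)) (𝓝[>] 0) (𝓝 (K r))

namespace ScreenedKernel

variable {K : Plane → ℝ} {R : ℝ → Plane → ℝ} {P : Plane → ℂ} {a b : ℝ → ℝ}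

lemma eventually_le_one : ∀ᶠ η : ℝ in 𝓝[>] 0, 0 < η ∧ η ≤ 1 := by
  filter_upwards [Ioc_mem_nhdsGT (zero_lt_one (α := ℝ))] with η hη using hη

lemma kernel_bound (h : ScreenedKernel K R P a b) : ∃ C, 0 ≤ C ∧ ∀ r, r ≠ 0 → |K r| ≤ C * weight r := by
  obtain ⟨C, hC⟩ := h.bound
  refine ⟨|C|, abs_nonneg _, fun r hr => ?_⟩
  refine (le_of_tendsto (h.limit r hr).abs ?_).trans
    (mul_le_mul_of_nonneg_right (le_abs_self C) (weight_nonneg r))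
  filter_upwards [eventually_le_one] with η hη using hC η hη.1 hη.2 r hr

lemma continuousAt (h : ScreenedKernel K R P a b) {ξ : ℝ} (hξ : 0 < ξ) {r : Plane} (hr : r ≠ 0) :
    ContinuousAt (R ξ) r :=
  (h.continuousOn ξ hξ).continuousAt (isOpen_ne.mem_nhds hr)

lemma aestronglyMeasurable_sub_poly (h : ScreenedKernel K R P a b) {η : ℝ} (hη : 0 < η) :
    AEStronglyMeasurable (fun r => R η r - (a η + b η * ‖r‖ ^ 2)) volume :=
  (h.integrable η hη).aestronglyMeasurable.sub
    (by fun_prop : Continuous fun r : Plane => a η + b η * ‖r‖ ^ 2).aestronglyMeasurable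

lemma aestronglyMeasurable (h : ScreenedKernel K R P a b) : AEStronglyMeasurable K volume := by
  have hu : Tendsto (fun n : ℕ => 1 / ((n : ℝ) + 1)) atTop (𝓝[>] 0) :=
    tendsto_nhdsWithin_iff.2 ⟨tendsto_one_div_add_atTop_nhds_zero_nat,
      Eventually.of_forall fun n => mem_Ioi.2 (by positivity)⟩
  refine aestronglyMeasurable_of_tendsto_ae atTop
    (f := fun (n : ℕ) r => R (1 / ((n : ℝ) + 1)) r - (a (1 / ((n : ℝ) + 1)) + b (1 / ((n : ℝ) + 1)) * ‖r‖ ^ 2))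
    (fun n => h.aestronglyMeasurable_sub_poly (by positivity)) ?_
  filter_upwards [ae_ne_zero] with r hr
  exact (h.limit r hr).comp hu

lemma ae_sub_ne_zero (r : Plane) : ∀ᵐ s : Plane, r - s ≠ 0 := by
  have : ∀ᵐ s : Plane, s ≠ r := by simp [ae_iff]
  filter_upwards [this] with s hs
  exact sub_ne_zero.2 hs.symm

lemma integrable_mul_hasimoto (h : ScreenedKernel K R P a b) {ξ : ℝ} (hξ : 0 < ξ) (r : Plane) :
    Integrable fun s => K (r - s) * hasimoto ξ s := by
  obtain ⟨C, hC0, hC⟩ := h.kernel_bound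
  refine ((integrable_weight_mul_hasimoto hξ r).norm.const_mul C).mono' ?_ ?_
  · refine AEStronglyMeasurable.mul ?_ (continuous_hasimoto ξ).aestronglyMeasurable
    exact h.aestronglyMeasurable.comp_quasiMeasurePreserving
      (quasiMeasurePreserving_sub_left volume r)
  · filter_upwards [ae_sub_ne_zero r] with s hs
    rw [norm_mul, norm_mul, Real.norm_of_nonneg (weight_nonneg _), ← mul_assoc]
    gcongr
    exact hC _ hs

/-- `(δ - γ_ξ) * R_η = (δ - γ_η) * R_ξ`, since both sides have the Fourier transform
`(1 - γ̂_ξ) (1 - γ̂_η) P / |k|⁴`. -/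
lemma sub_screened_symm (h : ScreenedKernel K R P a b) {ξ η : ℝ} (hξ : 0 < ξ) (hη : 0 < η)
    {r : Plane} (h1 : ContinuousAt (R ξ) r) (h2 : ContinuousAt (R η) r) :
    R η r - screened ξ (R η) r = R ξ r - screened η (R ξ) r := by
  have iη := h.integrable η hη
  have iξ := h.integrable ξ hξ
  have jη : Integrable fun r => (R η r : ℂ) := iη.ofReal
  have jξ : Integrable fun r => (R ξ r : ℂ) := iξ.ofReal
  have sη := integrable_screened_ofReal hξ iη
  have sξ := integrable_screened_ofReal hη iξ
  have dη : Integrable fun r => (R η r : ℂ) - ((screened ξ (R η) r : ℝ) : ℂ) := jη.sub sη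
  have dξ : Integrable fun r => (R ξ r : ℂ) - ((screened η (R ξ) r : ℝ) : ℂ) := jξ.sub sξ
  have key := eq_zero_of_planeFourier_eq_zero (r := r)
    (f := fun r => ((R η r : ℂ) - ((screened ξ (R η) r : ℝ) : ℂ))
      - ((R ξ r : ℂ) - ((screened η (R ξ) r : ℝ) : ℂ))) (dη.sub dξ) ?_ ?_
  · norm_cast at key
    linarith
  · intro k hk
    rw [planeFourier_sub dη dξ, planeFourier_sub jη sη, planeFourier_sub jξ sξ,
      planeFourier_screened hξ iη, planeFourier_screened hη iξ, h.fourier ξ hξ k hk,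
      h.fourier η hη k hk]
    push_cast
    ring
  · have c1 := (continuous_screened hξ iη).continuousAt (x := r)
    have c2 := (continuous_screened hη iξ).continuousAt (x := r)
    exact (((Complex.continuous_ofReal.continuousAt.comp h2).sub
      (Complex.continuous_ofReal.continuousAt.comp c1)).sub
      ((Complex.continuous_ofReal.continuousAt.comp h1).sub
      (Complex.continuous_ofReal.continuousAt.comp c2)))

/-- The splitting `K = R_ξ + K * γ_ξ`, obtained from `sub_screened_symm` as `η → 0`. -/
lemma eq_add_screened_of_limit (h : ScreenedKernel K R P a b) {ξ : ℝ} (hξ : 0 < ξ) {r : Plane}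
    (hc : ∀ η, 0 < η → ContinuousAt (R η) r)
    (hl : Tendsto (fun η => R η r - (a η + b η * ‖r‖ ^ 2)) (𝓝[>] 0) (𝓝 (K r))) :
    K r = R ξ r + screened ξ K r := by
  obtain ⟨C, hC⟩ := h.bound
  have l1 : Tendsto (fun η => ∫ s, (R η (r - s) - (a η + b η * ‖r - s‖ ^ 2)) * hasimoto ξ s)
      (𝓝[>] 0) (𝓝 (screened ξ K r)) := by
    refine tendsto_integral_filter_of_dominated_convergence
      (fun s => C * (weight (r - s) * |hasimoto ξ s|)) ?_ ?_ ?_ ?_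
    · filter_upwards [self_mem_nhdsWithin] with η hη
      refine AEStronglyMeasurable.mul ?_ (continuous_hasimoto ξ).aestronglyMeasurable
      exact (h.aestronglyMeasurable_sub_poly hη).comp_quasiMeasurePreserving
        (quasiMeasurePreserving_sub_left volume r)
    · filter_upwards [eventually_le_one] with η hη
      filter_upwards [ae_sub_ne_zero r] with s hs
      rw [norm_mul, ← mul_assoc]
      exact mul_le_mul_of_nonneg_right (hC η hη.1 hη.2 _ hs) (norm_nonneg _)
    · have := (integrable_weight_mul_hasimoto hξ r).norm.const_mul C
      refine this.congr (ae_of_all _ fun s => ?_)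
      simp only [norm_mul, Real.norm_of_nonneg (weight_nonneg _), Real.norm_eq_abs]
    · filter_upwards [ae_sub_ne_zero r] with s hs
      exact (h.limit _ hs).mul_const _
  have l2 : Tendsto (fun η => screened η (R ξ) r) (𝓝[>] 0) (𝓝 0) := by
    have l3 : Tendsto (fun η : ℝ => (∫ s, ‖R ξ s‖) * (4 * η ^ 2 / Real.pi)) (𝓝[>] 0) (𝓝 0) := by
      have : Tendsto (fun η : ℝ => (∫ s, ‖R ξ s‖) * (4 * η ^ 2 / Real.pi)) (𝓝 0)
          (𝓝 ((∫ s, ‖R ξ s‖) * (4 * 0 ^ 2 / Real.pi))) :=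
        (by fun_prop : Continuous fun η : ℝ => (∫ s, ‖R ξ s‖) * (4 * η ^ 2 / Real.pi)).tendsto 0
      simpa using this.mono_left nhdsWithin_le_nhds
    refine squeeze_zero_norm' ?_ l3
    filter_upwards [self_mem_nhdsWithin] with η hη
    exact abs_screened_le hη (h.integrable ξ hξ) r
  have l4 := (hl.sub l1).add l2
  have e : ∀ᶠ η in 𝓝[>] (0 : ℝ), R η r - (a η + b η * ‖r‖ ^ 2)
      - (∫ s, (R η (r - s) - (a η + b η * ‖r - s‖ ^ 2)) * hasimoto ξ s)
      + screened η (R ξ) r = R ξ r := by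
    filter_upwards [self_mem_nhdsWithin] with η hη
    have hs := h.sub_screened_symm hξ hη (hc ξ hξ) (hc η hη)
    obtain ⟨i2, e2⟩ := integral_norm_sub_sq_mul_hasimoto hξ r
    have i0 := integrable_hasimoto hξ
    have i1 : Integrable fun s => R η (r - s) * hasimoto ξ s :=
      ((h.integrable η hη).comp_sub_left r).mul_bdd (c := 4 * ξ ^ 2 / Real.pi)
        (continuous_hasimoto ξ).aestronglyMeasurable
        (ae_of_all _ fun s => abs_hasimoto_le_const hξ s)
    have e3 : ∀ s, (R η (r - s) - (a η + b η * ‖r - s‖ ^ 2)) * hasimoto ξ s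
        = R η (r - s) * hasimoto ξ s
          - (a η * hasimoto ξ s + b η * (‖r - s‖ ^ 2 * hasimoto ξ s)) := fun s => by ring
    have i02 : Integrable fun s => a η * hasimoto ξ s + b η * (‖r - s‖ ^ 2 * hasimoto ξ s) :=
      (i0.const_mul _).add (i2.const_mul _)
    simp only [e3]
    rw [integral_sub i1 i02, integral_add (i0.const_mul _) (i2.const_mul _),
      integral_const_mul, integral_const_mul, e2, integral_hasimoto hξ]
    change _ - (screened ξ (R η) r - _) + _ = _
    linarith
  have := tendsto_nhds_unique (tendsto_const_nhds.congr' (e.mono fun _ h => h.symm)) l4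
  linarith

lemma eq_add_screened (h : ScreenedKernel K R P a b) {ξ : ℝ} (hξ : 0 < ξ) {r : Plane} (hr : r ≠ 0) :
    K r = R ξ r + screened ξ K r :=
  h.eq_add_screened_of_limit hξ (fun _ hη => h.continuousAt hη hr) (h.limit r hr)

lemma integrable_mul_planeFourier (h : ScreenedKernel K R P a b) (φ : SchwartzMap Plane ℂ) :
    Integrable fun r => (K r : ℂ) * planeFourier φ r := by
  obtain ⟨C, hC0, hC⟩ := h.kernel_bound
  have := (integrable_weight_mul_schwartz (schwartzFourier φ)).const_mul C
  simp only [schwartzFourier_apply] at this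
  refine this.mono' ?_ ?_
  · exact (Complex.continuous_ofReal.comp_aestronglyMeasurable h.aestronglyMeasurable).mul
      (continuous_planeFourier φ.integrable).aestronglyMeasurable
  · filter_upwards [ae_ne_zero] with r hr
    rw [norm_mul, Complex.norm_real, ← mul_assoc]
    gcongr
    exact hC r hr

/-- The Fourier transform of `K` is the limit of those of `R_η` as `η → 0`. The polynomial
`a(η) + b(η) |r|²` is paired with `φ̂` to a combination of `φ(0)` and `Δφ(0)`, both zero because `φ`
vanishes near `0`. -/
lemma hasFourier (h : ScreenedKernel K R P a b) :
    HasFourierAwayFromZero K fun k => P k / ((‖k‖ ^ 4 : ℝ) : ℂ) := by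
  intro φ hφ
  obtain ⟨ψ, hψ⟩ := exists_schwartz_div_norm_pow_four h.temperate φ hφ
  refine ⟨h.integrable_mul_planeFourier φ, by simp only [← hψ]; exact ψ.integrable, ?_⟩
  simp only [← hψ]
  obtain ⟨C, hC⟩ := h.bound
  have hw := integrable_weight_mul_schwartz (schwartzFourier φ)
  simp only [schwartzFourier_apply] at hw
  have l1 : Tendsto (fun η => ∫ r, ((R η r - (a η + b η * ‖r‖ ^ 2) : ℝ) : ℂ) * planeFourier φ r)
      (𝓝[>] 0) (𝓝 (∫ r, (K r : ℂ) * planeFourier φ r)) := by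
    refine tendsto_integral_filter_of_dominated_convergence
      (fun r => C * (weight r * ‖planeFourier φ r‖)) ?_ ?_ (hw.const_mul C) ?_
    · filter_upwards [self_mem_nhdsWithin] with η hη
      exact (Complex.continuous_ofReal.comp_aestronglyMeasurable
        (h.aestronglyMeasurable_sub_poly hη)).mul
        (continuous_planeFourier φ.integrable).aestronglyMeasurable
    · filter_upwards [eventually_le_one] with η hη
      filter_upwards [ae_ne_zero] with r hr
      rw [norm_mul, Complex.norm_real, ← mul_assoc]
      exact mul_le_mul_of_nonneg_right (hC η hη.1 hη.2 _ hr) (norm_nonneg _)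
    · filter_upwards [ae_ne_zero] with r hr
      exact ((Complex.continuous_ofReal.tendsto _).comp (h.limit r hr)).mul_const _
  have l2 : Tendsto (fun η => ∫ k, ((1 - hasimotoHat η k : ℝ) : ℂ) * ψ k)
      (𝓝[>] 0) (𝓝 (∫ k, ψ k)) := by
    refine tendsto_integral_filter_of_dominated_convergence (fun k => ‖ψ k‖) ?_ ?_
      ψ.integrable.norm ?_
    · refine Eventually.of_forall fun η => AEStronglyMeasurable.mul ?_ ψ.continuous.aestronglyMeasurable
      refine Continuous.aestronglyMeasurable ?_
      unfold hasimotoHat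
      fun_prop
    · refine Eventually.of_forall fun η => ae_of_all _ fun k => ?_
      rw [norm_mul, Complex.norm_real, Real.norm_eq_abs]
      refine mul_le_of_le_one_left (norm_nonneg _) ?_
      rw [abs_le]
      have := hasimotoHat_nonneg η k
      have := hasimotoHat_le_one η k
      constructor <;> linarith
    · filter_upwards [ae_ne_zero] with k hk
      have := (tendsto_hasimotoHat_zero hk).const_sub 1
      rw [sub_zero] at this
      have := ((Complex.continuous_ofReal.tendsto _).comp this).mul_const (ψ k)
      simpa using this
  refine tendsto_nhds_unique (l1.congr' ?_) l2
  filter_upwards [self_mem_nhdsWithin] with η hη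
  have hη : 0 < η := hη
  obtain ⟨m2, e2⟩ := integral_norm_sq_mul_planeFourier φ hφ
  have m0 := integrable_planeFourier φ
  have e0 : ∫ r, planeFourier φ r = 0 := by
    rw [integral_planeFourier, image_eq_zero_of_notMem_tsupport hφ, mul_zero]
  have jη : Integrable fun r => (R η r : ℂ) := (h.integrable η hη).ofReal
  have i1 : Integrable fun r => (R η r : ℂ) * planeFourier φ r :=
    jη.mul_bdd (c := ∫ r, ‖φ r‖) (continuous_planeFourier φ.integrable).aestronglyMeasurable
      (ae_of_all _ fun r => norm_planeFourier_le φ r)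
  have e3 : ∀ r : Plane, ((R η r - (a η + b η * ‖r‖ ^ 2) : ℝ) : ℂ) * planeFourier φ r
      = (R η r : ℂ) * planeFourier φ r - ((a η : ℂ) * planeFourier φ r
        + (b η : ℂ) * (((‖r‖ ^ 2 : ℝ) : ℂ) * planeFourier φ r)) := by
    intro r; push_cast; ring
  have i02 : Integrable fun r : Plane => (a η : ℂ) * planeFourier φ r
        + (b η : ℂ) * (((‖r‖ ^ 2 : ℝ) : ℂ) * planeFourier φ r) :=
    (m0.const_mul _).add (m2.const_mul _)
  simp only [e3]
  rw [integral_sub i1 i02, integral_add (m0.const_mul _) (m2.const_mul _), integral_const_mul,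
    integral_const_mul, e0, e2, mul_zero, mul_zero, add_zero, sub_zero,
    integral_mul_planeFourier jη φ.integrable]
  refine integral_congr_ae ?_
  filter_upwards [ae_ne_zero] with k hk
  rw [h.fourier η hη k hk, hψ, mul_assoc]

/-- The complete Hasimoto split of a screened kernel. -/
lemma isHasimotoSplit (h : ScreenedKernel K R P a b) {ξ : ℝ} (hξ : 0 < ξ) {KR : Plane → ℝ}
    {Khat KFhat : Plane → ℂ} (hKR : ∀ r, r ≠ 0 → KR r = R ξ r)
    (hKhat : ∀ k, k ≠ 0 → Khat k = P k / ((‖k‖ ^ 4 : ℝ) : ℂ))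
    (hKF : ∀ k, k ≠ 0 → KFhat k = (hasimotoHat ξ k : ℂ) * Khat k) :
    IsHasimotoSplit ξ K KR Khat KFhat := by
  have eR : KR =ᵐ[volume] R ξ := by filter_upwards [ae_ne_zero] with r hr using hKR r hr
  have iR : Integrable KR := (h.integrable ξ hξ).congr eR.symm
  have jR : Integrable fun r => (KR r : ℂ) := iR.ofReal
  have hF : ∀ k, k ≠ 0 → planeFourier (fun r => (KR r : ℂ)) k = Khat k - KFhat k := by
    intro k hk
    rw [planeFourier_congr_ae (g := fun r => (R ξ r : ℂ))
      (by filter_upwards [eR] with r hr; rw [hr]), h.fourier ξ hξ k hk, hKF k hk, hKhat k hk]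
    push_cast
    ring
  have hsplit : ∀ r, r ≠ 0 → K r = KR r + screened ξ K r := by
    intro r hr
    rw [hKR r hr]
    exact h.eq_add_screened hξ hr
  have hfour : HasFourierAwayFromZero K Khat := by
    intro φ hφ
    obtain ⟨i1, i2, e⟩ := h.hasFourier φ hφ
    have ek : (fun k => P k / ((‖k‖ ^ 4 : ℝ) : ℂ) * φ k) =ᵐ[volume] fun k => Khat k * φ k := by
      filter_upwards [ae_ne_zero] with k hk
      rw [hKhat k hk]
    exact ⟨i1, i2.congr ek, e.trans (integral_congr_ae ek)⟩
  refine ⟨h.integrable_mul_hasimoto hξ, hsplit, hfour, ?_, hKF, iR, hF⟩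
  intro φ hφ
  obtain ⟨i1, i2, e⟩ := hfour φ hφ
  have iRφ : Integrable fun r => (KR r : ℂ) * planeFourier φ r :=
    jR.mul_bdd (c := ∫ r, ‖φ r‖) (continuous_planeFourier φ.integrable).aestronglyMeasurable
      (ae_of_all _ fun r => norm_planeFourier_le φ r)
  have e1 : (fun r => ((screened ξ K r : ℝ) : ℂ) * planeFourier φ r) =ᵐ[volume]
      fun r => (K r : ℂ) * planeFourier φ r - (KR r : ℂ) * planeFourier φ r := by
    filter_upwards [ae_ne_zero] with r hr
    rw [hsplit r hr]
    push_cast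
    ring
  have iFR : Integrable fun k => planeFourier (fun r => (KR r : ℂ)) k * φ k :=
    φ.integrable.bdd_mul (c := ∫ r, ‖(KR r : ℂ)‖) (continuous_planeFourier jR).aestronglyMeasurable
      (ae_of_all _ fun r => norm_planeFourier_le _ r)
  have e2 : (fun k => KFhat k * φ k) =ᵐ[volume]
      fun k => Khat k * φ k - planeFourier (fun r => (KR r : ℂ)) k * φ k := by
    filter_upwards [ae_ne_zero] with k hk
    rw [hF k hk]
    ring
  refine ⟨(i1.sub iRφ).congr e1.symm, (i2.sub iFR).congr e2.symm, ?_⟩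
  rw [integral_congr_ae e1, integral_congr_ae e2, integral_sub i1 iRφ, integral_sub i2 iFR, e,
    integral_mul_planeFourier jR φ.integrable]

end ScreenedKernel

/-! ### Superpositions of Gaussians -/

lemma one_add_pow_three_mul_exp_neg_le {u : ℝ} (hu : 0 ≤ u) :
    (1 + u) ^ 3 * Real.exp (-u) ≤ 64 * Real.exp (-(u / 4)) := by
  have h1 : 1 + u ≤ 4 * Real.exp (u / 4) := by linarith [Real.add_one_le_exp (u / 4)]
  have h2 : (1 + u) ^ 3 ≤ (4 * Real.exp (u / 4)) ^ 3 := by gcongr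
  have h3 : Real.exp (-(u / 4)) = Real.exp (u / 4) ^ 3 * Real.exp (-u) := by
    rw [← Real.exp_nat_mul, ← Real.exp_add]; congr 1; push_cast; ring
  rw [h3, ← mul_assoc]
  have := Real.exp_pos (-u)
  gcongr
  exact h2.trans (le_of_eq (by ring))

/-- The tail `H t r = ∫_t^∞ Φ τ r dτ` of a superposition of Gaussian-type functions `Φ τ` whose
Fourier transforms are `P(k) τ⁻³ e^{-k²/4τ} / 16`. -/
structure IsGaussianTail (H Φ : ℝ → Plane → ℝ) (P : Plane → ℂ) : Prop where
  measurable : Measurable (Function.uncurry Φ)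
  bound : ∀ t₀, 0 < t₀ → ∃ C, 0 ≤ C ∧ ∀ t, t₀ ≤ t → ∀ r,
    |Φ t r| ≤ C * ((√t)⁻¹ * ((1 + t * ‖r‖ ^ 2) ^ 3 * gauss t r))
  deriv : ∀ t, 0 < t → ∀ r, r ≠ 0 → HasDerivAt (fun t => H t r) (-Φ t r) t
  tendsto : ∀ r, r ≠ 0 → Tendsto (fun t => H t r) atTop (𝓝 0)
  fourier : ∀ t, 0 < t → ∀ k, planeFourier (fun r => (Φ t r : ℂ)) k
    = P k * ((1 / 16 * (t ^ 3)⁻¹ * Real.exp (-(‖k‖ ^ 2 / (4 * t))) : ℝ) : ℂ)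

lemma integral_gauss {t : ℝ} (ht : 0 < t) : ∫ r, gauss t r = Real.pi / t := by
  have := planeFourier_gauss ht 0
  rw [planeFourier_eq] at this
  simp only [neg_zero, wave_zero_left, mul_one] at this
  rw [integral_complex_ofReal] at this
  have h2 : gaussHat t 0 = Real.pi / t := by simp [gaussHat]
  rw [h2] at this
  exact_mod_cast this

namespace IsGaussianTail

variable {H Φ : ℝ → Plane → ℝ} {P : Plane → ℂ}

lemma bound' (h : IsGaussianTail H Φ P) {t₀ : ℝ} (ht₀ : 0 < t₀) : ∃ C, 0 ≤ C ∧ ∀ t, t₀ ≤ t → ∀ r,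
    |Φ t r| ≤ C * ((√t)⁻¹ * gauss (t / 4) r) := by
  obtain ⟨C, hC0, hC⟩ := h.bound t₀ ht₀
  refine ⟨C * 64, by positivity, fun t ht r => (hC t ht r).trans ?_⟩
  have ht' : 0 < t := ht₀.trans_le ht
  have h1 := one_add_pow_three_mul_exp_neg_le (u := t * ‖r‖ ^ 2) (by positivity)
  have h2 : gauss (t / 4) r = Real.exp (-(t * ‖r‖ ^ 2 / 4)) := by rw [gauss]; congr 1; ring
  rw [h2, gauss]
  calc C * ((√t)⁻¹ * ((1 + t * ‖r‖ ^ 2) ^ 3 * Real.exp (-(t * ‖r‖ ^ 2))))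
      ≤ C * ((√t)⁻¹ * (64 * Real.exp (-(t * ‖r‖ ^ 2 / 4)))) := by gcongr
    _ = _ := by ring

lemma measurable_left (h : IsGaussianTail H Φ P) (r : Plane) : Measurable fun t => Φ t r :=
  h.measurable.comp (measurable_id.prodMk measurable_const)

lemma measurable_right (h : IsGaussianTail H Φ P) (t : ℝ) : Measurable (Φ t) :=
  h.measurable.comp (measurable_const.prodMk measurable_id)

lemma abs_le_exp (h : IsGaussianTail H Φ P) {t₀ : ℝ} (ht₀ : 0 < t₀) : ∃ C, 0 ≤ C ∧ ∀ t, t₀ ≤ t → ∀ r,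
    |Φ t r| ≤ C * Real.exp (-(‖r‖ ^ 2 / 4) * t) := by
  obtain ⟨C, hC0, hC⟩ := h.bound' ht₀
  refine ⟨C * (√t₀)⁻¹, by positivity, fun t ht r => (hC t ht r).trans ?_⟩
  have e : gauss (t / 4) r = Real.exp (-(‖r‖ ^ 2 / 4) * t) := by rw [gauss]; congr 1; ring
  rw [e, ← mul_assoc]
  have : 0 < √t₀ := Real.sqrt_pos.2 ht₀
  gcongr

lemma integrableOn (h : IsGaussianTail H Φ P) {t₀ : ℝ} (ht₀ : 0 < t₀) {r : Plane} (hr : r ≠ 0) :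
    IntegrableOn (fun t => Φ t r) (Ioi t₀) := by
  obtain ⟨C, hC0, hC⟩ := h.abs_le_exp ht₀
  have hs : 0 < ‖r‖ ^ 2 / 4 := by have := norm_pos_iff.2 hr; positivity
  refine ((exp_neg_integrableOn_Ioi t₀ hs).const_mul C).mono'
    (h.measurable_left r).aestronglyMeasurable ?_
  exact (ae_restrict_iff' measurableSet_Ioi).2 (ae_of_all _ fun t ht => hC t (le_of_lt ht) r)

lemma integral_eq (h : IsGaussianTail H Φ P) {t₀ : ℝ} (ht₀ : 0 < t₀) {r : Plane} (hr : r ≠ 0) :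
    ∫ t in Ioi t₀, Φ t r = H t₀ r := by
  have := integral_Ioi_of_hasDerivAt_of_tendsto' (f := fun t => -H t r) (a := t₀) (m := 0)
    (f' := fun t => Φ t r)
    (fun t ht => by simpa using! (h.deriv t (ht₀.trans_le ht) r hr).neg) (h.integrableOn ht₀ hr)
    (by simpa using (h.tendsto r hr).neg)
  simpa using this

/-- The tail decays fast; an inverse fourth power suffices for absolute convergence of lattice
sums. -/
lemma decay (h : IsGaussianTail H Φ P) {t₀ : ℝ} (ht₀ : 0 < t₀) :
    ∃ C, ∀ r, r ≠ 0 → |H t₀ r| ≤ C / ‖r‖ ^ 4 := by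
  obtain ⟨C, hC0, hC⟩ := h.abs_le_exp ht₀
  refine ⟨C * (16 / t₀), fun r hr => ?_⟩
  have hn : 0 < ‖r‖ := norm_pos_iff.2 hr
  have hs : 0 < ‖r‖ ^ 2 / 4 := by positivity
  rw [← h.integral_eq ht₀ hr, ← Real.norm_eq_abs]
  have h1 : ‖∫ t in Ioi t₀, Φ t r‖ ≤ ∫ t in Ioi t₀, C * Real.exp (-(‖r‖ ^ 2 / 4) * t) := by
    refine norm_integral_le_of_norm_le ((exp_neg_integrableOn_Ioi t₀ hs).const_mul C) ?_
    exact (ae_restrict_iff' measurableSet_Ioi).2 (ae_of_all _ fun t ht => hC t (le_of_lt ht) r)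
  refine h1.trans ?_
  rw [integral_const_mul, integral_exp_mul_Ioi (by linarith)]
  have h2 := mul_exp_neg_le (‖r‖ ^ 2 / 4 * t₀)
  rw [mul_div_assoc]
  refine mul_le_mul_of_nonneg_left ?_ hC0
  rw [neg_div_neg_eq, neg_mul, div_div, le_div_iff₀ (by positivity), div_mul_eq_mul_div,
    div_le_iff₀ hs]
  nlinarith [Real.exp_pos (-(‖r‖ ^ 2 / 4 * t₀))]

lemma integrable_prod (h : IsGaussianTail H Φ P) {t₀ : ℝ} (ht₀ : 0 < t₀) :
    Integrable (Function.uncurry Φ) ((volume.restrict (Ioi t₀)).prod volume) := by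
  obtain ⟨C, hC0, hC⟩ := h.bound' ht₀
  have hm : AEStronglyMeasurable (Function.uncurry Φ) ((volume.restrict (Ioi t₀)).prod volume) :=
    h.measurable.aestronglyMeasurable
  rw [integrable_prod_iff hm]
  have hb : ∀ t, t₀ < t → Integrable fun r : Plane => C * ((√t)⁻¹ * gauss (t / 4) r) := fun t ht =>
    ((integrable_gauss (by linarith)).const_mul _).const_mul _
  constructor
  · refine (ae_restrict_iff' measurableSet_Ioi).2 (ae_of_all _ fun t ht => ?_)
    exact (hb t ht).mono' (h.measurable_right t).aestronglyMeasurable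
      (ae_of_all _ fun r => hC t (le_of_lt ht) r)
  · have hi : IntegrableOn (fun t : ℝ => C * (4 * Real.pi) * t ^ (-(3 / 2) : ℝ)) (Ioi t₀) :=
      (integrableOn_Ioi_rpow_of_lt (by norm_num) ht₀).const_mul _
    refine hi.mono' hm.norm.integral_prod_right' ?_
    refine (ae_restrict_iff' measurableSet_Ioi).2 (ae_of_all _ fun t ht => ?_)
    have ht0 : 0 < t := ht₀.trans ht
    rw [Real.norm_of_nonneg (integral_nonneg fun r => norm_nonneg _)]
    refine (integral_mono_of_nonneg (ae_of_all _ fun r => norm_nonneg _) (hb t ht)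
      (ae_of_all _ fun r => hC t (le_of_lt ht) r)).trans (le_of_eq ?_)
    rw [integral_const_mul, integral_const_mul, integral_gauss (by linarith)]
    have e : t ^ (-(3 / 2) : ℝ) = (√t)⁻¹ * t⁻¹ := by
      rw [show (-(3 / 2) : ℝ) = -(1 / 2) + -1 by norm_num, Real.rpow_add ht0, Real.rpow_neg_one,
        Real.rpow_neg ht0.le, Real.sqrt_eq_rpow]
    rw [e]
    field_simp

lemma ae_eq (h : IsGaussianTail H Φ P) {t₀ : ℝ} (ht₀ : 0 < t₀) :
    (fun r => ∫ t in Ioi t₀, Φ t r) =ᵐ[volume] H t₀ := by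
  filter_upwards [ae_ne_zero] with r hr using h.integral_eq ht₀ hr

lemma integrable (h : IsGaussianTail H Φ P) {t₀ : ℝ} (ht₀ : 0 < t₀) : Integrable (H t₀) :=
  (h.integrable_prod ht₀).integral_prod_right.congr (h.ae_eq ht₀)

lemma integral_inv_pow_three_mul_exp {t₀ : ℝ} (ht₀ : 0 < t₀) {s : ℝ} (hs : 0 < s) :
    ∫ t in Ioi t₀, (t ^ 3)⁻¹ * Real.exp (-(s / (4 * t)))
      = 16 / s ^ 2 * (1 - (1 + s / (4 * t₀)) * Real.exp (-(s / (4 * t₀)))) := by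
  have hlim : Tendsto (fun t : ℝ => 16 / s ^ 2 * ((1 + s / (4 * t)) * Real.exp (-(s / (4 * t)))))
      atTop (𝓝 (16 / s ^ 2)) := by
    have h1 : Tendsto (fun t : ℝ => s / (4 * t)) atTop (𝓝 0) :=
      tendsto_const_nhds.div_atTop (tendsto_id.const_mul_atTop (by norm_num))
    have h2 : Tendsto (fun u : ℝ => 16 / s ^ 2 * ((1 + u) * Real.exp (-u))) (𝓝 0)
        (𝓝 (16 / s ^ 2 * ((1 + 0) * Real.exp (-0)))) :=
      (by fun_prop : Continuous fun u : ℝ => 16 / s ^ 2 * ((1 + u) * Real.exp (-u))).tendsto 0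
    have h3 := h2.comp h1
    rw [neg_zero, Real.exp_zero, add_zero, mul_one, mul_one] at h3
    exact h3
  have hderiv : ∀ t ∈ Ici t₀, HasDerivAt
      (fun t : ℝ => 16 / s ^ 2 * ((1 + s / (4 * t)) * Real.exp (-(s / (4 * t)))))
      ((t ^ 3)⁻¹ * Real.exp (-(s / (4 * t)))) t := by
    intro t ht
    have ht0 : 0 < t := ht₀.trans_le ht
    have hu : HasDerivAt (fun t : ℝ => s / (4 * t)) (-(s / (4 * t ^ 2))) t := by
      have := (((hasDerivAt_id t).const_mul 4).inv (by simpa using ht0.ne')).const_mul s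
      convert! this using 1
      simp only [id]
      field_simp
    have := ((hu.const_add 1).mul hu.neg.exp).const_mul (16 / s ^ 2)
    convert! this using 1
    simp only [Pi.neg_apply]
    field_simp
    ring
  have hnn : ∀ t ∈ Ioi t₀, 0 ≤ (t ^ 3)⁻¹ * Real.exp (-(s / (4 * t))) := by
    intro t ht
    have : 0 < t := ht₀.trans ht
    positivity
  rw [integral_Ioi_of_hasDerivAt_of_nonneg' hderiv hnn hlim]
  ring

/-- Integrating the Fourier transforms of the Gaussians gives the factor `1 - γ̂`. -/
lemma fourier_tail (h : IsGaussianTail H Φ P) {ξ : ℝ} (hξ : 0 < ξ) {k : Plane} (hk : k ≠ 0) :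
    planeFourier (fun r => (H (ξ ^ 2) r : ℂ)) k
      = ((1 - hasimotoHat ξ k : ℝ) : ℂ) * (P k / ((‖k‖ ^ 4 : ℝ) : ℂ)) := by
  have ht₀ : 0 < ξ ^ 2 := by positivity
  have hkn : 0 < ‖k‖ := norm_pos_iff.2 hk
  have e1 : planeFourier (fun r => (H (ξ ^ 2) r : ℂ)) k
      = ∫ r, ∫ t in Ioi (ξ ^ 2), (Φ t r : ℂ) * wave (-k) r := by
    rw [planeFourier_eq]
    refine integral_congr_ae ?_
    filter_upwards [h.ae_eq ht₀] with r hr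
    rw [integral_mul_const, integral_complex_ofReal, hr]
  rw [e1, ← integral_integral_swap]
  · have e2 : ∀ t ∈ Ioi (ξ ^ 2), ∫ r, (Φ t r : ℂ) * wave (-k) r
        = P k * ((1 / 16 * ((t ^ 3)⁻¹ * Real.exp (-(‖k‖ ^ 2 / (4 * t)))) : ℝ) : ℂ) := by
      intro t ht
      rw [← planeFourier_eq, h.fourier t (ht₀.trans ht), mul_assoc]
    rw [setIntegral_congr_fun measurableSet_Ioi e2, integral_const_mul, integral_complex_ofReal,
      integral_const_mul, integral_inv_pow_three_mul_exp ht₀ (by positivity), hasimotoHat]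
    have : (‖k‖ : ℂ) ≠ 0 := by exact_mod_cast hkn.ne'
    push_cast
    field_simp
  · have hp := (h.integrable_prod ht₀).ofReal (𝕜 := ℂ)
    refine hp.mul_bdd (c := 1) ?_ ?_
    · exact ((continuous_wave_right (-k)).comp continuous_snd).aestronglyMeasurable
    · simp

/-- The tails of a Gaussian superposition are the real-space parts of the kernel obtained from them
as `ξ → 0`. -/
lemma screenedKernel (h : IsGaussianTail H Φ P) (hP : P.HasTemperateGrowth)
    {K : Plane → ℝ} {a b : ℝ → ℝ} (hcont : ∀ ξ, 0 < ξ → ContinuousOn (H (ξ ^ 2)) {0}ᶜ)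
    (hbound : ∃ C, ∀ η, 0 < η → η ≤ 1 → ∀ r, r ≠ 0 →
      |H (η ^ 2) r - (a η + b η * ‖r‖ ^ 2)| ≤ C * weight r)
    (hlim : ∀ r, r ≠ 0 → Tendsto (fun η => H (η ^ 2) r - (a η + b η * ‖r‖ ^ 2)) (𝓝[>] 0) (𝓝 (K r))) :
    ScreenedKernel K (fun ξ => H (ξ ^ 2)) P a b where
  continuousOn := hcont
  integrable ξ hξ := h.integrable (by positivity)
  decay ξ hξ := by
    obtain ⟨C, hC⟩ := h.decay (t₀ := ξ ^ 2) (by positivity)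
    refine ⟨C, fun r hr => hC r ?_⟩
    rintro rfl
    norm_num at hr
  fourier ξ hξ k hk := h.fourier_tail hξ hk
  temperate := hP
  bound := hbound
  limit := hlim

end IsGaussianTail

/-! ### Closed forms of the real-space parts -/

/-- The part of `B` carried by the Gaussians `e^{-τ|r|²}` with `τ ≥ t`. -/
def biharmTail (t : ℝ) (r : Plane) : ℝ :=
  1 / (16 * Real.pi * t) * (t * ‖r‖ ^ 2 * expInt (t * ‖r‖ ^ 2) - Real.exp (-(t * ‖r‖ ^ 2)))

/-- The part of `L` carried by the Gaussians `e^{-τ|r|²}` with `τ ≥ t`. -/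
def laplTail (t : ℝ) (r : Plane) : ℝ :=
  1 / (4 * Real.pi) * (-Real.exp (-(t * ‖r‖ ^ 2)) + expInt (t * ‖r‖ ^ 2))

/-- The part of the Stokeslet carried by the Gaussians with exponent at least `t`. -/
def stokesletTail (j l : Fin 2) (t : ℝ) (r : Plane) : ℝ :=
  1 / (4 * Real.pi) * (kd j l * (expInt (t * ‖r‖ ^ 2) / 2 - Real.exp (-(t * ‖r‖ ^ 2)))
    + r j * r l / ‖r‖ ^ 2 * Real.exp (-(t * ‖r‖ ^ 2)))

/-- The part of the stresslet carried by the Gaussians with exponent at least `t`. -/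
def stressletTail (j l m : Fin 2) (t : ℝ) (r : Plane) : ℝ :=
  1 / (2 * Real.pi) * Real.exp (-(t * ‖r‖ ^ 2)) * (t * (kd j l * r m + kd j m * r l + kd l m * r j)
    - 2 * (1 + t * ‖r‖ ^ 2) * (r j * r l * r m / ‖r‖ ^ 4))

/-! #### Derivatives with respect to the exponent -/

lemma hasDerivAt_exp_neg_mul (s t : ℝ) :
    HasDerivAt (fun t => Real.exp (-(t * s))) (-s * Real.exp (-(t * s))) t := by
  have := ((hasDerivAt_id t).mul_const s).neg.exp
  convert! this using 1
  simp; ring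

lemma hasDerivAt_expInt_mul {s t : ℝ} (hs : 0 < s) (ht : 0 < t) :
    HasDerivAt (fun t => expInt (t * s)) (-(Real.exp (-(t * s)) / t)) t := by
  have := (hasDerivAt_expInt (mul_pos ht hs)).comp t ((hasDerivAt_id t).mul_const s)
  convert! this using 1
  field_simp

lemma tendsto_exp_neg_mul {s : ℝ} (hs : 0 < s) :
    Tendsto (fun t => Real.exp (-(t * s))) atTop (𝓝 0) :=
  Real.tendsto_exp_neg_atTop_nhds_zero.comp (tendsto_id.atTop_mul_const hs)

lemma tendsto_expInt_atTop : Tendsto expInt atTop (𝓝 0) := by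
  refine squeeze_zero' ?_ ?_ Real.tendsto_exp_neg_atTop_nhds_zero
  · filter_upwards [eventually_ge_atTop 1] with x hx using expInt_nonneg (by linarith)
  · filter_upwards [eventually_ge_atTop 1] with x hx
    exact (expInt_le (by linarith)).trans (div_le_self (Real.exp_nonneg _) hx)

lemma tendsto_expInt_mul {s : ℝ} (hs : 0 < s) : Tendsto (fun t => expInt (t * s)) atTop (𝓝 0) :=
  tendsto_expInt_atTop.comp (tendsto_id.atTop_mul_const hs)

lemma norm_sq_pos {r : Plane} (hr : r ≠ 0) : 0 < ‖r‖ ^ 2 := norm_sq_mem_Ioi hr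

lemma inv_le_inv_sqrt_mul {t₀ t : ℝ} (h₀ : 0 < t₀) (h : t₀ ≤ t) : t⁻¹ ≤ (√t₀)⁻¹ * (√t)⁻¹ := by
  have ht : 0 < t := h₀.trans_le h
  have h1 : 0 < √t₀ := Real.sqrt_pos.2 h₀
  have h2 : √t₀ ≤ √t := Real.sqrt_le_sqrt h
  rw [← mul_inv]
  refine inv_anti₀ (by positivity) ?_
  calc √t₀ * √t ≤ √t * √t := by gcongr
    _ = t := Real.mul_self_sqrt ht.le

lemma norm_le_inv_sqrt_mul {t : ℝ} (ht : 0 < t) (r : Plane) :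
    ‖r‖ ≤ (√t)⁻¹ * (1 + t * ‖r‖ ^ 2) := by
  have h1 : 0 < √t := Real.sqrt_pos.2 ht
  have h2 : √t * √t = t := Real.mul_self_sqrt ht.le
  rw [← div_eq_inv_mul, le_div_iff₀ h1]
  nlinarith [sq_nonneg (√t * ‖r‖ - 1), sq_nonneg (√t * ‖r‖)]

lemma isGaussianTail_biharm : IsGaussianTail biharmTail
    (fun t r => -(1 / (16 * Real.pi)) * ((t ^ 2)⁻¹ * gauss t r)) (fun _ => -1) where
  measurable := by
    unfold gauss Function.uncurry
    fun_prop
  bound t₀ h₀ := by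
    refine ⟨(√t₀)⁻¹ * t₀⁻¹, by positivity, fun t ht r => ?_⟩
    have ht' : 0 < t := h₀.trans_le ht
    have hg := gauss_pos t r
    have hπ : 1 / (16 * Real.pi) ≤ 1 := by
      rw [div_le_one (by positivity)]; linarith [Real.pi_gt_three]
    have h1 : (t ^ 2)⁻¹ ≤ (√t₀)⁻¹ * (√t)⁻¹ * t₀⁻¹ := by
      rw [pow_two, mul_inv]
      gcongr
      exact inv_le_inv_sqrt_mul h₀ ht
    have h2 : 1 ≤ (1 + t * ‖r‖ ^ 2) ^ 3 := one_le_pow₀ (by have := mul_nonneg ht'.le (sq_nonneg ‖r‖); linarith)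
    rw [abs_mul, abs_neg, abs_of_pos (by positivity), abs_of_pos (by positivity)]
    calc 1 / (16 * Real.pi) * ((t ^ 2)⁻¹ * gauss t r)
        ≤ 1 * ((√t₀)⁻¹ * (√t)⁻¹ * t₀⁻¹ * (1 * gauss t r)) := by rw [one_mul (gauss t r)]; gcongr
      _ ≤ 1 * ((√t₀)⁻¹ * (√t)⁻¹ * t₀⁻¹ * ((1 + t * ‖r‖ ^ 2) ^ 3 * gauss t r)) := by gcongr
      _ = _ := by ring
  deriv t ht r hr := by
    have hs := norm_sq_pos hr
    have hp := Real.pi_ne_zero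
    have e : (fun t => biharmTail t r) =ᶠ[𝓝 t] fun t => 1 / (16 * Real.pi) *
        (‖r‖ ^ 2 * expInt (t * ‖r‖ ^ 2) - Real.exp (-(t * ‖r‖ ^ 2)) / t) := by
      filter_upwards [lt_mem_nhds ht] with τ hτ
      rw [biharmTail]
      field_simp
    refine HasDerivAt.congr_of_eventuallyEq ?_ e
    have := (((hasDerivAt_expInt_mul hs ht).const_mul (‖r‖ ^ 2)).sub
      ((hasDerivAt_exp_neg_mul (‖r‖ ^ 2) t).div (hasDerivAt_id t) ht.ne')).const_mul
      (1 / (16 * Real.pi))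
    convert! this using 1
    simp only [gauss, id]
    field_simp
    ring
  tendsto r hr := by
    have hs := norm_sq_pos hr
    have hp := Real.pi_ne_zero
    have h1 := (((tendsto_expInt_mul hs).const_mul (‖r‖ ^ 2)).sub
      ((tendsto_exp_neg_mul hs).mul tendsto_inv_atTop_zero)).const_mul (1 / (16 * Real.pi))
    simp only [mul_zero, sub_zero] at h1
    refine h1.congr' ?_
    filter_upwards [eventually_gt_atTop 0] with t ht
    rw [biharmTail]
    field_simp
  fourier t ht k := by
    have hp : (Real.pi : ℂ) ≠ 0 := by exact_mod_cast Real.pi_ne_zero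
    have ht' : (t : ℂ) ≠ 0 := by exact_mod_cast ht.ne'
    have e : (fun r => ((-(1 / (16 * Real.pi)) * ((t ^ 2)⁻¹ * gauss t r) : ℝ) : ℂ))
        = fun r => ((-(1 / (16 * Real.pi)) * (t ^ 2)⁻¹ : ℝ) : ℂ) * ((gauss t r : ℝ) : ℂ) := by
      funext r; push_cast; ring
    rw [e, planeFourier_const_mul, planeFourier_gauss ht, gaussHat]
    push_cast
    field_simp

/-- The Laplacian of a Gaussian has the Fourier transform `-k² ĝ`. -/
lemma planeFourier_lap_gauss {t : ℝ} (ht : 0 < t) (k : Plane) :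
    Integrable (lap (gauss t)) ∧ planeFourier (fun r => ((lap (gauss t) r : ℝ) : ℂ)) k
      = ((-‖k‖ ^ 2 * gaussHat t k : ℝ) : ℂ) := by
  have i0 := integrable_pd_pd_gauss ht 0 0
  have i1 := integrable_pd_pd_gauss ht 1 1
  refine ⟨i0.add i1, ?_⟩
  have e : (fun r => ((lap (gauss t) r : ℝ) : ℂ)) = fun r => ((pd 0 (pd 0 (gauss t)) r : ℝ) : ℂ)
      + ((pd 1 (pd 1 (gauss t)) r : ℝ) : ℂ) := by
    funext r; rw [lap]; push_cast; rfl
  rw [e, planeFourier_add (integrable_ofReal i0) (integrable_ofReal i1),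
    planeFourier_pd_pd_gauss ht, planeFourier_pd_pd_gauss ht, norm_sq_eq]
  push_cast
  ring

lemma lap_gauss (t : ℝ) (r : Plane) :
    lap (gauss t) r = (-4 * t + 4 * t ^ 2 * ‖r‖ ^ 2) * gauss t r := by
  rw [lap, pd_pd_gauss, pd_pd_gauss, norm_sq_eq]
  simp only [kd, if_true]
  ring

lemma isGaussianTail_lapl : IsGaussianTail laplTail
    (fun t r => 1 / (4 * Real.pi) * ((t⁻¹ - ‖r‖ ^ 2) * gauss t r))
    (fun k => ((‖k‖ ^ 2 : ℝ) : ℂ)) where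
  measurable := by
    unfold gauss Function.uncurry
    fun_prop
  bound t₀ h₀ := by
    refine ⟨(√t₀)⁻¹, by positivity, fun t ht r => ?_⟩
    have ht' : 0 < t := h₀.trans_le ht
    have hg := gauss_pos t r
    have hπ : 1 / (4 * Real.pi) ≤ 1 := by
      rw [div_le_one (by positivity)]; linarith [Real.pi_gt_three]
    have h0 : 0 ≤ t * ‖r‖ ^ 2 := by positivity
    have h1 : |t⁻¹ - ‖r‖ ^ 2| ≤ t⁻¹ * (1 + t * ‖r‖ ^ 2) := by
      have e : t⁻¹ * (1 + t * ‖r‖ ^ 2) = t⁻¹ + ‖r‖ ^ 2 := by field_simp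
      have h3 : 0 < t⁻¹ := by positivity
      rw [e, abs_le]
      constructor <;> nlinarith [sq_nonneg ‖r‖]
    have h2 : 1 + t * ‖r‖ ^ 2 ≤ (1 + t * ‖r‖ ^ 2) ^ 3 := le_self_pow₀ (by linarith) (by norm_num)
    rw [abs_mul, abs_mul, abs_of_pos (by positivity), abs_of_pos hg]
    calc 1 / (4 * Real.pi) * (|t⁻¹ - ‖r‖ ^ 2| * gauss t r)
        ≤ 1 * (t⁻¹ * (1 + t * ‖r‖ ^ 2) * gauss t r) := by gcongr
      _ ≤ 1 * ((√t₀)⁻¹ * (√t)⁻¹ * (1 + t * ‖r‖ ^ 2) ^ 3 * gauss t r) := by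
        gcongr
        exact inv_le_inv_sqrt_mul h₀ ht
      _ = _ := by ring
  deriv t ht r hr := by
    have hs := norm_sq_pos hr
    have := ((hasDerivAt_exp_neg_mul (‖r‖ ^ 2) t).neg.add
      (hasDerivAt_expInt_mul hs ht)).const_mul (1 / (4 * Real.pi))
    convert! this using 1
    simp only [gauss]
    field_simp
    ring
  tendsto r hr := by
    have hs := norm_sq_pos hr
    have h1 := ((tendsto_exp_neg_mul hs).neg.add (tendsto_expInt_mul hs)).const_mul
      (1 / (4 * Real.pi))
    simp only [neg_zero, add_zero, mul_zero] at h1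
    exact h1
  fourier t ht k := by
    have hp : (Real.pi : ℂ) ≠ 0 := by exact_mod_cast Real.pi_ne_zero
    have ht' : (t : ℂ) ≠ 0 := by exact_mod_cast ht.ne'
    have e : (fun r => ((1 / (4 * Real.pi) * ((t⁻¹ - ‖r‖ ^ 2) * gauss t r) : ℝ) : ℂ))
        = fun r => ((-(1 / (16 * Real.pi)) * (t ^ 2)⁻¹ : ℝ) : ℂ) * ((lap (gauss t) r : ℝ) : ℂ) := by
      funext r
      rw [← Complex.ofReal_mul, lap_gauss]
      congr 1
      field_simp
      ring
    rw [e, planeFourier_const_mul, (planeFourier_lap_gauss ht k).2, gaussHat]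
    push_cast
    field_simp

lemma isGaussianTail_stokeslet (j l : Fin 2) : IsGaussianTail (stokesletTail j l)
    (fun t r => 1 / (16 * Real.pi) *
      ((kd j l * (2 * t⁻¹ - 4 * ‖r‖ ^ 2) + 4 * (r j * r l)) * gauss t r))
    (fun k => ((kd j l * ‖k‖ ^ 2 - k j * k l : ℝ) : ℂ)) where
  measurable := by
    unfold gauss Function.uncurry
    fun_prop
  bound t₀ h₀ := by
    refine ⟨(√t₀)⁻¹, by positivity, fun t ht r => ?_⟩
    have ht' : 0 < t := h₀.trans_le ht
    have hg := gauss_pos t r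
    have hπ : 1 / (16 * Real.pi) ≤ 1 / 16 := by
      apply one_div_le_one_div_of_le (by norm_num); linarith [Real.pi_gt_three]
    have h0 : 0 ≤ t * ‖r‖ ^ 2 := by positivity
    have h1 : |kd j l * (2 * t⁻¹ - 4 * ‖r‖ ^ 2) + 4 * (r j * r l)|
        ≤ 16 * (t⁻¹ * (1 + t * ‖r‖ ^ 2)) := by
      have e : t⁻¹ * (1 + t * ‖r‖ ^ 2) = t⁻¹ + ‖r‖ ^ 2 := by field_simp
      have h3 : 0 < t⁻¹ := by positivity
      have h4 : |2 * t⁻¹ - 4 * ‖r‖ ^ 2| ≤ 2 * t⁻¹ + 4 * ‖r‖ ^ 2 := by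
        rw [abs_le]; constructor <;> nlinarith [sq_nonneg ‖r‖]
      have h5 : |kd j l * (2 * t⁻¹ - 4 * ‖r‖ ^ 2)| ≤ 1 * (2 * t⁻¹ + 4 * ‖r‖ ^ 2) := by
        rw [abs_mul]; gcongr; exact abs_kd_le j l
      have h6 : |r j * r l| ≤ ‖r‖ * ‖r‖ := by
        rw [abs_mul]; gcongr <;> exact abs_coord_le r _
      have h7 := abs_add_le (kd j l * (2 * t⁻¹ - 4 * ‖r‖ ^ 2)) (4 * (r j * r l))
      rw [abs_mul 4, abs_of_pos (by norm_num : (0 : ℝ) < 4)] at h7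
      rw [e]
      nlinarith [sq_nonneg ‖r‖]
    have h2 : 1 + t * ‖r‖ ^ 2 ≤ (1 + t * ‖r‖ ^ 2) ^ 3 := le_self_pow₀ (by linarith) (by norm_num)
    rw [abs_mul, abs_mul, abs_of_pos (by positivity), abs_of_pos hg]
    calc 1 / (16 * Real.pi) * (|kd j l * (2 * t⁻¹ - 4 * ‖r‖ ^ 2) + 4 * (r j * r l)| * gauss t r)
        ≤ 1 / 16 * (16 * (t⁻¹ * (1 + t * ‖r‖ ^ 2)) * gauss t r) := by gcongr
      _ = t⁻¹ * (1 + t * ‖r‖ ^ 2) * gauss t r := by ring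
      _ ≤ (√t₀)⁻¹ * (√t)⁻¹ * (1 + t * ‖r‖ ^ 2) ^ 3 * gauss t r := by
        gcongr
        exact inv_le_inv_sqrt_mul h₀ ht
      _ = _ := by ring
  deriv t ht r hr := by
    have hs := norm_sq_pos hr
    have hn : ‖r‖ ≠ 0 := norm_ne_zero_iff.2 hr
    have := (((((hasDerivAt_expInt_mul hs ht).div_const 2).sub
      (hasDerivAt_exp_neg_mul (‖r‖ ^ 2) t)).const_mul (kd j l)).add
      ((hasDerivAt_exp_neg_mul (‖r‖ ^ 2) t).const_mul (r j * r l / ‖r‖ ^ 2))).const_mul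
      (1 / (4 * Real.pi))
    convert! this using 1
    simp only [gauss]
    field_simp
    ring
  tendsto r hr := by
    have hs := norm_sq_pos hr
    have h1 := (((((tendsto_expInt_mul hs).div_const 2).sub
      (tendsto_exp_neg_mul hs)).const_mul (kd j l)).add
      ((tendsto_exp_neg_mul hs).const_mul (r j * r l / ‖r‖ ^ 2))).const_mul
      (1 / (4 * Real.pi))
    simp only [zero_div, sub_zero, mul_zero, add_zero] at h1
    exact h1
  fourier t ht k := by
    have hp : (Real.pi : ℂ) ≠ 0 := by exact_mod_cast Real.pi_ne_zero
    have ht' : (t : ℂ) ≠ 0 := by exact_mod_cast ht.ne'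
    have e : (fun r : Plane => ((1 / (16 * Real.pi) *
          ((kd j l * (2 * t⁻¹ - 4 * ‖r‖ ^ 2) + 4 * (r j * r l)) * gauss t r) : ℝ) : ℂ))
        = fun r => ((-(1 / (16 * Real.pi)) * (t ^ 2)⁻¹ : ℝ) : ℂ) *
          ((kd j l : ℂ) * ((lap (gauss t) r : ℝ) : ℂ) - ((pd j (pd l (gauss t)) r : ℝ) : ℂ)) := by
      funext r
      rw [← Complex.ofReal_mul, ← Complex.ofReal_sub, ← Complex.ofReal_mul, lap_gauss, pd_pd_gauss]
      congr 1
      field_simp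
      ring
    obtain ⟨i1, e1⟩ := planeFourier_lap_gauss ht k
    rw [e, planeFourier_const_mul, planeFourier_sub ((integrable_ofReal i1).const_mul _)
      (integrable_ofReal (integrable_pd_pd_gauss ht j l)), planeFourier_const_mul, e1,
      planeFourier_pd_pd_gauss ht, gaussHat]
    push_cast
    field_simp
    ring

lemma pd_lap_gauss (t : ℝ) (m : Fin 2) (r : Plane) :
    pd m (lap (gauss t)) r = r m * (16 * t ^ 2 - 8 * t ^ 3 * ‖r‖ ^ 2) * gauss t r := by
  have := (hasJet_gauss t).pd_lap isOpen_univ (mem_univ (‖r‖ ^ 2)) m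
  unfold gauss
  rw [this]; ring

lemma planeFourier_pd_lap_gauss {t : ℝ} (ht : 0 < t) (m : Fin 2) (k : Plane) :
    Integrable (pd m (lap (gauss t))) ∧
      planeFourier (fun r => ((pd m (lap (gauss t)) r : ℝ) : ℂ)) k
        = Complex.I * ((-(k m * ‖k‖ ^ 2) * gaussHat t k : ℝ) : ℂ) := by
  have i : Integrable (pd m (lap (gauss t))) := by
    have e : pd m (lap (gauss t)) = fun r => 16 * t ^ 2 * (r m * gauss t r)
        + -8 * t ^ 3 * (r m * r 0 * r 0 * gauss t r) + -8 * t ^ 3 * (r m * r 1 * r 1 * gauss t r) := by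
      funext r; rw [pd_lap_gauss, norm_sq_eq]; ring
    rw [e]
    exact (((integrable_coord_mul_gauss ht m).const_mul _).add
      ((integrable_coord3_mul_gauss ht m 0 0).const_mul _)).add
      ((integrable_coord3_mul_gauss ht m 1 1).const_mul _)
  have hd : ContDiff ℝ ∞ (lap (gauss t)) :=
    (contDiff_pd (contDiff_pd (contDiff_gauss t) 0) 0).add
      (contDiff_pd (contDiff_pd (contDiff_gauss t) 1) 1)
  obtain ⟨i1, e1⟩ := planeFourier_lap_gauss ht k
  refine ⟨i, ?_⟩
  rw [planeFourier_pd (differentiable_of_contDiff hd) i1 m i, e1]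
  push_cast
  ring

lemma isGaussianTail_stresslet (j l m : Fin 2) : IsGaussianTail (stressletTail j l m)
    (fun t r => -(1 / (2 * Real.pi)) * (((kd j l * r m + kd j m * r l + kd l m * r j) *
      (1 - t * ‖r‖ ^ 2) + 2 * t * (r j * r l * r m)) * gauss t r))
    (fun k => Complex.I * (((kd j l * k m + kd j m * k l + kd l m * k j) * ‖k‖ ^ 2
      - 2 * (k j * k l * k m) : ℝ) : ℂ)) where
  measurable := by
    unfold gauss Function.uncurry
    fun_prop
  bound t₀ h₀ := by
    refine ⟨1, by positivity, fun t ht r => ?_⟩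
    have ht' : 0 < t := h₀.trans_le ht
    have hg := gauss_pos t r
    have hπ : 1 / (2 * Real.pi) ≤ 1 / 5 := by
      apply one_div_le_one_div_of_le (by norm_num); linarith [Real.pi_gt_three]
    have h0 : 0 ≤ t * ‖r‖ ^ 2 := by positivity
    have hk : ∀ a b c : Fin 2, |kd a b * r c| ≤ ‖r‖ := fun a b c => by
      rw [abs_mul]
      exact (mul_le_mul (abs_kd_le a b) (abs_coord_le r c) (abs_nonneg _) zero_le_one).trans_eq
        (one_mul _)
    have h1 : |(kd j l * r m + kd j m * r l + kd l m * r j) * (1 - t * ‖r‖ ^ 2)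
        + 2 * t * (r j * r l * r m)| ≤ 5 * (‖r‖ * (1 + t * ‖r‖ ^ 2)) := by
      have h3 : |kd j l * r m + kd j m * r l + kd l m * r j| ≤ 3 * ‖r‖ := by
        have := abs_add_three (kd j l * r m) (kd j m * r l) (kd l m * r j)
        linarith [hk j l m, hk j m l, hk l m j]
      have h4 : |1 - t * ‖r‖ ^ 2| ≤ 1 + t * ‖r‖ ^ 2 := by
        rw [abs_le]; constructor <;> linarith
      have h5 : |r j * r l * r m| ≤ ‖r‖ * ‖r‖ * ‖r‖ := by
        rw [abs_mul, abs_mul]; gcongr <;> exact abs_coord_le r _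
      refine (abs_add_le _ _).trans ?_
      rw [abs_mul, abs_mul (2 * t), abs_of_pos (by positivity : 0 < 2 * t)]
      calc _ ≤ 3 * ‖r‖ * (1 + t * ‖r‖ ^ 2) + 2 * t * (‖r‖ * ‖r‖ * ‖r‖) := by gcongr
        _ ≤ _ := by nlinarith [norm_nonneg r]
    rw [abs_mul, abs_mul, abs_neg, abs_of_pos (by positivity), abs_of_pos hg]
    have h6 := norm_le_inv_sqrt_mul ht' r
    have h7 : (1 + t * ‖r‖ ^ 2) ^ 2 ≤ (1 + t * ‖r‖ ^ 2) ^ 3 :=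
      pow_le_pow_right₀ (by linarith) (by norm_num)
    calc _ ≤ 1 / 5 * (5 * (‖r‖ * (1 + t * ‖r‖ ^ 2)) * gauss t r) := by gcongr
      _ = ‖r‖ * (1 + t * ‖r‖ ^ 2) * gauss t r := by ring
      _ ≤ (√t)⁻¹ * (1 + t * ‖r‖ ^ 2) * (1 + t * ‖r‖ ^ 2) * gauss t r := by gcongr
      _ = (√t)⁻¹ * (1 + t * ‖r‖ ^ 2) ^ 2 * gauss t r := by ring
      _ ≤ (√t)⁻¹ * (1 + t * ‖r‖ ^ 2) ^ 3 * gauss t r := by gcongr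
      _ = _ := by ring
  deriv t ht r hr := by
    have hs := norm_sq_pos hr
    have hn : ‖r‖ ≠ 0 := norm_ne_zero_iff.2 hr
    have := ((hasDerivAt_exp_neg_mul (‖r‖ ^ 2) t).const_mul (1 / (2 * Real.pi))).mul
      (((hasDerivAt_id t).mul_const (kd j l * r m + kd j m * r l + kd l m * r j)).sub
        (((((hasDerivAt_id t).mul_const (‖r‖ ^ 2)).const_add 1).const_mul 2).mul_const
          (r j * r l * r m / ‖r‖ ^ 4)))
    convert! this using 1
    simp only [gauss, id, Pi.sub_apply]
    field_simp
    ring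
  tendsto r hr := by
    have hs := norm_sq_pos hr
    have h1 : Tendsto (fun t => t * ‖r‖ ^ 2 * Real.exp (-(t * ‖r‖ ^ 2))) atTop (𝓝 0) := by
      have := (Real.tendsto_pow_mul_exp_neg_atTop_nhds_zero 1).comp
        (tendsto_id.atTop_mul_const hs)
      refine this.congr fun t => ?_
      simp
    have h2 := ((h1.const_mul (1 / (2 * Real.pi))).mul_const
      ((kd j l * r m + kd j m * r l + kd l m * r j) / ‖r‖ ^ 2 - 2 * (r j * r l * r m / ‖r‖ ^ 4))).add
      ((tendsto_exp_neg_mul hs).mul_const (-(1 / (2 * Real.pi)) * 2 * (r j * r l * r m / ‖r‖ ^ 4)))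
    simp only [mul_zero, zero_mul, add_zero] at h2
    refine h2.congr fun t => ?_
    rw [stressletTail]
    have hn : ‖r‖ ≠ 0 := norm_ne_zero_iff.2 hr
    field_simp
    ring
  fourier t ht k := by
    have hp : (Real.pi : ℂ) ≠ 0 := by exact_mod_cast Real.pi_ne_zero
    have ht' : (t : ℂ) ≠ 0 := by exact_mod_cast ht.ne'
    have e : (fun r : Plane => ((-(1 / (2 * Real.pi)) *
        (((kd j l * r m + kd j m * r l + kd l m * r j) *
      (1 - t * ‖r‖ ^ 2) + 2 * t * (r j * r l * r m)) * gauss t r) : ℝ) : ℂ))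
        = fun r => ((-(1 / (16 * Real.pi)) * (t ^ 2)⁻¹ : ℝ) : ℂ) *
          ((kd j l : ℂ) * ((pd m (lap (gauss t)) r : ℝ) : ℂ)
            + (kd j m : ℂ) * ((pd l (lap (gauss t)) r : ℝ) : ℂ)
            + (kd l m : ℂ) * ((pd j (lap (gauss t)) r : ℝ) : ℂ)
            - 2 * ((pd j (pd l (pd m (gauss t))) r : ℝ) : ℂ)) := by
      funext r
      rw [pd_lap_gauss, pd_lap_gauss, pd_lap_gauss, pd_pd_pd_gauss]
      norm_cast
      field_simp
      ring
    obtain ⟨im, em⟩ := planeFourier_pd_lap_gauss ht m k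
    obtain ⟨il, el⟩ := planeFourier_pd_lap_gauss ht l k
    obtain ⟨ij, ej⟩ := planeFourier_pd_lap_gauss ht j k
    have jm := (integrable_ofReal im).const_mul (kd j l : ℂ)
    have jl := (integrable_ofReal il).const_mul (kd j m : ℂ)
    have jj := (integrable_ofReal ij).const_mul (kd l m : ℂ)
    have jp := (integrable_ofReal (integrable_pd_pd_pd_gauss ht j l m)).const_mul (2 : ℂ)
    have jml : Integrable fun r => (kd j l : ℂ) * ((pd m (lap (gauss t)) r : ℝ) : ℂ)
        + (kd j m : ℂ) * ((pd l (lap (gauss t)) r : ℝ) : ℂ) := jm.add jl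
    have jmlj : Integrable fun r => (kd j l : ℂ) * ((pd m (lap (gauss t)) r : ℝ) : ℂ)
        + (kd j m : ℂ) * ((pd l (lap (gauss t)) r : ℝ) : ℂ)
        + (kd l m : ℂ) * ((pd j (lap (gauss t)) r : ℝ) : ℂ) := jml.add jj
    rw [e, planeFourier_const_mul, planeFourier_sub jmlj jp,
      planeFourier_add jml jj, planeFourier_add jm jl, planeFourier_const_mul,
      planeFourier_const_mul, planeFourier_const_mul, planeFourier_const_mul, em, el, ej,
      planeFourier_pd_pd_pd_gauss ht, gaussHat]
    push_cast
    field_simp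
    ring

/-! ### The four kernels as limits of their real-space parts -/

lemma norm_pow_le_weight {r : Plane} (hr : r ≠ 0) {j : ℕ} (hj : j ≤ 4) : ‖r‖ ^ j ≤ weight r := by
  have hn : 0 < ‖r‖ := norm_pos_iff.2 hr
  have h4 : 0 < ‖r‖ ^ 4 := by positivity
  have hi : 0 < ‖r‖⁻¹ := by positivity
  unfold weight
  rcases le_total ‖r‖ 1 with h | h
  · have h1 := pow_le_one₀ (n := j) hn.le h
    have h2 := (one_le_inv₀ hn).2 h
    linarith
  · have h1 := pow_le_pow_right₀ h hj
    linarith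

lemma norm_inv_le_weight (r : Plane) : ‖r‖⁻¹ ≤ weight r := by
  unfold weight; linarith [pow_nonneg (norm_nonneg r) 4]

lemma abs_log_norm_le {r : Plane} (hr : r ≠ 0) : |Real.log ‖r‖| ≤ ‖r‖⁻¹ + ‖r‖ := by
  have hn : 0 < ‖r‖ := norm_pos_iff.2 hr
  have hi : 0 < ‖r‖⁻¹ := by positivity
  have h1 := Real.log_le_sub_one_of_pos hn
  have h2 := Real.log_le_sub_one_of_pos hi
  rw [Real.log_inv] at h2
  rw [abs_le]
  constructor <;> linarith

lemma expInt_sq_mul {η n : ℝ} (hη : 0 < η) (hn : 0 < n) :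
    expInt (η ^ 2 * n ^ 2) = ein (η ^ 2 * n ^ 2) - 2 * Real.log η - 2 * Real.log n
      - Real.eulerMascheroniConstant := by
  rw [expInt_eq, Real.log_mul (by positivity) (by positivity), Real.log_pow, Real.log_pow]
  push_cast
  ring

lemma one_sub_exp_neg_mem {x : ℝ} (hx : 0 ≤ x) : 0 ≤ 1 - Real.exp (-x) ∧ 1 - Real.exp (-x) ≤ x := by
  have h1 : Real.exp (-x) ≤ 1 := Real.exp_le_one_iff.2 (by linarith)
  have h2 := Real.add_one_le_exp (-x)
  constructor <;> linarith

lemma sq_mul_norm_sq_le {η : ℝ} (hη : 0 < η) (h1 : η ≤ 1) (r : Plane) : η ^ 2 * ‖r‖ ^ 2 ≤ ‖r‖ ^ 2 :=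
  mul_le_of_le_one_left (sq_nonneg _) (pow_le_one₀ hη.le h1)

lemma tendsto_sq_mul {n : ℝ} (hn : 0 < n) :
    Tendsto (fun η : ℝ => η ^ 2 * n ^ 2) (𝓝[>] 0) (𝓝[>] 0) := by
  refine tendsto_nhdsWithin_iff.2 ⟨?_, ?_⟩
  · have : Tendsto (fun η : ℝ => η ^ 2 * n ^ 2) (𝓝 0) (𝓝 (0 ^ 2 * n ^ 2)) :=
      (by fun_prop : Continuous fun η : ℝ => η ^ 2 * n ^ 2).tendsto 0
    simp only [ne_eq, OfNat.ofNat_ne_zero, not_false_eq_true, zero_pow, zero_mul] at this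
    exact this.mono_left nhdsWithin_le_nhds
  · filter_upwards [self_mem_nhdsWithin] with η hη
    have : (0 : ℝ) < η := hη
    exact mem_Ioi.2 (by positivity)

lemma tendsto_ein_sq_mul {n : ℝ} (hn : 0 < n) :
    Tendsto (fun η : ℝ => ein (η ^ 2 * n ^ 2)) (𝓝[>] 0) (𝓝 0) :=
  tendsto_ein_zero.comp (tendsto_sq_mul hn)

lemma tendsto_one_sub_exp_neg_sq_mul {n : ℝ} (hn : 0 < n) :
    Tendsto (fun η : ℝ => 1 - Real.exp (-(η ^ 2 * n ^ 2))) (𝓝[>] 0) (𝓝 0) := by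
  have : Tendsto (fun x : ℝ => 1 - Real.exp (-x)) (𝓝 0) (𝓝 (1 - Real.exp (-0))) :=
    (by fun_prop : Continuous fun x : ℝ => 1 - Real.exp (-x)).tendsto 0
  simp only [neg_zero, Real.exp_zero, sub_self] at this
  exact (this.mono_left nhdsWithin_le_nhds).comp (tendsto_sq_mul hn)

lemma tendsto_one_sub_exp_neg_sq_mul_div {n : ℝ} (hn : 0 < n) :
    Tendsto (fun η : ℝ => (1 - Real.exp (-(η ^ 2 * n ^ 2))) / η ^ 2) (𝓝[>] 0) (𝓝 (n ^ 2)) := by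
  have h1 : Tendsto (fun η : ℝ => n ^ 2 * (1 + η ^ 2 * n ^ 2)⁻¹) (𝓝[>] 0) (𝓝 (n ^ 2)) := by
    have h2 := ((((tendsto_sq_mul hn).mono_right nhdsWithin_le_nhds).const_add 1).inv₀
      (by norm_num)).const_mul (n ^ 2)
    simpa using h2
  refine tendsto_of_tendsto_of_tendsto_of_le_of_le' h1 tendsto_const_nhds ?_ ?_
  · filter_upwards [self_mem_nhdsWithin] with η hη
    have hη : (0 : ℝ) < η := hη
    have hx : 0 < η ^ 2 * n ^ 2 := by positivity
    have h2 : Real.exp (-(η ^ 2 * n ^ 2)) ≤ (1 + η ^ 2 * n ^ 2)⁻¹ := by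
      rw [Real.exp_neg]
      exact inv_anti₀ (by positivity) (by linarith [Real.add_one_le_exp (η ^ 2 * n ^ 2)])
    rw [le_div_iff₀ (by positivity)]
    have h3 : n ^ 2 * (1 + η ^ 2 * n ^ 2)⁻¹ * η ^ 2 = 1 - (1 + η ^ 2 * n ^ 2)⁻¹ := by
      field_simp
      ring
    linarith
  · filter_upwards [self_mem_nhdsWithin] with η hη
    have hη : (0 : ℝ) < η := hη
    rw [div_le_iff₀ (by positivity)]
    linarith [(one_sub_exp_neg_mem (by positivity : 0 ≤ η ^ 2 * n ^ 2)).2]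

lemma continuousOn_expInt : ContinuousOn expInt (Ioi 0) := fun _ hx =>
  (hasDerivAt_expInt hx).continuousAt.continuousWithinAt

lemma continuousOn_expInt_sq {ξ : ℝ} (hξ : 0 < ξ) :
    ContinuousOn (fun r : Plane => expInt (ξ ^ 2 * ‖r‖ ^ 2)) {0}ᶜ :=
  continuousOn_expInt.comp (by fun_prop) fun r hr => mul_pos (by positivity) (norm_sq_pos hr)

lemma continuousOn_inv_norm_pow (n : ℕ) : ContinuousOn (fun r : Plane => (‖r‖ ^ n)⁻¹) {0}ᶜ :=
  ContinuousOn.inv₀ (by fun_prop) fun _ hr => pow_ne_zero _ (norm_ne_zero_iff.2 hr)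

lemma tail_factor_le : 1 / (4 * Real.pi) ≤ 1 := by
  rw [div_le_one (by positivity)]; linarith [Real.pi_gt_three]

/-- The additive constant that diverges when the screening of `L` is removed. -/
def laplConst (η : ℝ) : ℝ :=
  1 / (4 * Real.pi) * (-Real.eulerMascheroniConstant - 2 * Real.log η - 1)

lemma laplTail_sub_laplConst {η : ℝ} (hη : 0 < η) {r : Plane} (hr : r ≠ 0) :
    laplTail (η ^ 2) r - laplConst η = 1 / (4 * Real.pi) *
      (-2 * Real.log ‖r‖ + ein (η ^ 2 * ‖r‖ ^ 2) + (1 - Real.exp (-(η ^ 2 * ‖r‖ ^ 2)))) := by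
  rw [laplTail, laplConst, expInt_sq_mul hη (norm_pos_iff.2 hr)]
  ring

/-- For `L`, and likewise for `B` and the Stokeslet below, the subtracted polynomial comes from
replacing `E₁(η²|r|²)` by `ein (η²|r|²) - log (η²|r|²) - γ`. -/
lemma screenedKernel_lapl : ScreenedKernel lapl (fun ξ => laplTail (ξ ^ 2))
    (fun k => ((‖k‖ ^ 2 : ℝ) : ℂ)) laplConst (fun _ => 0) := by
  refine isGaussianTail_lapl.screenedKernel ?_ ?_ ?_ ?_
  · exact Function.Complex.hasTemperateGrowth_ofReal.comp (Function.hasTemperateGrowth_norm_sq (H := Plane))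
  · intro ξ hξ
    have := continuousOn_expInt_sq hξ
    unfold laplTail
    fun_prop
  · refine ⟨6, fun η hη h1 r hr => ?_⟩
    have hn : 0 < ‖r‖ := norm_pos_iff.2 hr
    have hx : 0 < η ^ 2 * ‖r‖ ^ 2 := by positivity
    have hx1 := sq_mul_norm_sq_le hη h1 r
    have hl := abs_le.1 (abs_log_norm_le hr)
    have hw0 := norm_inv_le_weight r
    have hw1 := norm_pow_le_weight hr (show 1 ≤ 4 by norm_num)
    have hw2 := norm_pow_le_weight hr (show 2 ≤ 4 by norm_num)
    rw [pow_one] at hw1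
    have he := one_sub_exp_neg_mem hx.le
    have he1 := ein_nonneg hx
    have he2 := ein_le hx
    rw [zero_mul, add_zero, laplTail_sub_laplConst hη hr, abs_mul, abs_of_pos (by positivity)]
    refine (mul_le_of_le_one_left (abs_nonneg _) tail_factor_le).trans ?_
    rw [abs_le]
    constructor <;> linarith
  · intro r hr
    have hn : 0 < ‖r‖ := norm_pos_iff.2 hr
    have h := (((tendsto_ein_sq_mul hn).const_add (-2 * Real.log ‖r‖)).add
      (tendsto_one_sub_exp_neg_sq_mul hn)).const_mul (1 / (4 * Real.pi))
    have e : 1 / (4 * Real.pi) * (-2 * Real.log ‖r‖ + 0 + 0) = lapl r := by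
      rw [lapl]; field_simp; ring
    rw [e] at h
    refine h.congr' ?_
    filter_upwards [self_mem_nhdsWithin] with η hη
    rw [zero_mul, add_zero, laplTail_sub_laplConst hη hr]

lemma biharmTail_sub {η : ℝ} (hη : 0 < η) {r : Plane} (hr : r ≠ 0) :
    biharmTail (η ^ 2) r - (-(1 / (16 * Real.pi * η ^ 2)) + 1 / (16 * Real.pi) *
        (-2 * Real.log η - Real.eulerMascheroniConstant - 2) * ‖r‖ ^ 2)
      = 1 / (16 * Real.pi) * (‖r‖ ^ 2 * ein (η ^ 2 * ‖r‖ ^ 2) + -2 * (‖r‖ ^ 2 * Real.log ‖r‖)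
        + 2 * ‖r‖ ^ 2 + (1 - Real.exp (-(η ^ 2 * ‖r‖ ^ 2))) / η ^ 2) := by
  rw [biharmTail, expInt_sq_mul hη (norm_pos_iff.2 hr)]
  field_simp
  ring

lemma screenedKernel_biharm : ScreenedKernel biharm (fun ξ => biharmTail (ξ ^ 2))
    (fun _ => -1) (fun η => -(1 / (16 * Real.pi * η ^ 2)))
    (fun η => 1 / (16 * Real.pi) * (-2 * Real.log η - Real.eulerMascheroniConstant - 2)) := by
  refine isGaussianTail_biharm.screenedKernel (Function.HasTemperateGrowth.const _) ?_ ?_ ?_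
  · intro ξ hξ
    have := continuousOn_expInt_sq hξ
    unfold biharmTail
    fun_prop
  · refine ⟨9, fun η hη h1 r hr => ?_⟩
    have hn : 0 < ‖r‖ := norm_pos_iff.2 hr
    have hx : 0 < η ^ 2 * ‖r‖ ^ 2 := by positivity
    have hx1 := sq_mul_norm_sq_le hη h1 r
    have hw1 := norm_pow_le_weight hr (show 1 ≤ 4 by norm_num)
    have hw2 := norm_pow_le_weight hr (show 2 ≤ 4 by norm_num)
    have hw3 := norm_pow_le_weight hr (show 3 ≤ 4 by norm_num)
    have hw4 := norm_pow_le_weight hr (show 4 ≤ 4 by norm_num)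
    rw [pow_one] at hw1
    have hl : |‖r‖ ^ 2 * Real.log ‖r‖| ≤ ‖r‖ + ‖r‖ ^ 3 := by
      rw [abs_mul, abs_of_pos (by positivity)]
      calc _ ≤ ‖r‖ ^ 2 * (‖r‖⁻¹ + ‖r‖) := by gcongr; exact abs_log_norm_le hr
        _ = _ := by field_simp
    have hl' := abs_le.1 hl
    have he := one_sub_exp_neg_mem hx.le
    have he0 : 0 ≤ (1 - Real.exp (-(η ^ 2 * ‖r‖ ^ 2))) / η ^ 2 := div_nonneg he.1 (sq_nonneg _)
    have he3 : (1 - Real.exp (-(η ^ 2 * ‖r‖ ^ 2))) / η ^ 2 ≤ ‖r‖ ^ 2 := by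
      rw [div_le_iff₀ (by positivity)]; linarith
    have he1 : 0 ≤ ‖r‖ ^ 2 * ein (η ^ 2 * ‖r‖ ^ 2) := mul_nonneg (sq_nonneg _) (ein_nonneg hx)
    have he2 : ‖r‖ ^ 2 * ein (η ^ 2 * ‖r‖ ^ 2) ≤ ‖r‖ ^ 4 := by
      calc _ ≤ ‖r‖ ^ 2 * ‖r‖ ^ 2 := by gcongr; exact (ein_le hx).trans hx1
        _ = _ := by ring
    have hf : 1 / (16 * Real.pi) ≤ 1 := by
      rw [div_le_one (by positivity)]; linarith [Real.pi_gt_three]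
    rw [biharmTail_sub hη hr, abs_mul, abs_of_pos (by positivity)]
    refine (mul_le_of_le_one_left (abs_nonneg _) hf).trans ?_
    have hw0 := weight_nonneg r
    rw [abs_le]
    constructor <;> linarith
  · intro r hr
    have hn : 0 < ‖r‖ := norm_pos_iff.2 hr
    have h := (((((tendsto_ein_sq_mul hn).const_mul (‖r‖ ^ 2)).add_const
      (-2 * (‖r‖ ^ 2 * Real.log ‖r‖))).add_const (2 * ‖r‖ ^ 2)).add
      (tendsto_one_sub_exp_neg_sq_mul_div hn)).const_mul (1 / (16 * Real.pi))
    have e : 1 / (16 * Real.pi) * (‖r‖ ^ 2 * 0 + -2 * (‖r‖ ^ 2 * Real.log ‖r‖) + 2 * ‖r‖ ^ 2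
        + ‖r‖ ^ 2) = biharm r := by
      rw [biharm]; field_simp; ring
    rw [e] at h
    refine h.congr' ?_
    filter_upwards [self_mem_nhdsWithin] with η hη
    rw [biharmTail_sub hη hr]

lemma abs_coord_mul_div_le (j l : Fin 2) {r : Plane} (hr : r ≠ 0) : |r j * r l / ‖r‖ ^ 2| ≤ 1 := by
  have hn : 0 < ‖r‖ := norm_pos_iff.2 hr
  rw [abs_div, abs_of_pos (by positivity : 0 < ‖r‖ ^ 2), div_le_one (by positivity), abs_mul, pow_two]
  gcongr <;> exact abs_coord_le r _

lemma abs_coord3_mul_div_le (j l m : Fin 2) {r : Plane} (hr : r ≠ 0) :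
    |r j * r l * r m / ‖r‖ ^ 4| ≤ ‖r‖⁻¹ := by
  have hn : 0 < ‖r‖ := norm_pos_iff.2 hr
  rw [abs_div, abs_of_pos (by positivity : 0 < ‖r‖ ^ 4), div_le_iff₀ (by positivity), abs_mul, abs_mul]
  calc |r j| * |r l| * |r m| ≤ ‖r‖ * ‖r‖ * ‖r‖ := by gcongr <;> exact abs_coord_le r _
    _ = _ := by field_simp

lemma stokesletTail_sub {η : ℝ} (hη : 0 < η) (j l : Fin 2) {r : Plane} (hr : r ≠ 0) :
    stokesletTail j l (η ^ 2) r - selfConst η * kd j l = 1 / (4 * Real.pi) *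
      (kd j l * (-Real.log ‖r‖ + ein (η ^ 2 * ‖r‖ ^ 2) / 2 + (1 - Real.exp (-(η ^ 2 * ‖r‖ ^ 2))))
        + r j * r l / ‖r‖ ^ 2 * (1 - (1 - Real.exp (-(η ^ 2 * ‖r‖ ^ 2))))) := by
  rw [stokesletTail, selfConst, expInt_sq_mul hη (norm_pos_iff.2 hr)]
  ring

lemma screenedKernel_stokeslet (j l : Fin 2) :
    ScreenedKernel (stokeslet j l) (fun ξ => stokesletTail j l (ξ ^ 2))
    (fun k => ((kd j l * ‖k‖ ^ 2 - k j * k l : ℝ) : ℂ)) (fun η => selfConst η * kd j l)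
    (fun _ => 0) := by
  refine (isGaussianTail_stokeslet j l).screenedKernel ?_ ?_ ?_ ?_
  · refine Function.Complex.hasTemperateGrowth_ofReal.comp (f := fun k : Plane => kd j l * ‖k‖ ^ 2 - k j * k l) ?_
    have h2 := Function.hasTemperateGrowth_norm_sq (H := Plane)
    have hc : ∀ i : Fin 2, (fun k : Plane => k i).HasTemperateGrowth := fun i =>
      (EuclideanSpace.proj (𝕜 := ℝ) i : Plane →L[ℝ] ℝ).hasTemperateGrowth
    have := hc j
    have := hc l
    fun_prop
  · intro ξ hξ
    have := continuousOn_expInt_sq hξ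
    have := continuousOn_inv_norm_pow 2
    unfold stokesletTail
    simp only [div_eq_mul_inv _ (‖_‖ ^ 2)]
    fun_prop
  · refine ⟨6, fun η hη h1 r hr => ?_⟩
    have hn : 0 < ‖r‖ := norm_pos_iff.2 hr
    have hx : 0 < η ^ 2 * ‖r‖ ^ 2 := by positivity
    have hx1 := sq_mul_norm_sq_le hη h1 r
    have hl := abs_le.1 (abs_log_norm_le hr)
    have hw := norm_inv_le_weight r
    have hw0 := norm_pow_le_weight hr (show 0 ≤ 4 by norm_num)
    have hw1 := norm_pow_le_weight hr (show 1 ≤ 4 by norm_num)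
    have hw2 := norm_pow_le_weight hr (show 2 ≤ 4 by norm_num)
    rw [pow_one] at hw1
    rw [pow_zero] at hw0
    have he := one_sub_exp_neg_mem hx.le
    have he1 := ein_nonneg hx
    have he2 := ein_le hx
    have hep := Real.exp_pos (-(η ^ 2 * ‖r‖ ^ 2))
    rw [zero_mul, add_zero, stokesletTail_sub hη j l hr, abs_mul, abs_of_pos (by positivity)]
    refine (mul_le_of_le_one_left (abs_nonneg _) tail_factor_le).trans ((abs_add_le _ _).trans ?_)
    rw [abs_mul, abs_mul]
    calc _ ≤ 1 * (5 * weight r) + 1 * 1 := by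
          gcongr
          · exact abs_kd_le j l
          · rw [abs_le]; constructor <;> linarith
          · exact abs_coord_mul_div_le j l hr
          · rw [abs_le]; constructor <;> linarith
      _ ≤ _ := by linarith
  · intro r hr
    have hn : 0 < ‖r‖ := norm_pos_iff.2 hr
    have h := (((((tendsto_ein_sq_mul hn).div_const 2).const_add (-Real.log ‖r‖)).add
      (tendsto_one_sub_exp_neg_sq_mul hn)).const_mul (kd j l)).add
      (((tendsto_one_sub_exp_neg_sq_mul hn).const_sub 1).const_mul (r j * r l / ‖r‖ ^ 2))
    have h := h.const_mul (1 / (4 * Real.pi))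
    have e : 1 / (4 * Real.pi) * (kd j l * (-Real.log ‖r‖ + 0 / 2 + 0)
        + r j * r l / ‖r‖ ^ 2 * (1 - 0)) = stokeslet j l r := by
      rw [stokeslet]; ring
    rw [e] at h
    refine h.congr' ?_
    filter_upwards [self_mem_nhdsWithin] with η hη
    rw [zero_mul, add_zero, stokesletTail_sub hη j l hr]

lemma abs_kd_mul_coord_sum_le (j l m : Fin 2) (r : Plane) :
    |kd j l * r m + kd j m * r l + kd l m * r j| ≤ 3 * ‖r‖ := by
  have hk : ∀ a b c : Fin 2, |kd a b * r c| ≤ ‖r‖ := fun a b c => by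
    rw [abs_mul]
    exact (mul_le_mul (abs_kd_le a b) (abs_coord_le r c) (abs_nonneg _) zero_le_one).trans_eq
      (one_mul _)
  have := abs_add_three (kd j l * r m) (kd j m * r l) (kd l m * r j)
  linarith [hk j l m, hk j m l, hk l m j]

lemma screenedKernel_stresslet (j l m : Fin 2) :
    ScreenedKernel (stresslet j l m) (fun ξ => stressletTail j l m (ξ ^ 2))
    (fun k => Complex.I * (((kd j l * k m + kd j m * k l + kd l m * k j) * ‖k‖ ^ 2
      - 2 * (k j * k l * k m) : ℝ) : ℂ)) (fun _ => 0) (fun _ => 0) := by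
  refine (isGaussianTail_stresslet j l m).screenedKernel ?_ ?_ ?_ ?_
  · have h2 := Function.hasTemperateGrowth_norm_sq (H := Plane)
    have hc : ∀ i : Fin 2, (fun k : Plane => k i).HasTemperateGrowth := fun i =>
      (EuclideanSpace.proj (𝕜 := ℝ) i : Plane →L[ℝ] ℝ).hasTemperateGrowth
    have := hc j
    have := hc l
    have := hc m
    refine (Function.HasTemperateGrowth.const _).mul (Function.Complex.hasTemperateGrowth_ofReal.comp
      (f := fun k : Plane => (kd j l * k m + kd j m * k l + kd l m * k j) * ‖k‖ ^ 2
        - 2 * (k j * k l * k m)) ?_)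
    fun_prop
  · intro ξ hξ
    have := continuousOn_inv_norm_pow 4
    unfold stressletTail
    simp only [div_eq_mul_inv _ (‖_‖ ^ 4)]
    fun_prop
  · refine ⟨5, fun η hη h1 r hr => ?_⟩
    have hn : 0 < ‖r‖ := norm_pos_iff.2 hr
    have hx : 0 < η ^ 2 * ‖r‖ ^ 2 := by positivity
    have hw := norm_inv_le_weight r
    have hw1 := norm_pow_le_weight hr (show 1 ≤ 4 by norm_num)
    rw [pow_one] at hw1
    have h2 : 1 / (2 * Real.pi) ≤ 1 := by
      rw [div_le_one (by positivity)]; linarith [Real.pi_gt_three]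
    have h3 : Real.exp (-(η ^ 2 * ‖r‖ ^ 2)) ≤ 1 := Real.exp_le_one_iff.2 (by linarith)
    have h4 : (1 + η ^ 2 * ‖r‖ ^ 2) * Real.exp (-(η ^ 2 * ‖r‖ ^ 2)) ≤ 1 := by
      rw [Real.exp_neg, ← div_eq_mul_inv, div_le_one (Real.exp_pos _)]
      linarith [Real.add_one_le_exp (η ^ 2 * ‖r‖ ^ 2)]
    have e : stressletTail j l m (η ^ 2) r = 1 / (2 * Real.pi) *
        (Real.exp (-(η ^ 2 * ‖r‖ ^ 2)) * η ^ 2 * (kd j l * r m + kd j m * r l + kd l m * r j)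
        - 2 * ((1 + η ^ 2 * ‖r‖ ^ 2) * Real.exp (-(η ^ 2 * ‖r‖ ^ 2)) * (r j * r l * r m / ‖r‖ ^ 4))) := by
      rw [stressletTail]; ring
    rw [zero_mul, add_zero, sub_zero, e, abs_mul, abs_of_pos (by positivity)]
    refine (mul_le_of_le_one_left (abs_nonneg _) h2).trans ((abs_sub _ _).trans ?_)
    rw [abs_mul, abs_mul 2, abs_mul (_ * Real.exp _), abs_of_pos (by positivity : 0 < (1 + η ^ 2 * ‖r‖ ^ 2) * Real.exp (-(η ^ 2 * ‖r‖ ^ 2))),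
      abs_of_pos (by positivity : 0 < Real.exp (-(η ^ 2 * ‖r‖ ^ 2)) * η ^ 2), abs_of_pos (two_pos : (0 : ℝ) < 2)]
    calc _ ≤ 1 * 1 * (3 * ‖r‖) + 2 * (1 * ‖r‖⁻¹) := by
          gcongr
          · exact pow_le_one₀ hη.le h1
          · exact abs_kd_mul_coord_sum_le j l m r
          · exact abs_coord3_mul_div_le j l m hr
      _ ≤ _ := by linarith
  · intro r hr
    have hc : Continuous fun η : ℝ => stressletTail j l m (η ^ 2) r := by
      unfold stressletTail; fun_prop
    have h := (hc.tendsto 0).mono_left (nhdsWithin_le_nhds (s := Ioi 0))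
    have e : stressletTail j l m (0 ^ 2) r = stresslet j l m r := by
      rw [stresslet, stressletTail]
      simp
      ring
    rw [e] at h
    refine h.congr fun η => ?_
    ring

/-! ### The real-space parts and their derivatives -/

lemma tendsto_mul_expInt_zero : Tendsto (fun x => x * expInt x) (𝓝[>] 0) (𝓝 0) := by
  have h1 : Tendsto (fun x : ℝ => Real.log x * x) (𝓝[>] 0) (𝓝 0) :=
    by simpa only [Real.rpow_one] using tendsto_log_mul_rpow_nhdsGT_zero zero_lt_one
  have h0 : Tendsto (fun x : ℝ => x) (𝓝[>] 0) (𝓝 0) := tendsto_id.mono_left nhdsWithin_le_nhds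
  have h := ((h0.mul tendsto_ein_zero).sub h1).sub (h0.mul_const Real.eulerMascheroniConstant)
  simp only [mul_zero, sub_zero, zero_mul] at h
  refine h.congr fun x => ?_
  rw [expInt_eq]
  ring

lemma tendsto_norm_sq_nhdsNE {t : ℝ} (ht : 0 < t) :
    Tendsto (fun r : Plane => t * ‖r‖ ^ 2) (𝓝[≠] 0) (𝓝[>] 0) := by
  refine tendsto_nhdsWithin_iff.2 ⟨?_, ?_⟩
  · have := (by fun_prop : Continuous fun r : Plane => t * ‖r‖ ^ 2).tendsto 0
    simp only [norm_zero, ne_eq, OfNat.ofNat_ne_zero, not_false_eq_true, zero_pow, mul_zero] at this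
    exact this.mono_left nhdsWithin_le_nhds
  · filter_upwards [self_mem_nhdsWithin] with r hr
    exact mul_pos ht (norm_sq_pos hr)

lemma continuousAt_biharmTail_zero {t : ℝ} (ht : 0 < t) : ContinuousAt (biharmTail t) 0 := by
  rw [← continuousWithinAt_compl_self]
  have h1 := tendsto_mul_expInt_zero.comp (tendsto_norm_sq_nhdsNE ht)
  have h2 : Tendsto (fun r : Plane => Real.exp (-(t * ‖r‖ ^ 2))) (𝓝[≠] 0) (𝓝 1) := by
    have := (by fun_prop : Continuous fun r : Plane => Real.exp (-(t * ‖r‖ ^ 2))).tendsto 0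
    simp only [norm_zero, ne_eq, OfNat.ofNat_ne_zero, not_false_eq_true, zero_pow, mul_zero,
      neg_zero, Real.exp_zero] at this
    exact this.mono_left nhdsWithin_le_nhds
  have h := (h1.sub h2).const_mul (1 / (16 * Real.pi * t))
  have e : biharmTail t 0 = 1 / (16 * Real.pi * t) * (0 - 1) := by simp [biharmTail]
  rw [ContinuousWithinAt, e]
  exact h

/-- At `r = 0` the splitting holds too, because `biharmTail` is continuous there and both
`biharmTail` minus its polynomial and `B` vanish. -/
lemma biharmR_eq_biharmTail {ξ : ℝ} (hξ : 0 < ξ) : biharmR ξ = biharmTail (ξ ^ 2) := by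
  funext r
  have h : biharm r = biharmTail (ξ ^ 2) r + screened ξ biharm r := by
    by_cases hr : r = 0
    · subst hr
      refine screenedKernel_biharm.eq_add_screened_of_limit hξ
        (fun η hη => continuousAt_biharmTail_zero (by positivity)) ?_
      refine tendsto_const_nhds.congr' ?_
      filter_upwards [self_mem_nhdsWithin] with η hη
      have hη : (0 : ℝ) < η := hη
      simp [biharmTail, biharm]
    · exact screenedKernel_biharm.eq_add_screened hξ hr
  rw [biharmR, h, add_sub_cancel_right]

lemma laplR_eq_laplTail {ξ : ℝ} (hξ : 0 < ξ) {r : Plane} (hr : r ≠ 0) :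
    laplR ξ r = laplTail (ξ ^ 2) r := by
  rw [laplR, screenedKernel_lapl.eq_add_screened hξ hr, add_sub_cancel_right]

/-- The profile of `biharmTail t` as a function of `s = |r|²`, with three derivatives: enough for all
third partial derivatives of `B^R`. -/
lemma hasJet_biharmTail {t : ℝ} (ht : 0 < t) : HasJet (Ioi 0)
    (fun s => 1 / (16 * Real.pi * t) * (t * s * expInt (t * s) - Real.exp (-(t * s))))
    (fun s => 1 / (16 * Real.pi) * expInt (t * s))
    (fun s => -(1 / (16 * Real.pi)) * (Real.exp (-(t * s)) / s))
    (fun s => 1 / (16 * Real.pi) * (Real.exp (-(t * s)) * (t / s + 1 / s ^ 2))) := by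
  have hm : ∀ s, HasDerivAt (fun s : ℝ => t * s) t s := fun s => by
    simpa using (hasDerivAt_id s).const_mul t
  have he : ∀ s, HasDerivAt (fun s : ℝ => Real.exp (-(t * s))) (Real.exp (-(t * s)) * -t) s :=
    fun s => (hm s).neg.exp
  have hE : ∀ s, 0 < s → HasDerivAt (fun s : ℝ => expInt (t * s))
      (-(Real.exp (-(t * s)) / (t * s)) * t) s := fun s hs =>
    (hasDerivAt_expInt (mul_pos ht hs)).comp s (hm s)
  have hp := Real.pi_ne_zero
  refine ⟨fun s hs => ?_, fun s hs => ?_, fun s hs => ?_⟩ <;> have hs : 0 < s := hs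
  · have := (((hm s).mul (hE s hs)).sub (he s)).const_mul (1 / (16 * Real.pi * t))
    convert! this using 1
    field_simp
    ring
  · have := (hE s hs).const_mul (1 / (16 * Real.pi))
    convert! this using 1
    field_simp
  · have := ((he s).div (hasDerivAt_id s) hs.ne').const_mul (-(1 / (16 * Real.pi)))
    convert! this using 1
    simp only [id]
    field_simp
    ring

lemma lap_biharmTail {t : ℝ} (ht : 0 < t) {r : Plane} (hr : r ≠ 0) :
    lap (biharmTail t) r = laplTail t r := by
  have hn : ‖r‖ ≠ 0 := norm_ne_zero_iff.2 hr
  have := (hasJet_biharmTail ht).lap isOpen_Ioi (norm_sq_mem_Ioi hr)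
  refine this.trans ?_
  rw [laplTail]
  field_simp
  ring

lemma lap_biharmR {ξ : ℝ} (hξ : 0 < ξ) {r : Plane} (hr : r ≠ 0) : lap (biharmR ξ) r = laplR ξ r := by
  rw [biharmR_eq_biharmTail hξ, lap_biharmTail (by positivity) hr, laplR_eq_laplTail hξ hr]

lemma stokesletR_eq {ξ : ℝ} (hξ : 0 < ξ) (j l : Fin 2) {r : Plane} (hr : r ≠ 0) :
    stokesletR ξ j l r = stokesletTail j l (ξ ^ 2) r := by
  have hn : ‖r‖ ≠ 0 := norm_ne_zero_iff.2 hr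
  have h2 : pd j (pd l (biharmTail (ξ ^ 2))) r = _ :=
    (hasJet_biharmTail (by positivity : 0 < ξ ^ 2)).pd2 isOpen_Ioi (norm_sq_mem_Ioi hr) j l
  rw [stokesletR, laplR_eq_laplTail hξ hr, biharmR_eq_biharmTail hξ, h2, laplTail, stokesletTail]
  field_simp
  ring

lemma stressletR_eq {ξ : ℝ} (hξ : 0 < ξ) (j l m : Fin 2) {r : Plane} (hr : r ≠ 0) :
    stressletR ξ j l m r = stressletTail j l m (ξ ^ 2) r := by
  have hn : ‖r‖ ≠ 0 := norm_ne_zero_iff.2 hr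
  have ht : 0 < ξ ^ 2 := by positivity
  have h1 : ∀ i, pd i (laplR ξ) r = pd i (lap (biharmTail (ξ ^ 2))) r := fun i =>
    pd_eventuallyEq (fun s hs => by rw [lap_biharmTail ht hs, laplR_eq_laplTail hξ hs]) hr i
  have h2 : ∀ i, pd i (lap (biharmTail (ξ ^ 2))) r = _ := fun i =>
    (hasJet_biharmTail ht).pd_lap isOpen_Ioi (norm_sq_mem_Ioi hr) i
  have h3 : pd j (pd l (pd m (biharmTail (ξ ^ 2)))) r = _ :=
    (hasJet_biharmTail ht).pd3 isOpen_Ioi (norm_sq_mem_Ioi hr) j l m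
  rw [stressletR, h1, h1, h1, h2, h2, h2, biharmR_eq_biharmTail hξ, h3, stressletTail]
  field_simp
  ring

lemma contDiffOn_expInt : ContDiffOn ℝ ∞ expInt (Ioi 0) := by
  rw [contDiffOn_infty_iff_deriv_of_isOpen isOpen_Ioi]
  refine ⟨fun x hx => (hasDerivAt_expInt hx).differentiableAt.differentiableWithinAt, ?_⟩
  have : ContDiffOn ℝ ∞ (fun x : ℝ => -(Real.exp (-x) / x)) (Ioi 0) :=
    ((Real.contDiff_exp.comp contDiff_neg).contDiffOn.div contDiffOn_id fun x hx => ne_of_gt hx).neg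
  exact this.congr fun x hx => (hasDerivAt_expInt hx).deriv

lemma contDiffOn_expInt_mul_norm_sq {t : ℝ} (ht : 0 < t) :
    ContDiffOn ℝ ∞ (fun r : Plane => expInt (t * ‖r‖ ^ 2)) {0}ᶜ :=
  contDiffOn_expInt.comp (contDiff_const.mul (contDiff_norm_sq ℝ)).contDiffOn
    fun _ hr => mul_pos ht (norm_sq_pos hr)

lemma contDiff_exp_neg_mul_norm_sq (t : ℝ) :
    ContDiff ℝ ∞ (fun r : Plane => Real.exp (-(t * ‖r‖ ^ 2))) := contDiff_gauss t

lemma contDiffOn_biharmR {ξ : ℝ} (hξ : 0 < ξ) : ContDiffOn ℝ ∞ (biharmR ξ) {0}ᶜ := by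
  rw [biharmR_eq_biharmTail hξ]
  have h1 := contDiffOn_expInt_mul_norm_sq (t := ξ ^ 2) (by positivity)
  have h2 := (contDiff_exp_neg_mul_norm_sq (ξ ^ 2)).contDiffOn (s := {0}ᶜ)
  have h3 : ContDiffOn ℝ ∞ (fun r : Plane => ξ ^ 2 * ‖r‖ ^ 2) {0}ᶜ :=
    (contDiff_const.mul (contDiff_norm_sq ℝ)).contDiffOn
  exact contDiffOn_const.mul ((h3.mul h1).sub h2)

lemma contDiffOn_laplR {ξ : ℝ} (hξ : 0 < ξ) : ContDiffOn ℝ ∞ (laplR ξ) {0}ᶜ := by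
  have h1 := contDiffOn_expInt_mul_norm_sq (t := ξ ^ 2) (by positivity)
  have h2 := (contDiff_exp_neg_mul_norm_sq (ξ ^ 2)).contDiffOn (s := {0}ᶜ)
  exact (contDiffOn_const.mul (h2.neg.add h1)).congr fun r hr => laplR_eq_laplTail hξ hr

/-! ### The self-interaction limits -/

lemma tendsto_stokesletR_sub {ξ : ℝ} (hξ : 0 < ξ) (j l : Fin 2) :
    Tendsto (fun r => stokesletR ξ j l r - stokeslet j l r) (𝓝[≠] 0)
      (𝓝 (selfConst ξ * kd j l)) := by
  have hx : Tendsto (fun r : Plane => 3 * (ξ ^ 2 * ‖r‖ ^ 2)) (𝓝[≠] 0) (𝓝 0) := by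
    have := ((tendsto_norm_sq_nhdsNE (by positivity : 0 < ξ ^ 2)).mono_right
      nhdsWithin_le_nhds).const_mul 3
    simpa using this
  rw [tendsto_iff_norm_sub_tendsto_zero]
  refine squeeze_zero' (Eventually.of_forall fun _ => norm_nonneg _) ?_ hx
  filter_upwards [self_mem_nhdsWithin] with r hr
  have hr : r ≠ 0 := hr
  have hp : 0 < ξ ^ 2 * ‖r‖ ^ 2 := mul_pos (by positivity) (norm_sq_pos hr)
  have e : stokesletR ξ j l r - stokeslet j l r - selfConst ξ * kd j l = 1 / (4 * Real.pi) *
      (kd j l * (ein (ξ ^ 2 * ‖r‖ ^ 2) / 2 + (1 - Real.exp (-(ξ ^ 2 * ‖r‖ ^ 2))))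
        + -(r j * r l / ‖r‖ ^ 2) * (1 - Real.exp (-(ξ ^ 2 * ‖r‖ ^ 2)))) := by
    have := stokesletTail_sub hξ j l hr
    rw [stokesletR_eq hξ j l hr, sub_right_comm, this, stokeslet]
    ring
  obtain ⟨h1, h2⟩ := one_sub_exp_neg_mem hp.le
  have h3 := ein_nonneg hp
  have h4 := ein_le hp
  rw [e, Real.norm_eq_abs, abs_mul, abs_of_pos (by positivity)]
  refine (mul_le_of_le_one_left (abs_nonneg _) tail_factor_le).trans ((abs_add_le _ _).trans ?_)
  rw [abs_mul, abs_mul, abs_neg]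
  calc _ ≤ 1 * (2 * (ξ ^ 2 * ‖r‖ ^ 2)) + 1 * (ξ ^ 2 * ‖r‖ ^ 2) := by
        gcongr
        · exact abs_kd_le j l
        · rw [abs_le]; constructor <;> linarith
        · exact abs_coord_mul_div_le j l hr
        · rw [abs_le]; constructor <;> linarith
    _ = _ := by ring

lemma tendsto_stressletR_sub {ξ : ℝ} (hξ : 0 < ξ) (j l m : Fin 2) :
    Tendsto (fun r => stressletR ξ j l m r - stresslet j l m r) (𝓝[≠] 0) (𝓝 0) := by
  have hx : Tendsto (fun r : Plane => 5 * ξ ^ 2 * ‖r‖) (𝓝[≠] 0) (𝓝 0) := by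
    have := (by fun_prop : Continuous fun r : Plane => 5 * ξ ^ 2 * ‖r‖).tendsto 0
    simp only [norm_zero, mul_zero] at this
    exact this.mono_left nhdsWithin_le_nhds
  refine squeeze_zero_norm' ?_ hx
  filter_upwards [self_mem_nhdsWithin] with r hr
  have hr : r ≠ 0 := hr
  have hn : 0 < ‖r‖ := norm_pos_iff.2 hr
  have hp : 0 < ξ ^ 2 * ‖r‖ ^ 2 := mul_pos (by positivity) (norm_sq_pos hr)
  have e : stressletR ξ j l m r - stresslet j l m r = 1 / (2 * Real.pi) *
      (Real.exp (-(ξ ^ 2 * ‖r‖ ^ 2)) * ξ ^ 2 * (kd j l * r m + kd j m * r l + kd l m * r j)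
      + 2 * ((1 - (1 + ξ ^ 2 * ‖r‖ ^ 2) * Real.exp (-(ξ ^ 2 * ‖r‖ ^ 2)))
        * (r j * r l * r m / ‖r‖ ^ 4))) := by
    rw [stressletR_eq hξ j l m hr, stressletTail, stresslet]
    ring
  have h2 : 1 / (2 * Real.pi) ≤ 1 := by
    rw [div_le_one (by positivity)]; linarith [Real.pi_gt_three]
  have h3 : Real.exp (-(ξ ^ 2 * ‖r‖ ^ 2)) ≤ 1 := Real.exp_le_one_iff.2 (by linarith)
  have h4 : (1 + ξ ^ 2 * ‖r‖ ^ 2) * Real.exp (-(ξ ^ 2 * ‖r‖ ^ 2)) ≤ 1 := by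
    rw [Real.exp_neg, ← div_eq_mul_inv, div_le_one (Real.exp_pos _)]
    linarith [Real.add_one_le_exp (ξ ^ 2 * ‖r‖ ^ 2)]
  have h5 : 1 - (1 + ξ ^ 2 * ‖r‖ ^ 2) * Real.exp (-(ξ ^ 2 * ‖r‖ ^ 2)) ≤ ξ ^ 2 * ‖r‖ ^ 2 := by
    have := Real.add_one_le_exp (-(ξ ^ 2 * ‖r‖ ^ 2))
    have h6 := mul_nonneg hp.le (Real.exp_nonneg (-(ξ ^ 2 * ‖r‖ ^ 2)))
    linarith
  rw [e, Real.norm_eq_abs, abs_mul, abs_of_pos (by positivity)]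
  refine (mul_le_of_le_one_left (abs_nonneg _) h2).trans ((abs_add_le _ _).trans ?_)
  rw [abs_mul, abs_mul 2, abs_mul (1 - _), abs_of_nonneg (sub_nonneg.2 h4),
    abs_of_pos (by positivity : 0 < Real.exp (-(ξ ^ 2 * ‖r‖ ^ 2)) * ξ ^ 2),
    abs_of_pos (two_pos : (0 : ℝ) < 2)]
  calc _ ≤ 1 * ξ ^ 2 * (3 * ‖r‖) + 2 * (ξ ^ 2 * ‖r‖ ^ 2 * ‖r‖⁻¹) := by
        gcongr
        · exact abs_kd_mul_coord_sum_le j l m r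
        · exact abs_coord3_mul_div_le j l m hr
    _ = _ := by field_simp; ring

/-! ### The Hasimoto splits -/

/-- The numerator `k⁴ Ĝ_{jl}(k)` of the Fourier transform of the Stokeslet. -/
def stokesletNum (j l : Fin 2) (k : Plane) : ℂ := ((kd j l * ‖k‖ ^ 2 - k j * k l : ℝ) : ℂ)

/-- The numerator `k⁴ T̂_{jlm}(k)` of the Fourier transform of the stresslet. -/
def stressletNum (j l m : Fin 2) (k : Plane) : ℂ :=
  Complex.I * (((kd j l * k m + kd j m * k l + kd l m * k j) * ‖k‖ ^ 2
    - 2 * (k j * k l * k m) : ℝ) : ℂ)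

lemma stokesletHat_eq (j l : Fin 2) {k : Plane} (hk : k ≠ 0) :
    stokesletHat j l k = stokesletNum j l k / ((‖k‖ ^ 4 : ℝ) : ℂ) := by
  have hn : ‖k‖ ≠ 0 := norm_ne_zero_iff.2 hk
  rw [stokesletHat, stokesletNum, ← Complex.ofReal_div]
  congr 1
  simp only [unitComp]
  field_simp

lemma stressletHat_eq (j l m : Fin 2) {k : Plane} (hk : k ≠ 0) :
    stressletHat j l m k = stressletNum j l m k / ((‖k‖ ^ 4 : ℝ) : ℂ) := by
  have hn : ‖k‖ ≠ 0 := norm_ne_zero_iff.2 hk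
  rw [stressletHat, stressletNum, mul_div_assoc, ← Complex.ofReal_div]
  congr 2
  simp only [stressletSymbol, unitComp]
  field_simp

lemma stokesletFHat_eq (ξ : ℝ) (j l : Fin 2) (k : Plane) :
    stokesletFHat ξ j l k = (hasimotoHat ξ k : ℂ) * stokesletHat j l k := by
  rw [stokesletFHat, stokesletHat, hasimotoHat, ← Complex.ofReal_mul]
  congr 1
  ring

lemma stressletFHat_eq (ξ : ℝ) (j l m : Fin 2) (k : Plane) :
    stressletFHat ξ j l m k = (hasimotoHat ξ k : ℂ) * stressletHat j l m k := by
  rw [stressletFHat, stressletHat, hasimotoHat, mul_left_comm, ← Complex.ofReal_mul]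
  congr 2
  ring

lemma isHasimotoSplit_biharm {ξ : ℝ} (hξ : 0 < ξ) :
    IsHasimotoSplit ξ biharm (biharmR ξ) biharmHat (biharmFHat ξ) := by
  refine screenedKernel_biharm.isHasimotoSplit hξ
    (fun r _ => congrFun (biharmR_eq_biharmTail hξ) r) (fun k _ => ?_) fun k _ => ?_
  · rw [biharmHat]; push_cast; rfl
  · rw [biharmFHat, biharmHat, hasimotoHat, ← Complex.ofReal_mul]
    congr 1
    ring

lemma isHasimotoSplit_lapl {ξ : ℝ} (hξ : 0 < ξ) :
    IsHasimotoSplit ξ lapl (laplR ξ) laplHat (laplFHat ξ) := by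
  refine screenedKernel_lapl.isHasimotoSplit hξ
    (fun r hr => laplR_eq_laplTail hξ hr) (fun k hk => ?_) fun k _ => ?_
  · have hn : ‖k‖ ≠ 0 := norm_ne_zero_iff.2 hk
    rw [laplHat, ← Complex.ofReal_div]
    congr 1
    field_simp
  · rw [laplFHat, laplHat, hasimotoHat, ← Complex.ofReal_mul]
    congr 1
    ring

lemma isHasimotoSplit_stokeslet {ξ : ℝ} (hξ : 0 < ξ) (j l : Fin 2) :
    IsHasimotoSplit ξ (stokeslet j l) (stokesletR ξ j l) (stokesletHat j l)
      (stokesletFHat ξ j l) :=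
  (screenedKernel_stokeslet j l).isHasimotoSplit hξ (fun _ hr => stokesletR_eq hξ j l hr)
    (fun _ hk => stokesletHat_eq j l hk) fun k _ => stokesletFHat_eq ξ j l k

lemma isHasimotoSplit_stresslet {ξ : ℝ} (hξ : 0 < ξ) (j l m : Fin 2) :
    IsHasimotoSplit ξ (stresslet j l m) (stressletR ξ j l m) (stressletHat j l m)
      (stressletFHat ξ j l m) :=
  (screenedKernel_stresslet j l m).isHasimotoSplit hξ (fun _ hr => stressletR_eq hξ j l m hr)
    (fun _ hk => stressletHat_eq j l m hk) fun k _ => stressletFHat_eq ξ j l m k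

lemma stressletR_symm {ξ : ℝ} (hξ : 0 < ξ) (j l m : Fin 2) {r : Plane} (hr : r ≠ 0) :
    stressletR ξ j l m r = stressletR ξ l j m r ∧ stressletR ξ j l m r = stressletR ξ j m l r := by
  simp only [stressletR_eq hξ _ _ _ hr, stressletTail]
  constructor
  · rw [kd_comm j l]; ring
  · rw [kd_comm l m]; ring

lemma stressletFHat_symm (ξ : ℝ) (j l m : Fin 2) (k : Plane) :
    stressletFHat ξ j l m k = stressletFHat ξ l j m k ∧
      stressletFHat ξ j l m k = stressletFHat ξ j m l k := by
  have h1 : stressletSymbol j l m k = stressletSymbol l j m k := by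
    simp only [stressletSymbol]; rw [kd_comm j l]; ring
  have h2 : stressletSymbol j l m k = stressletSymbol j m l k := by
    simp only [stressletSymbol]; rw [kd_comm l m]; ring
  simp only [stressletFHat]
  exact ⟨by rw [h1], by rw [h2]⟩

/-! ### The lattice and its periodic box -/

section Lattice

variable {L : Fin 2 → ℝ}

@[simp] lemma latticeVec_apply (L : Fin 2 → ℝ) (p : Fin 2 → ℤ) (i : Fin 2) :
    latticeVec L p i = p i * L i := rfl

@[simp] lemma waveVec_apply (L : Fin 2 → ℝ) (q : Fin 2 → ℤ) (i : Fin 2) :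
    waveVec L q i = 2 * Real.pi * q i / L i := rfl

lemma latticeVec_add (L : Fin 2 → ℝ) (p q : Fin 2 → ℤ) :
    latticeVec L (p + q) = latticeVec L p + latticeVec L q := by ext i; simp; ring

lemma latticeVec_neg (L : Fin 2 → ℝ) (p : Fin 2 → ℤ) : latticeVec L (-p) = -latticeVec L p := by
  ext i; simp

lemma waveVec_neg (L : Fin 2 → ℝ) (q : Fin 2 → ℤ) : waveVec L (-q) = -waveVec L q := by
  ext i; simp; ring

@[simp] lemma waveVec_zero (L : Fin 2 → ℝ) : waveVec L 0 = 0 := by ext i; simp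

lemma latticeVec_injective (hL : ∀ i, 0 < L i) : Function.Injective (latticeVec L) := by
  intro p q h
  funext i
  have h1 : latticeVec L p i = latticeVec L q i := by rw [h]
  simp only [latticeVec_apply] at h1
  exact_mod_cast mul_right_cancel₀ (hL i).ne' h1

lemma waveVec_injective (hL : ∀ i, 0 < L i) : Function.Injective (waveVec L) := by
  intro p q h
  funext i
  have h1 : waveVec L p i = waveVec L q i := by rw [h]
  simp only [waveVec_apply] at h1
  have := (div_left_inj' (hL i).ne').1 h1
  exact_mod_cast mul_left_cancel₀ (by positivity) this

lemma inner_eq_sum (k r : Plane) : inner ℝ k r = k 0 * r 0 + k 1 * r 1 := by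
  rw [PiLp.inner_apply, Fin.sum_univ_two]
  simp [mul_comm]

lemma wave_waveVec_latticeVec (hL : ∀ i, 0 < L i) (q p : Fin 2 → ℤ) :
    wave (waveVec L q) (latticeVec L p) = 1 := by
  have h0 := (hL 0).ne'
  have h1 := (hL 1).ne'
  rw [wave_def, Complex.exp_eq_one_iff]
  refine ⟨q 0 * p 0 + q 1 * p 1, ?_⟩
  rw [inner_eq_sum]
  simp only [latticeVec_apply, waveVec_apply]
  rw [show 2 * Real.pi * (q 0 : ℝ) / L 0 * (p 0 * L 0) + 2 * Real.pi * (q 1 : ℝ) / L 1 * (p 1 * L 1)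
    = 2 * Real.pi * (q 0 * p 0 + q 1 * p 1) by field_simp]
  push_cast
  ring

lemma wave_sub_latticeVec (hL : ∀ i, 0 < L i) (q p : Fin 2 → ℤ) (y : Plane) :
    wave (waveVec L q) (y - latticeVec L p) = wave (waveVec L q) y := by
  rw [sub_eq_add_neg, ← latticeVec_neg, wave_add_right, wave_waveVec_latticeVec hL, mul_one]

lemma measurableSet_box (L : Fin 2 → ℝ) : MeasurableSet (box L) := by
  have : box L = ⋂ i, (fun r : Plane => r i) ⁻¹' Ico 0 (L i) := by
    ext r; simp [box]
  rw [this]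
  exact MeasurableSet.iInter fun i => (by fun_prop : Measurable fun r : Plane => r i) measurableSet_Ico

lemma norm_le_of_mem_box {y : Plane} (hy : y ∈ box L) : ‖y‖ ≤ L 0 + L 1 := by
  have h0 := hy 0
  have h1 := hy 1
  refine le_of_sq_le_sq ?_ (by linarith [h0.1, h0.2, h1.1, h1.2])
  rw [norm_sq_eq]
  nlinarith [h0.1, h0.2, h1.1, h1.2]

/-- The translate of the periodic box by `-τ(p)`. -/
def cell (L : Fin 2 → ℝ) (p : Fin 2 → ℤ) : Set Plane := {y | y + latticeVec L p ∈ box L}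

lemma measurableSet_cell (L : Fin 2 → ℝ) (p : Fin 2 → ℤ) : MeasurableSet (cell L p) :=
  (by fun_prop : Measurable fun y : Plane => y + latticeVec L p) (measurableSet_box L)

lemma mem_cell_iff (hL : ∀ i, 0 < L i) (p : Fin 2 → ℤ) (y : Plane) :
    y ∈ cell L p ↔ ∀ i, p i = -⌊y i / L i⌋ := by
  refine forall_congr' fun i => ?_
  have e : p i = -⌊y i / L i⌋ ↔ ⌊y i / L i⌋ = -p i := by omega
  rw [e, Int.floor_eq_iff, PiLp.add_apply, latticeVec_apply, le_div_iff₀ (hL i), div_lt_iff₀ (hL i), mem_Ico]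
  push_cast
  constructor <;> rintro ⟨h1, h2⟩ <;> constructor <;> linarith

lemma pairwise_disjoint_cell (hL : ∀ i, 0 < L i) : Pairwise (Function.onFun Disjoint (cell L)) := by
  intro p q hpq
  refine Set.disjoint_left.2 fun y h1 h2 => hpq ?_
  rw [mem_cell_iff hL] at h1 h2
  funext i
  rw [h1, h2]

lemma iUnion_cell (hL : ∀ i, 0 < L i) : ⋃ p, cell L p = univ := by
  refine eq_univ_of_forall fun y => mem_iUnion.2 ⟨fun i => -⌊y i / L i⌋, ?_⟩
  rw [mem_cell_iff hL]
  exact fun _ => rfl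

variable {E : Type*} [NormedAddCommGroup E]

lemma integrableOn_cell_iff {h : Plane → E} (p : Fin 2 → ℤ) :
    IntegrableOn h (cell L p) ↔ IntegrableOn (fun y => h (y - latticeVec L p)) (box L) := by
  have := (measurePreserving_add_right (volume : Measure Plane) (latticeVec L p)).integrableOn_comp_preimage
    (measurableEmbedding_addRight _) (f := fun y => h (y - latticeVec L p)) (s := box L)
  rw [← this]
  simp only [Function.comp_def, add_sub_cancel_right]
  rfl

lemma setIntegral_cell [NormedSpace ℝ E] (h : Plane → E) (p : Fin 2 → ℤ) :
    ∫ y in cell L p, h y = ∫ y in box L, h (y - latticeVec L p) := by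
  have := (measurePreserving_add_right (volume : Measure Plane) (latticeVec L p)).setIntegral_preimage_emb
    (measurableEmbedding_addRight _) (fun y => h (y - latticeVec L p)) (box L)
  rw [← this]
  simp only [add_sub_cancel_right]
  rfl

/-- The integral over the plane as a sum of integrals over the box. -/
lemma hasSum_integral_box [NormedSpace ℝ E] (hL : ∀ i, 0 < L i) {h : Plane → E}
    (hh : Integrable h) :
    HasSum (fun p => ∫ y in box L, h (y - latticeVec L p)) (∫ y, h y) := by
  have := hasSum_integral_iUnion (measurableSet_cell L) (pairwise_disjoint_cell hL)
    (f := h) (μ := volume) hh.integrableOn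
  rw [iUnion_cell hL, setIntegral_univ] at this
  simpa only [setIntegral_cell] using this

lemma integrableOn_box_sub {h : Plane → E} (hh : Integrable h) (p : Fin 2 → ℤ) :
    IntegrableOn (fun y => h (y - latticeVec L p)) (box L) :=
  (integrableOn_cell_iff p).1 hh.integrableOn

lemma summable_integral_norm_box (hL : ∀ i, 0 < L i) {h : Plane → E} (hh : Integrable h) :
    Summable fun p => ∫ y in box L, ‖h (y - latticeVec L p)‖ :=
  (hasSum_integral_box hL hh.norm).summable

/-- The integral of the periodization of a function over the box. -/
lemma integral_box_tsum [NormedSpace ℝ E] (hL : ∀ i, 0 < L i) {h : Plane → E}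
    (hh : Integrable h) : ∫ y in box L, ∑' p, h (y - latticeVec L p) = ∫ y, h y :=
  (hasSum_integral_of_summable_integral_norm (μ := volume.restrict (box L))
    (F := fun p y => h (y - latticeVec L p)) (integrableOn_box_sub hh)
    (summable_integral_norm_box hL hh)).unique (hasSum_integral_box hL hh)

/-- A function is integrable if the integrals of its norm over the translates of the box are
summable. -/
lemma integrable_of_summable_box (hL : ∀ i, 0 < L i) {h : Plane → E}
    (h1 : ∀ p, IntegrableOn (fun y => h (y - latticeVec L p)) (box L))
    (h2 : Summable fun p => ∫ y in box L, ‖h (y - latticeVec L p)‖) : Integrable h := by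
  rw [← integrableOn_univ, ← iUnion_cell hL]
  refine integrableOn_iUnion_of_summable_integral_norm (fun p => (integrableOn_cell_iff p).2 (h1 p)) ?_
  refine h2.congr fun p => ?_
  rw [setIntegral_cell (fun y => ‖h y‖)]

/-- All but finitely many lattice points are far away from a given bounded set. -/
lemma eventually_norm_sub_latticeVec (hL : ∀ i, 0 < L i) (M C : ℝ) :
    ∃ c, 0 < c ∧ ∀ᶠ p : Fin 2 → ℤ in cofinite, ∀ y : Plane, ‖y‖ ≤ M →
      0 < ‖p‖ ∧ C ≤ ‖y - latticeVec L p‖ ∧ c * ‖p‖ ≤ ‖y - latticeVec L p‖ := by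
  set a := min (L 0) (L 1) with ha
  have ha0 : 0 < a := lt_min (hL 0) (hL 1)
  have hai : ∀ i, a ≤ L i := by
    intro i
    fin_cases i
    · exact min_le_left _ _
    · exact min_le_right _ _
  have hp : ∀ p : Fin 2 → ℤ, a * ‖p‖ ≤ ‖latticeVec L p‖ := by
    intro p
    have h1 : ‖p‖ ≤ ‖latticeVec L p‖ / a := by
      refine (pi_norm_le_iff_of_nonneg (by positivity)).2 fun i => ?_
      rw [le_div_iff₀ ha0]
      refine le_trans ?_ (abs_coord_le (latticeVec L p) i)
      rw [latticeVec_apply, abs_mul, abs_of_pos (hL i), Int.norm_eq_abs]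
      exact mul_le_mul_of_nonneg_left (hai i) (abs_nonneg _)
    rw [le_div_iff₀ ha0] at h1
    linarith
  refine ⟨a / 2, by positivity, ?_⟩
  have ht : Tendsto (fun p : Fin 2 → ℤ => ‖p‖) cofinite atTop := by
    rw [← cocompact_eq_cofinite]
    exact tendsto_norm_cocompact_atTop
  filter_upwards [ht.eventually_ge_atTop (2 * (M + C) / a), ht.eventually_ge_atTop (2 * M / a),
    ht.eventually_gt_atTop 0] with p h1 h2 h3 y hy
  rw [div_le_iff₀ ha0] at h1 h2
  have h4 : ‖latticeVec L p‖ - ‖y‖ ≤ ‖y - latticeVec L p‖ := by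
    rw [norm_sub_rev]
    exact norm_sub_norm_le _ _
  have := hp p
  exact ⟨h3, by nlinarith, by nlinarith⟩

lemma summable_inv_norm_pow_four : Summable fun p : Fin 2 → ℤ => (‖p‖ ^ 4)⁻¹ := by
  refine (EisensteinSeries.summable_one_div_norm_rpow (k := 4) (by norm_num)).congr fun p => ?_
  rw [Real.rpow_neg (norm_nonneg p)]
  norm_cast

/-- The translates of a function with decay `O(|r|⁻⁴)` are eventually dominated by a summable
family, uniformly on bounded sets. -/
lemma exists_summable_bound (hL : ∀ i, 0 < L i) {g : Plane → E} {C : ℝ}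
    (hg : ∀ r, 1 ≤ ‖r‖ → ‖g r‖ ≤ C / ‖r‖ ^ 4) (M : ℝ) :
    ∃ u : (Fin 2 → ℤ) → ℝ, Summable u ∧ ∀ᶠ p in cofinite, ∀ y : Plane, ‖y‖ ≤ M →
      1 ≤ ‖y - latticeVec L p‖ ∧ ‖g (y - latticeVec L p)‖ ≤ u p := by
  obtain ⟨c, hc, he⟩ := eventually_norm_sub_latticeVec hL M 1
  refine ⟨fun p => |C| * (c ^ 4)⁻¹ * (‖p‖ ^ 4)⁻¹, summable_inv_norm_pow_four.mul_left _, ?_⟩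
  filter_upwards [he] with p hp y hy
  obtain ⟨h0, h1, h2⟩ := hp y hy
  refine ⟨h1, (hg _ h1).trans ?_⟩
  have h3 : (c * ‖p‖) ^ 4 ≤ ‖y - latticeVec L p‖ ^ 4 := by gcongr
  calc C / ‖y - latticeVec L p‖ ^ 4 ≤ |C| / ‖y - latticeVec L p‖ ^ 4 := by
        gcongr; exact le_abs_self C
    _ ≤ |C| / (c * ‖p‖) ^ 4 := by gcongr
    _ = _ := by rw [mul_pow, div_eq_mul_inv, mul_inv]; ring

/-- If the function is moreover bounded, then all its translates are dominated. -/
lemma exists_summable_bound_of_bounded (hL : ∀ i, 0 < L i) {g : Plane → E} {C C₀ : ℝ}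
    (h0 : ∀ r, ‖g r‖ ≤ C₀) (hg : ∀ r, 1 ≤ ‖r‖ → ‖g r‖ ≤ C / ‖r‖ ^ 4) (M : ℝ) :
    ∃ u : (Fin 2 → ℤ) → ℝ, Summable u ∧ ∀ p, ∀ y : Plane, ‖y‖ ≤ M →
      ‖g (y - latticeVec L p)‖ ≤ u p := by
  classical
  obtain ⟨u, hu, he⟩ := exists_summable_bound hL hg M
  have hf := eventually_cofinite.1 he
  refine ⟨fun p => if p ∈ hf.toFinset then C₀ else u p, ?_, fun p y hy => ?_⟩
  · refine (hu.congr_cofinite ?_)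
    filter_upwards [he] with p hp
    have : p ∉ hf.toFinset := by simpa using hp
    rw [if_neg this]
  · by_cases hp : p ∈ hf.toFinset
    · simp only [hp, if_true]; exact h0 _
    · simp only [hp, if_false]
      have : ∀ y : Plane, ‖y‖ ≤ M → 1 ≤ ‖y - latticeVec L p‖ ∧ ‖g (y - latticeVec L p)‖ ≤ u p := by
        simpa using hp
      exact (this y hy).2

end Lattice

/-! ### Fourier series of doubly periodic functions -/

section FourierSeries

variable {L : Fin 2 → ℝ}

/-- The area of the periodic box. -/
def cellArea (L : Fin 2 → ℝ) : ℝ := L 0 * L 1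

lemma cellArea_pos (hL : ∀ i, 0 < L i) : 0 < cellArea L := mul_pos (hL 0) (hL 1)

/-- The Fourier coefficient `V⁻¹ ∫_box f(y) e^{-i k_q·y} dy`. -/
def boxCoeff (L : Fin 2 → ℝ) (f : Plane → ℂ) (q : Fin 2 → ℤ) : ℂ :=
  (cellArea L : ℂ)⁻¹ * ∫ y in box L, f y * wave (-waveVec L q) y

/-- The parametrisation of the plane by the coordinates relative to the lattice basis. -/
def scaleBox (L : Fin 2 → ℝ) (x : Fin 2 → ℝ) : Plane := WithLp.toLp 2 fun i => L i * x i

lemma continuous_scaleBox (L : Fin 2 → ℝ) : Continuous (scaleBox L) := by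
  unfold scaleBox; fun_prop

lemma integral_scaleBox (hL : ∀ i, 0 < L i) (h : Plane → ℂ) :
    ∫ y, h y = (cellArea L : ℂ) * ∫ x : Fin 2 → ℝ, h (scaleBox L x) := by
  have hd : (Matrix.diagonal L).det = cellArea L := by
    rw [Matrix.det_diagonal, Fin.prod_univ_two, cellArea]
  have hV := cellArea_pos hL
  have hd0 : (Matrix.diagonal L).det ≠ 0 := by rw [hd]; exact hV.ne'
  have h1 := (PiLp.volume_preserving_toLp (Fin 2)).integral_comp
    (MeasurableEquiv.toLp 2 (Fin 2 → ℝ)).measurableEmbedding h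
  rw [← h1]
  conv_lhs => rw [← Real.smul_map_diagonal_volume_pi hd0]
  have hL' : LinearMap.det (Matrix.toLin' (Matrix.diagonal L)) ≠ 0 := by
    rwa [LinearMap.det_toLin']
  have he : MeasurableEmbedding (Matrix.toLin' (Matrix.diagonal L)) :=
    ((LinearEquiv.ofIsUnitDet (f := Matrix.toLin' (Matrix.diagonal L)) (v := Pi.basisFun ℝ (Fin 2))
      (v' := Pi.basisFun ℝ (Fin 2)) (by
        rw [← Matrix.toLin_eq_toLin', LinearMap.toMatrix_toLin]
        exact isUnit_iff_ne_zero.2 hd0)).toContinuousLinearEquiv.toHomeomorph).measurableEmbedding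
  rw [integral_smul_measure, he.integral_map, hd, abs_of_pos hV, ENNReal.toReal_ofReal hV.le,
    Complex.real_smul]
  congr 2
  funext x
  congr 1
  ext i
  simp [scaleBox, Matrix.toLin'_apply, Matrix.mulVec_diagonal]

lemma setIntegral_box (hL : ∀ i, 0 < L i) (h : Plane → ℂ) :
    ∫ y in box L, h y = (cellArea L : ℂ) *
      ∫ x in {x : Fin 2 → ℝ | ∀ i, x i ∈ Ioc (0 : ℝ) (0 + 1)}, h (scaleBox L x) := by
  rw [← integral_indicator (measurableSet_box L), integral_scaleBox hL]
  have e : ∀ x, (box L).indicator h (scaleBox L x)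
      = (univ.pi fun _ : Fin 2 => Ico (0 : ℝ) 1).indicator (fun x => h (scaleBox L x)) x := by
    intro x
    have : scaleBox L x ∈ box L ↔ x ∈ univ.pi fun _ : Fin 2 => Ico (0 : ℝ) 1 := by
      simp only [box, mem_ofPred_eq, mem_univ_pi]
      refine forall_congr' fun i => ?_
      change L i * x i ∈ Ico 0 (L i) ↔ _
      rw [mem_Ico, mem_Ico, mul_nonneg_iff_of_pos_left (hL i), mul_lt_iff_lt_one_right (hL i)]
    by_cases hx : x ∈ univ.pi fun _ : Fin 2 => Ico (0 : ℝ) 1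
    · rw [indicator_of_mem hx, indicator_of_mem (this.2 hx)]
    · rw [indicator_of_notMem hx, indicator_of_notMem (mt this.1 hx)]
  simp_rw [e]
  rw [integral_indicator (MeasurableSet.univ_pi fun _ => measurableSet_Ico)]
  congr 1
  refine setIntegral_congr_set ?_
  have e2 : {x : Fin 2 → ℝ | ∀ i, x i ∈ Ioc (0 : ℝ) (0 + 1)} = univ.pi fun _ => Ioc (0 : ℝ) 1 := by
    ext x; simp
  rw [e2]
  exact (Measure.univ_pi_Ico_ae_eq_Icc (f := fun _ : Fin 2 => (0 : ℝ)) (g := fun _ => 1)).trans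
    (Measure.univ_pi_Ioc_ae_eq_Icc (f := fun _ : Fin 2 => (0 : ℝ)) (g := fun _ => 1)).symm

lemma mFourier_coe (hL : ∀ i, 0 < L i) (q : Fin 2 → ℤ) (x : Fin 2 → ℝ) :
    UnitAddTorus.mFourier q (fun i => (x i : UnitAddCircle)) = wave (waveVec L q) (scaleBox L x) := by
  have h0 := (hL 0).ne'
  have h1 := (hL 1).ne'
  have e : UnitAddTorus.mFourier q (fun i => (x i : UnitAddCircle))
      = ∏ i, fourier (q i) (x i : UnitAddCircle) := rfl
  rw [e, Fin.prod_univ_two, fourier_coe_apply, fourier_coe_apply, ← Complex.exp_add, wave_def,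
    inner_eq_sum]
  simp only [waveVec_apply, scaleBox]
  congr 1
  rw [show 2 * Real.pi * (q 0 : ℝ) / L 0 * (L 0 * x 0) + 2 * Real.pi * (q 1 : ℝ) / L 1 * (L 1 * x 1)
    = 2 * Real.pi * (q 0 * x 0 + q 1 * x 1) by field_simp]
  push_cast
  ring

/-- A continuous periodic function with summable Fourier coefficients is the sum of its Fourier
series. -/
lemma hasSum_boxCoeff (hL : ∀ i, 0 < L i) {f : Plane → ℂ} (hf : Continuous f)
    (hp : ∀ y p, f (y - latticeVec L p) = f y) (hs : Summable (boxCoeff L f)) (y : Plane) :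
    HasSum (fun q => boxCoeff L f q * wave (waveVec L q) y) (f y) := by
  have hq₀ : IsOpenQuotientMap (Pi.map fun _ => ((↑) : ℝ → UnitAddCircle) :
      (Fin 2 → ℝ) → UnitAddTorus (Fin 2)) :=
    IsOpenQuotientMap.piMap fun _ => QuotientAddGroup.isOpenQuotientMap_mk
  let π : C(Fin 2 → ℝ, UnitAddTorus (Fin 2)) := ⟨_, hq₀.continuous⟩
  have hq : IsOpenQuotientMap π := hq₀
  let f' : C(Fin 2 → ℝ, ℂ) := ⟨fun x => f (scaleBox L x), hf.comp (continuous_scaleBox L)⟩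
  have hf' : Function.FactorsThrough f' π := by
    intro a b hab
    have : ∀ i, ∃ n : ℤ, a i - n = b i := by
      intro i
      have h1 : ((a i : ℝ) : UnitAddCircle) = (b i : ℝ) := congrFun hab i
      obtain ⟨n, hn⟩ := AddSubgroup.mem_zmultiples_iff.1 (QuotientAddGroup.eq_iff_sub_mem.1 h1)
      refine ⟨n, ?_⟩
      rw [zsmul_one] at hn
      rw [hn]
      ring
    choose n hn using this
    have e : scaleBox L b = scaleBox L a - latticeVec L n := by
      ext i
      simp only [scaleBox, PiLp.sub_apply, latticeVec_apply, ← hn]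
      ring
    change f (scaleBox L a) = f (scaleBox L b)
    rw [e, hp]
  let F : C(UnitAddTorus (Fin 2), ℂ) := hq.isQuotientMap.lift f' hf'
  have hF : ∀ x : Fin 2 → ℝ, F (fun i => (x i : UnitAddCircle)) = f (scaleBox L x) := fun x =>
    DFunLike.congr_fun (hq.isQuotientMap.lift_comp f' hf') x
  have hV : (cellArea L : ℂ) ≠ 0 := by exact_mod_cast (cellArea_pos hL).ne'
  have hc : UnitAddTorus.mFourierCoeff F = boxCoeff L f := by
    funext q
    rw [UnitAddTorus.mFourierCoeff_eq_integral F q (fun _ => 0), boxCoeff, setIntegral_box hL,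
      inv_mul_cancel_left₀ hV]
    congr 1
    funext x
    rw [hF, mFourier_coe hL, waveVec_neg, smul_eq_mul, mul_comm]
  have h := UnitAddTorus.hasSum_mFourier_series_apply_of_summable (f := F) (by rw [hc]; exact hs)
    (fun i => ((y i / L i : ℝ) : UnitAddCircle))
  have e : scaleBox L (fun i => y i / L i) = y := by
    ext i
    exact mul_div_cancel₀ (y i) (hL i).ne'
  rw [hF, e, hc] at h
  refine h.congr_fun fun q => ?_
  rw [mFourier_coe hL, e, smul_eq_mul]

lemma exists_schwartz_decay (g : 𝓢(Plane, ℂ)) :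
    ∃ C₀ C, (∀ r, ‖g r‖ ≤ C₀) ∧ ∀ r, 1 ≤ ‖r‖ → ‖g r‖ ≤ C / ‖r‖ ^ 4 := by
  obtain ⟨C₀, h0⟩ := g.decay 0 0
  obtain ⟨C, h1⟩ := g.decay 4 0
  refine ⟨C₀, C, fun r => by simpa using h0.2 r, fun r hr => ?_⟩
  rw [le_div_iff₀ (by positivity), mul_comm]
  simpa using h1.2 r

lemma summable_schwartz_waveVec (hL : ∀ i, 0 < L i) (φ : 𝓢(Plane, ℂ)) :
    Summable fun q => ‖φ (waveVec L q)‖ := by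
  obtain ⟨C₀, C, h0, h1⟩ := exists_schwartz_decay φ
  set L' : Fin 2 → ℝ := fun i => 2 * Real.pi / L i with hL'
  have hp : ∀ i, 0 < L' i := fun i => div_pos (by positivity) (hL i)
  obtain ⟨u, hu, hb⟩ := exists_summable_bound_of_bounded hp h0 h1 0
  refine Summable.of_nonneg_of_le (fun _ => norm_nonneg _) (fun q => ?_)
    ((Equiv.neg (Fin 2 → ℤ)).summable_iff.2 hu)
  have := hb (-q) 0 (by simp)
  have e : (0 : Plane) - latticeVec L' (-q) = waveVec L q := by
    ext i
    simp [hL']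
    ring
  rwa [e] at this

lemma summable_schwartz_sub_latticeVec (hL : ∀ i, 0 < L i) (g : 𝓢(Plane, ℂ)) (M : ℝ) :
    ∃ u : (Fin 2 → ℤ) → ℝ, Summable u ∧ ∀ p, ∀ y : Plane, ‖y‖ ≤ M →
      ‖g (y - latticeVec L p)‖ ≤ u p := by
  obtain ⟨C₀, C, h0, h1⟩ := exists_schwartz_decay g
  exact exists_summable_bound_of_bounded hL h0 h1 M

/-- Poisson summation for the Fourier transform of a Schwartz function. -/
lemma poisson_summation (hL : ∀ i, 0 < L i) (φ : 𝓢(Plane, ℂ)) (y : Plane) :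
    HasSum (fun q => ((2 * Real.pi) ^ 2 / cellArea L : ℝ) * φ (waveVec L q) * wave (-waveVec L q) y)
      (∑' p, planeFourier φ (y - latticeVec L p)) := by
  set g := schwartzFourier φ with hg
  have hgφ : ∀ r, g r = planeFourier φ r := schwartzFourier_apply φ
  have hV : (cellArea L : ℂ) ≠ 0 := by exact_mod_cast (cellArea_pos hL).ne'
  set f : Plane → ℂ := fun y => ∑' p, g (y - latticeVec L p) with hf
  have hcont : Continuous f := by
    rw [continuous_iff_continuousAt]
    intro y
    obtain ⟨u, hu, hb⟩ := summable_schwartz_sub_latticeVec hL g (‖y‖ + 1)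
    have : ContinuousOn f (Metric.ball 0 (‖y‖ + 1)) :=
      continuousOn_tsum (fun p => (g.continuous.comp (continuous_sub_right _)).continuousOn) hu
        fun p z hz => hb p z (mem_ball_zero_iff.1 hz).le
    exact this.continuousAt (Metric.isOpen_ball.mem_nhds (by simp))
  have hper : ∀ y p, f (y - latticeVec L p) = f y := by
    intro y p
    simp only [hf, sub_sub, ← latticeVec_add]
    exact (Equiv.addLeft p).tsum_eq fun q => g (y - latticeVec L q)
  have hint : Integrable g := g.integrable
  have hcoef : ∀ q, boxCoeff L f q = ((2 * Real.pi) ^ 2 / cellArea L : ℝ) * φ (-waveVec L q) := by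
    intro q
    have hw : Integrable fun r => g r * wave (-waveVec L q) r := integrable_mul_wave hint _
    have h4 : ∫ y in box L, f y * wave (-waveVec L q) y = ∫ r, g r * wave (-waveVec L q) r := by
      rw [← integral_box_tsum hL hw]
      congr 1
      funext y
      simp only [hf, ← waveVec_neg, wave_sub_latticeVec hL]
      rw [tsum_mul_right]
    rw [boxCoeff, h4]
    simp only [hgφ]
    rw [integral_planeFourier_mul_wave]
    push_cast
    field_simp
  have hs : Summable (boxCoeff L f) := by
    have h1 := (Equiv.neg (Fin 2 → ℤ)).summable_iff.2 (summable_schwartz_waveVec hL φ).of_norm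
    have h2 := h1.mul_left (((2 * Real.pi) ^ 2 / cellArea L : ℝ) : ℂ)
    refine h2.congr fun q => ?_
    rw [hcoef, Function.comp_apply, Equiv.neg_apply, waveVec_neg]
  have h := hasSum_boxCoeff hL hcont hper hs y
  simp only [hf, hgφ] at h
  rw [← (Equiv.neg (Fin 2 → ℤ)).hasSum_iff] at h
  refine h.congr_fun fun q => ?_
  simp only [Function.comp_apply, Equiv.neg_apply, waveVec_neg]
  have := hcoef (-q)
  simp only [hf, hgφ, waveVec_neg, neg_neg] at this
  rw [this]

/-- The pairing of a periodic function with `φ̂` in terms of its Fourier coefficients. -/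
lemma hasSum_integral_mul_planeFourier (hL : ∀ i, 0 < L i) {U : Plane → ℂ}
    (hp : ∀ y p, U (y - latticeVec L p) = U y) (hU : IntegrableOn U (box L)) (φ : 𝓢(Plane, ℂ)) :
    Integrable (fun y => U y * planeFourier φ y) ∧
      HasSum (fun q => (2 * Real.pi : ℂ) ^ 2 * φ (waveVec L q) * boxCoeff L U q)
        (∫ y, U y * planeFourier φ y) := by
  set g := schwartzFourier φ with hg
  have hgφ : ∀ r, g r = planeFourier φ r := schwartzFourier_apply φ
  have hV : (cellArea L : ℂ) ≠ 0 := by exact_mod_cast (cellArea_pos hL).ne'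
  obtain ⟨u, hu, hb⟩ := summable_schwartz_sub_latticeVec hL g (L 0 + L 1)
  have hgm : ∀ p, AEStronglyMeasurable (fun y => g (y - latticeVec L p)) (volume.restrict (box L)) :=
    fun p => (g.continuous.comp (continuous_sub_right _)).aestronglyMeasurable
  have hbox : ∀ p, ∀ᵐ y ∂volume.restrict (box L), ‖g (y - latticeVec L p)‖ ≤ u p := fun p => by
    filter_upwards [ae_restrict_mem (measurableSet_box L)] with y hy using
      hb p y (norm_le_of_mem_box hy)
  have hi : ∀ p, IntegrableOn (fun y => U y * g (y - latticeVec L p)) (box L) := fun p =>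
    hU.mul_bdd (c := u p) (hgm p) (hbox p)
  have hu0 : ∀ p, 0 ≤ u p := fun p => (norm_nonneg _).trans (hb p 0 (by simp [(hL 0).le, (hL 1).le, add_nonneg]))
  have hsum : Summable fun p => ∫ y in box L, ‖U y * g (y - latticeVec L p)‖ := by
    refine Summable.of_nonneg_of_le (fun _ => integral_nonneg fun _ => norm_nonneg _) (fun p => ?_)
      (hu.mul_left (∫ y in box L, ‖U y‖))
    rw [← integral_mul_const]
    refine integral_mono_ae (hi p).norm (hU.norm.mul_const _) ?_
    filter_upwards [hbox p] with y hy
    rw [norm_mul]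
    gcongr
  have e1 : ∀ p, (fun y => U y * g (y - latticeVec L p))
      = fun y => (fun y => U y * g y) (y - latticeVec L p) := by
    intro p; funext y; simp only [hp]
  have hUg : Integrable fun y => U y * g y :=
    integrable_of_summable_box hL (fun p => by rw [← e1]; exact hi p)
      (hsum.congr fun p => by simp only [hp])
  have h1 := hasSum_integral_box hL hUg
  have h2 := hasSum_integral_of_summable_integral_norm hi hsum
  simp only [hp] at h1
  have h3 : ∫ y, U y * g y = ∫ y in box L, U y * ∑' p, g (y - latticeVec L p) := by
    rw [h1.unique h2]
    simp only [tsum_mul_left]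
  have hcn : ∀ q y, ‖((2 * Real.pi) ^ 2 / cellArea L : ℝ) * φ (waveVec L q) * wave (-waveVec L q) y‖
      = ((2 * Real.pi) ^ 2 / cellArea L) * ‖φ (waveVec L q)‖ := by
    intro q y
    rw [norm_mul, norm_mul, norm_wave, mul_one, Complex.norm_real, Real.norm_of_nonneg]
    exact div_nonneg (by positivity) (cellArea_pos hL).le
  have hi2 : ∀ q, IntegrableOn (fun y => U y * (((2 * Real.pi) ^ 2 / cellArea L : ℝ) * φ (waveVec L q)
      * wave (-waveVec L q) y)) (box L) := fun q =>
    hU.mul_bdd (c := ((2 * Real.pi) ^ 2 / cellArea L) * ‖φ (waveVec L q)‖)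
      ((continuous_const.mul (continuous_wave_right _)).aestronglyMeasurable)
      (Eventually.of_forall fun y => (hcn q y).le)
  have hs2 : Summable fun q => ∫ y in box L, ‖U y * (((2 * Real.pi) ^ 2 / cellArea L : ℝ)
      * φ (waveVec L q) * wave (-waveVec L q) y)‖ := by
    refine ((summable_schwartz_waveVec hL φ).mul_left
      ((∫ y in box L, ‖U y‖) * ((2 * Real.pi) ^ 2 / cellArea L))).congr fun q => ?_
    simp only [norm_mul (U _), hcn]
    rw [integral_mul_const]
    ring
  have h4 := hasSum_integral_of_summable_integral_norm hi2 hs2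
  have h5 : ∀ y, ∑' q, U y * (((2 * Real.pi) ^ 2 / cellArea L : ℝ) * φ (waveVec L q)
      * wave (-waveVec L q) y) = U y * ∑' p, g (y - latticeVec L p) := by
    intro y
    have := poisson_summation hL φ y
    simp only [← hgφ] at this
    rw [tsum_mul_left, this.tsum_eq]
  simp only [h5] at h4
  rw [← h3] at h4
  simp only [hgφ] at h4 hUg
  refine ⟨hUg, h4.congr_fun fun q => ?_⟩
  rw [boxCoeff, ← integral_const_mul, ← integral_const_mul]
  congr 1
  funext y
  push_cast
  field_simp

end FourierSeries

/-! ### Uniqueness of Fourier coefficients -/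

section Uniqueness

variable {L : Fin 2 → ℝ}

lemma exists_le_norm_waveVec_sub (hL : ∀ i, 0 < L i) :
    ∃ δ, 0 < δ ∧ ∀ p q : Fin 2 → ℤ, p ≠ q → δ ≤ ‖waveVec L p - waveVec L q‖ := by
  refine ⟨min (2 * Real.pi / L 0) (2 * Real.pi / L 1),
    lt_min (div_pos (by positivity) (hL 0)) (div_pos (by positivity) (hL 1)), fun p q h => ?_⟩
  obtain ⟨i, hi⟩ := Function.ne_iff.1 h
  have h1 : (1 : ℝ) ≤ |(p i : ℝ) - q i| := by
    have : 1 ≤ |p i - q i| := Int.one_le_abs (sub_ne_zero.2 hi)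
    exact_mod_cast this
  have h2 : 0 < 2 * Real.pi / L i := div_pos (by positivity) (hL i)
  have h3 : 2 * Real.pi / L i ≤ ‖waveVec L p - waveVec L q‖ := by
    refine le_trans ?_ (abs_coord_le _ i)
    rw [PiLp.sub_apply, waveVec_apply, waveVec_apply,
      show 2 * Real.pi * (p i : ℝ) / L i - 2 * Real.pi * (q i : ℝ) / L i
        = 2 * Real.pi / L i * (p i - q i) by ring, abs_mul, abs_of_pos h2]
    exact le_mul_of_one_le_right h2.le h1
  refine le_trans ?_ h3
  fin_cases i
  · exact min_le_left _ _
  · exact min_le_right _ _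

/-- A Schwartz function that isolates one wave vector of the reciprocal lattice. -/
lemma exists_schwartz_delta (hL : ∀ i, 0 < L i) (q : Fin 2 → ℤ) : ∃ φ : 𝓢(Plane, ℂ),
    φ (waveVec L q) = 1 ∧ (∀ p, p ≠ q → φ (waveVec L p) = 0) ∧
      (q ≠ 0 → (0 : Plane) ∉ tsupport (φ : Plane → ℂ)) := by
  obtain ⟨δ, hδ, h⟩ := exists_le_norm_waveVec_sub hL
  let b : ContDiffBump (waveVec L q) := ⟨δ / 4, δ / 2, by linarith, by linarith⟩
  have hs : HasCompactSupport fun k => ((b k : ℝ) : ℂ) :=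
    b.hasCompactSupport.comp_left Complex.ofReal_zero
  have hd : ContDiff ℝ ∞ fun k => ((b k : ℝ) : ℂ) :=
    Complex.ofRealCLM.contDiff.comp b.contDiff
  let φ : 𝓢(Plane, ℂ) := hs.toSchwartzMap hd
  have hφ : ∀ k, φ k = ((b k : ℝ) : ℂ) := fun k => rfl
  have h0 : ∀ k : Plane, δ / 2 < dist k (waveVec L q) → k ∉ tsupport (φ : Plane → ℂ) := by
    intro k hk hmem
    have h1 : tsupport (φ : Plane → ℂ) ⊆ tsupport b :=
      tsupport_comp_subset (g := fun x : ℝ => (x : ℂ)) Complex.ofReal_zero b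
    have h2 := h1 hmem
    rw [b.tsupport_eq, Metric.mem_closedBall] at h2
    exact absurd h2 (not_le.2 hk)
  refine ⟨φ, ?_, fun p hp => ?_, fun hq => ?_⟩
  · rw [hφ, b.one_of_mem_closedBall (Metric.mem_closedBall_self (by positivity))]
    exact Complex.ofReal_one
  · refine image_eq_zero_of_notMem_tsupport (h0 _ ?_)
    rw [dist_eq_norm]
    linarith [h p q hp]
  · refine h0 _ ?_
    rw [dist_eq_norm, ← waveVec_zero L]
    linarith [h 0 q hq.symm]

lemma two_pi_sq_ne_zero : (2 * Real.pi : ℂ) ^ 2 ≠ 0 := by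
  have : (Real.pi : ℂ) ≠ 0 := by exact_mod_cast Real.pi_ne_zero
  exact pow_ne_zero 2 (mul_ne_zero two_ne_zero this)

/-- The Fourier coefficient of a periodic function is the pairing with `φ̂` when `φ` isolates the
wave vector. -/
lemma integral_mul_planeFourier_delta (hL : ∀ i, 0 < L i) {U : Plane → ℂ}
    (hp : ∀ y p, U (y - latticeVec L p) = U y) (hU : IntegrableOn U (box L)) (φ : 𝓢(Plane, ℂ))
    {q : Fin 2 → ℤ} (h1 : φ (waveVec L q) = 1) (h0 : ∀ p, p ≠ q → φ (waveVec L p) = 0) :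
    ∫ y, U y * planeFourier φ y = (2 * Real.pi : ℂ) ^ 2 * boxCoeff L U q := by
  have h := (hasSum_integral_mul_planeFourier hL hp hU φ).2
  have h2 := hasSum_single (f := fun q => (2 * Real.pi : ℂ) ^ 2 * φ (waveVec L q) * boxCoeff L U q) q
    fun p hpq => by rw [h0 p hpq, mul_zero, zero_mul]
  rw [h.unique h2, h1, mul_one]

lemma boxCoeff_eq_of_hasSum (hL : ∀ i, 0 < L i) {U : Plane → ℂ}
    (hp : ∀ y p, U (y - latticeVec L p) = U y) (hU : IntegrableOn U (box L))
    {c : (Fin 2 → ℤ) → ℂ} (hc : ∀ φ : 𝓢(Plane, ℂ), HasSum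
      (fun q => (2 * Real.pi : ℂ) ^ 2 * φ (waveVec L q) * c q) (∫ y, U y * planeFourier φ y))
    (q : Fin 2 → ℤ) : boxCoeff L U q = c q := by
  obtain ⟨φ, h1, h0, -⟩ := exists_schwartz_delta hL q
  have h2 := hasSum_single (f := fun q => (2 * Real.pi : ℂ) ^ 2 * φ (waveVec L q) * c q) q
    fun p hpq => by rw [h0 p hpq, mul_zero, zero_mul]
  have h3 := (hc φ).unique h2
  rw [integral_mul_planeFourier_delta hL hp hU φ h1 h0, h1, mul_one] at h3
  exact mul_left_cancel₀ two_pi_sq_ne_zero h3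

/-- Every Schwartz function is the Fourier transform of a Schwartz function. -/
lemma exists_planeFourier_eq (g : 𝓢(Plane, ℂ)) : ∃ φ : 𝓢(Plane, ℂ), ∀ r, planeFourier φ r = g r := by
  let ψ : 𝓢(Plane, ℂ) := SchwartzMap.compCLMOfContinuousLinearEquiv ℂ
    (ContinuousLinearEquiv.neg ℝ : Plane ≃L[ℝ] Plane) (schwartzFourier g)
  have hψ : ∀ k, ψ k = planeFourier g (-k) := fun k => schwartzFourier_apply g (-k)
  refine ⟨((2 * Real.pi : ℂ) ^ 2)⁻¹ • ψ, fun r => ?_⟩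
  have h : planeFourier (((2 * Real.pi : ℂ) ^ 2)⁻¹ • ψ : 𝓢(Plane, ℂ)) r
      = ((2 * Real.pi : ℂ) ^ 2)⁻¹ * ∫ k, (fun k => planeFourier g k * wave r k) (-k) := by
    rw [planeFourier_eq, ← integral_const_mul]
    congr 1
    funext k
    rw [smul_apply, hψ, smul_eq_mul, wave_neg_comm, mul_assoc]
  rw [h, integral_neg_eq_self (fun k => planeFourier g k * wave r k)]
  simp_rw [wave_comm r]
  have h3 := integral_planeFourier_mul_wave g r
  simp_rw [wave_comm r] at h3
  rw [h3, inv_mul_cancel_left₀ two_pi_sq_ne_zero]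

lemma integrableOn_box {E : Type*} [NormedAddCommGroup E] {U : Plane → E}
    (hU : LocallyIntegrable U) : IntegrableOn U (box L) :=
  (hU.integrableOn_isCompact (isCompact_closedBall (0 : Plane) (L 0 + L 1))).mono_set
    fun _ hy => mem_closedBall_zero_iff.2 (norm_le_of_mem_box hy)

/-- A locally integrable doubly periodic function all of whose Fourier coefficients vanish is zero
almost everywhere. -/
lemma ae_eq_zero_of_boxCoeff_eq_zero (hL : ∀ i, 0 < L i) {D : Plane → ℝ}
    (hp : ∀ y p, D (y - latticeVec L p) = D y) (hD : LocallyIntegrable D)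
    (hc : ∀ q, boxCoeff L (fun y => (D y : ℂ)) q = 0) : ∀ᵐ y, D y = 0 := by
  refine ae_eq_zero_of_integral_contDiff_smul_eq_zero hD fun g hg hgs => ?_
  have hs : HasCompactSupport fun k => ((g k : ℝ) : ℂ) := hgs.comp_left Complex.ofReal_zero
  have hd : ContDiff ℝ ∞ fun k => ((g k : ℝ) : ℂ) := Complex.ofRealCLM.contDiff.comp hg
  obtain ⟨φ, hφ⟩ := exists_planeFourier_eq (hs.toSchwartzMap hd)
  have hi : IntegrableOn (fun y => (D y : ℂ)) (box L) := (integrableOn_box hD).ofReal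
  have h := (hasSum_integral_mul_planeFourier hL (U := fun y => (D y : ℂ))
    (fun y p => by rw [hp]) hi φ).2
  simp only [hc, mul_zero] at h
  have h2 := h.unique hasSum_zero
  have e : ∀ y, (D y : ℂ) * planeFourier φ y = ((g y • D y : ℝ) : ℂ) := by
    intro y
    rw [hφ, smul_eq_mul, Complex.ofReal_mul, mul_comm]
    rfl
  simp only [e] at h2
  have h3 := (integral_ofReal (𝕜 := ℂ) (f := fun y => g y • D y) (μ := volume)).symm.trans h2
  exact RCLike.ofReal_eq_zero.1 h3

end Uniqueness

/-! ### Periodic sums of decaying functions -/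

section RealSum

variable {L : Fin 2 → ℝ} {R : Plane → ℝ} {C : ℝ}

open Classical in
/-- The function `R` with its value at the singular point `0` left out. -/
def starred (R : Plane → ℝ) (r : Plane) : ℝ := if r = 0 then 0 else R r

lemma starred_of_ne {r : Plane} (hr : r ≠ 0) : starred R r = R r := if_neg hr

@[simp] lemma starred_zero : starred R 0 = 0 := if_pos rfl

lemma starred_ae_eq : starred R =ᵐ[volume] R := by
  filter_upwards [ae_ne_zero] with r hr using starred_of_ne hr

/-- The sum `∑*_p R(y - τ(p))`. -/
def realSum (L : Fin 2 → ℝ) (R : Plane → ℝ) (y : Plane) : ℝ := ∑' p, starred R (y - latticeVec L p)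

/-- On a bounded set the periodic sum of a decaying function consists of finitely many terms,
which include all the singular ones, and a continuous function. -/
lemma exists_realSum_eq (hL : ∀ i, 0 < L i) (hc : ContinuousOn R {0}ᶜ)
    (hd : ∀ r, 1 ≤ ‖r‖ → |R r| ≤ C / ‖r‖ ^ 4) (M : ℝ) :
    ∃ (s : Finset (Fin 2 → ℤ)) (g : Plane → ℝ), ContinuousOn g (Metric.ball 0 M) ∧
      (∀ p, p ∉ s → ∀ y ∈ Metric.ball (0 : Plane) M, y - latticeVec L p ≠ 0) ∧
      ∀ y ∈ Metric.ball (0 : Plane) M, HasSum (fun p => starred R (y - latticeVec L p))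
        (∑ p ∈ s, starred R (y - latticeVec L p) + g y) := by
  classical
  obtain ⟨u, hu, he⟩ := exists_summable_bound hL (g := R) hd M
  have hf := eventually_cofinite.1 he
  set s := hf.toFinset with hs
  have hb : ∀ p, p ∉ s → ∀ y ∈ Metric.ball (0 : Plane) M,
      y - latticeVec L p ≠ 0 ∧ |R (y - latticeVec L p)| ≤ u p := by
    intro p hp y hy
    have : ∀ y : Plane, ‖y‖ ≤ M → 1 ≤ ‖y - latticeVec L p‖ ∧ ‖R (y - latticeVec L p)‖ ≤ u p := by
      simpa [hs] using hp
    obtain ⟨h1, h2⟩ := this y (mem_ball_zero_iff.1 hy).le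
    exact ⟨norm_pos_iff.1 (by linarith), h2⟩
  set T : (Fin 2 → ℤ) → Plane → ℝ := fun p y =>
    if p ∈ s then 0 else starred R (y - latticeVec L p) with hT
  have hTb : ∀ p, ∀ y ∈ Metric.ball (0 : Plane) M, ‖T p y‖ ≤ |u p| := by
    intro p y hy
    by_cases hp : p ∈ s
    · simp [hT, hp]
    · obtain ⟨h1, h2⟩ := hb p hp y hy
      simp only [hT, hp, if_false, starred_of_ne h1]
      exact h2.trans (le_abs_self _)
  refine ⟨s, fun y => ∑' p, T p y, ?_, fun p hp y hy => (hb p hp y hy).1, fun y hy => ?_⟩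
  · refine continuousOn_tsum (fun p => ?_) hu.abs hTb
    by_cases hp : p ∈ s
    · simp only [hT, hp, if_true]
      exact continuousOn_const
    · have : ContinuousOn (fun y => R (y - latticeVec L p)) (Metric.ball 0 M) :=
        hc.comp (continuous_sub_right _).continuousOn fun y hy => (hb p hp y hy).1
      refine this.congr fun y hy => ?_
      simp only [hT, hp, if_false, starred_of_ne (hb p hp y hy).1]
  · have h1 : HasSum (fun p => T p y) (∑' p, T p y) :=
      (Summable.of_norm_bounded hu.abs fun p => hTb p y hy).hasSum
    have h2 : HasSum (fun p => if p ∈ s then starred R (y - latticeVec L p) else 0)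
        (∑ p ∈ s, starred R (y - latticeVec L p)) := by
      have : HasSum (fun p => if p ∈ s then starred R (y - latticeVec L p) else 0)
          (∑ p ∈ s, if p ∈ s then starred R (y - latticeVec L p) else 0) :=
        hasSum_sum_of_ne_finset_zero fun p hp => if_neg hp
      rwa [Finset.sum_congr rfl fun p hp => if_pos hp] at this
    refine (h2.add h1).congr_fun fun p => ?_
    by_cases hp : p ∈ s <;> simp [hT, hp]

lemma summable_starred (hL : ∀ i, 0 < L i) (hc : ContinuousOn R {0}ᶜ)
    (hd : ∀ r, 1 ≤ ‖r‖ → |R r| ≤ C / ‖r‖ ^ 4) (y : Plane) :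
    Summable fun p => starred R (y - latticeVec L p) := by
  obtain ⟨s, g, -, -, h⟩ := exists_realSum_eq hL hc hd (‖y‖ + 1)
  exact (h y (by simp)).summable

lemma realSum_sub_latticeVec (L : Fin 2 → ℝ) (R : Plane → ℝ) (y : Plane) (p : Fin 2 → ℤ) :
    realSum L R (y - latticeVec L p) = realSum L R y := by
  simp only [realSum, sub_sub, ← latticeVec_add]
  exact (Equiv.addLeft p).tsum_eq fun q => starred R (y - latticeVec L q)

lemma locallyIntegrable_realSum (hL : ∀ i, 0 < L i) (hc : ContinuousOn R {0}ᶜ)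
    (hd : ∀ r, 1 ≤ ‖r‖ → |R r| ≤ C / ‖r‖ ^ 4) (hi : Integrable R) :
    LocallyIntegrable (realSum L R) := by
  intro x
  obtain ⟨s, g, hg, -, h⟩ := exists_realSum_eq hL hc hd (‖x‖ + 2)
  refine ⟨Metric.ball 0 (‖x‖ + 1), Metric.isOpen_ball.mem_nhds (by simp), ?_⟩
  have hsub : Metric.closedBall (0 : Plane) (‖x‖ + 1) ⊆ Metric.ball 0 (‖x‖ + 2) :=
    Metric.closedBall_subset_ball (by linarith)
  have h1 : IntegrableOn g (Metric.ball 0 (‖x‖ + 1)) :=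
    ((hg.mono hsub).integrableOn_compact (isCompact_closedBall _ _)).mono_set
      Metric.ball_subset_closedBall
  have h2 : Integrable fun y => ∑ p ∈ s, starred R (y - latticeVec L p) :=
    integrable_finsetSum _ fun p _ => (hi.congr starred_ae_eq.symm).comp_sub_right (latticeVec L p)
  refine (h2.integrableOn.add h1).congr_fun (fun y hy => ?_) Metric.isOpen_ball.measurableSet
  exact (h y (hsub (Metric.ball_subset_closedBall hy))).tsum_eq.symm

lemma boxCoeff_realSum (hL : ∀ i, 0 < L i) (hi : Integrable R) (q : Fin 2 → ℤ) :
    boxCoeff L (fun y => (realSum L R y : ℂ)) q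
      = (cellArea L : ℂ)⁻¹ * planeFourier (fun r => (R r : ℂ)) (waveVec L q) := by
  have hi' : Integrable fun r => ((starred R r : ℝ) : ℂ) := (hi.congr starred_ae_eq.symm).ofReal
  have h := integral_box_tsum hL (integrable_mul_wave hi' (-waveVec L q))
  have e : ∀ y, ∑' p, ((starred R (y - latticeVec L p) : ℝ) : ℂ) * wave (-waveVec L q) (y - latticeVec L p)
      = (realSum L R y : ℂ) * wave (-waveVec L q) y := by
    intro y
    simp only [← waveVec_neg, wave_sub_latticeVec hL]
    rw [tsum_mul_right, realSum, Complex.ofReal_tsum]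
  simp only [e] at h
  rw [boxCoeff, h, planeFourier_eq]
  congr 1
  refine integral_congr_ae ?_
  filter_upwards [starred_ae_eq (R := R)] with r hr
  rw [hr]

open Classical in
/-- Near a lattice point the periodic sum differs from the singular term by a function that
extends continuously, with the value of the sum without the singular term. -/
lemma tendsto_realSum (hL : ∀ i, 0 < L i) (hc : ContinuousOn R {0}ᶜ)
    (hd : ∀ r, 1 ≤ ‖r‖ → |R r| ≤ C / ‖r‖ ^ 4) (y : Plane) :
    Tendsto (fun z => realSum L R z - if Congruent L y 0 then R (z - y) else 0) (𝓝[≠] y)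
        (𝓝 (realSum L R y)) ∧
      ∀ᶠ z in 𝓝[≠] y, ¬ Congruent L z 0 := by
  obtain ⟨s, g, hg, hns, h⟩ := exists_realSum_eq hL hc hd (‖y‖ + 1)
  have hy : y ∈ Metric.ball (0 : Plane) (‖y‖ + 1) := by simp
  have hball : ∀ᶠ z in 𝓝[≠] y, z ∈ Metric.ball (0 : Plane) (‖y‖ + 1) :=
    nhdsWithin_le_nhds (Metric.isOpen_ball.mem_nhds hy)
  have hterm : ∀ p ∈ s, Tendsto (fun z => starred R (z - latticeVec L p)
      - if y = latticeVec L p then R (z - y) else 0) (𝓝[≠] y) (𝓝 (starred R (y - latticeVec L p))) := by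
    intro p _
    by_cases hp : y = latticeVec L p
    · rw [← hp]
      simp only [if_true, sub_self, starred_zero]
      refine tendsto_const_nhds.congr' ?_
      filter_upwards [self_mem_nhdsWithin] with z hz
      rw [starred_of_ne (sub_ne_zero.2 hz), sub_self]
    · have hne : y - latticeVec L p ≠ 0 := sub_ne_zero.2 hp
      simp only [hp, if_false, sub_zero]
      rw [starred_of_ne hne]
      have h1 : ContinuousAt (fun z => R (z - latticeVec L p)) y :=
        ContinuousAt.comp (f := fun z => z - latticeVec L p) (g := R)
          (hc.continuousAt (isOpen_ne.mem_nhds hne)) (continuous_sub_right _).continuousAt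
      refine (h1.tendsto.mono_left nhdsWithin_le_nhds).congr' ?_
      filter_upwards [nhdsWithin_le_nhds (isOpen_ne.mem_nhds hp)] with z hz
      rw [starred_of_ne (sub_ne_zero.2 hz)]
  have hcong : (fun z => if Congruent L y 0 then R (z - y) else 0)
      = fun z => ∑ p ∈ s, if y = latticeVec L p then R (z - y) else 0 := by
    funext z
    by_cases hC : Congruent L y 0
    · obtain ⟨p, hp⟩ := hC
      rw [if_pos ⟨p, hp⟩]
      rw [sub_zero] at hp
      have hps : p ∈ s := by
        by_contra hps
        exact hns p hps y hy (sub_eq_zero.2 hp)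
      rw [Finset.sum_eq_single_of_mem p hps, if_pos hp]
      intro p' _ hne
      rw [if_neg]
      intro hp'
      exact hne (latticeVec_injective hL (hp'.symm.trans hp))
    · rw [if_neg hC, Finset.sum_eq_zero]
      intro p _
      rw [if_neg]
      intro hp
      exact hC ⟨p, by rw [sub_zero, hp]⟩
  constructor
  · have h1 := (tendsto_finsetSum s hterm).add
      ((hg.continuousAt (Metric.isOpen_ball.mem_nhds hy)).tendsto.mono_left
        (nhdsWithin_le_nhds (s := {y}ᶜ)))
    have e : realSum L R y = ∑ p ∈ s, starred R (y - latticeVec L p) + g y := (h y hy).tsum_eq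
    rw [e]
    refine h1.congr' ?_
    filter_upwards [hball] with z hz
    have e2 : realSum L R z = ∑ p ∈ s, starred R (z - latticeVec L p) + g z := (h z hz).tsum_eq
    rw [congrFun hcong z, e2, Finset.sum_sub_distrib]
    ring
  · have h1 : ∀ᶠ z in 𝓝[≠] y, ∀ p ∈ s, z ≠ latticeVec L p := by
      refine (Finset.eventually_all s).2 fun p _ => ?_
      by_cases hp : y = latticeVec L p
      · rw [← hp]; exact self_mem_nhdsWithin
      · exact nhdsWithin_le_nhds (isOpen_ne.mem_nhds hp)
    filter_upwards [h1, hball] with z hz hzb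
    rintro ⟨p, hp⟩
    rw [sub_zero] at hp
    by_cases hps : p ∈ s
    · exact hz p hps hp
    · exact hns p hps z hzb (sub_eq_zero.2 hp)

end RealSum

/-! ### Rapidly converging Fourier sums -/

section WaveSum

variable {L : Fin 2 → ℝ} {F : Plane → ℂ}

/-- The Fourier sum `V⁻¹ ∑_q F(k_q) e^{i k_q·y}`. -/
def waveSum (L : Fin 2 → ℝ) (F : Plane → ℂ) (y : Plane) : ℂ :=
  (cellArea L : ℂ)⁻¹ * ∑' q, F (waveVec L q) * wave (waveVec L q) y

lemma summable_norm_waveVec (hL : ∀ i, 0 < L i) {C : ℝ}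
    (hF : ∀ k, 1 ≤ ‖k‖ → ‖F k‖ ≤ C / ‖k‖ ^ 4) : Summable fun q => ‖F (waveVec L q)‖ := by
  set L' : Fin 2 → ℝ := fun i => 2 * Real.pi / L i with hL'
  have hp : ∀ i, 0 < L' i := fun i => div_pos (by positivity) (hL i)
  obtain ⟨u, hu, hb⟩ := exists_summable_bound hp hF 0
  have h : Summable fun p => ‖F ((0 : Plane) - latticeVec L' p)‖ := by
    refine Summable.of_norm_bounded_eventually hu ?_
    filter_upwards [hb] with p hp
    rw [norm_norm]
    exact (hp 0 (by simp)).2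
  refine ((Equiv.neg (Fin 2 → ℤ)).summable_iff.2 h).congr fun q => ?_
  have e : (0 : Plane) - latticeVec L' (-q) = waveVec L q := by
    ext i
    simp [hL']
    ring
  rw [Function.comp_apply, Equiv.neg_apply, e]

lemma norm_mul_wave (c : ℂ) (k y : Plane) : ‖c * wave k y‖ = ‖c‖ := by
  rw [norm_mul, norm_wave, mul_one]

lemma summable_waveSum (hF : Summable fun q => ‖F (waveVec L q)‖) (y : Plane) :
    Summable fun q => F (waveVec L q) * wave (waveVec L q) y :=
  Summable.of_norm (by simpa only [norm_mul_wave] using hF)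

lemma continuous_waveSum (hF : Summable fun q => ‖F (waveVec L q)‖) : Continuous (waveSum L F) :=
  continuous_const.mul (continuous_tsum (fun _ => continuous_const.mul (continuous_wave_right _)) hF
    fun _ _ => (norm_mul_wave _ _ _).le)

lemma waveSum_sub_latticeVec (hL : ∀ i, 0 < L i) (F : Plane → ℂ) (y : Plane) (p : Fin 2 → ℤ) :
    waveSum L F (y - latticeVec L p) = waveSum L F y := by
  simp only [waveSum, wave_sub_latticeVec hL]

/-- The Fourier sum is real if its coefficients are Hermitian. -/
lemma ofReal_re_waveSum (hF : ∀ k, F (-k) = (starRingEnd ℂ) (F k)) (y : Plane) :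
    (((waveSum L F y).re : ℝ) : ℂ) = waveSum L F y := by
  rw [← Complex.conj_eq_iff_re, waveSum, map_mul, map_inv₀, Complex.conj_ofReal, Complex.conj_tsum]
  congr 1
  rw [← (Equiv.neg (Fin 2 → ℤ)).tsum_eq]
  refine tsum_congr fun q => ?_
  rw [Equiv.neg_apply, waveVec_neg, map_mul, conj_wave, neg_neg, hF, Complex.conj_conj]

lemma boxCoeff_waveSum (hL : ∀ i, 0 < L i) (hF : Summable fun q => ‖F (waveVec L q)‖)
    (q : Fin 2 → ℤ) : boxCoeff L (waveSum L F) q = (cellArea L : ℂ)⁻¹ * F (waveVec L q) := by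
  refine boxCoeff_eq_of_hasSum (c := fun q => (cellArea L : ℂ)⁻¹ * F (waveVec L q)) hL
    (fun y p => waveSum_sub_latticeVec hL F y p)
    (integrableOn_box (continuous_waveSum hF).locallyIntegrable) (fun φ => ?_) q
  have hφ := integrable_planeFourier φ
  have h1 : ∀ q, Integrable fun y => F (waveVec L q) * (planeFourier φ y * wave (waveVec L q) y) :=
    fun q => (integrable_mul_wave hφ _).const_mul _
  have h2 : Summable fun q =>
      ∫ y, ‖F (waveVec L q) * (planeFourier φ y * wave (waveVec L q) y)‖ := by
    refine (hF.mul_right (∫ y, ‖planeFourier φ y‖)).congr fun q => ?_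
    rw [← integral_const_mul]
    simp only [norm_mul, norm_wave, mul_one]
  have h3 := (hasSum_integral_of_summable_integral_norm h1 h2).mul_left ((cellArea L : ℂ)⁻¹)
  have e : ∫ y, waveSum L F y * planeFourier φ y = (cellArea L : ℂ)⁻¹ *
      ∫ y, ∑' q, F (waveVec L q) * (planeFourier φ y * wave (waveVec L q) y) := by
    rw [← integral_const_mul]
    congr 1
    funext y
    rw [waveSum, mul_assoc, ← tsum_mul_right]
    congr 2
    funext q
    ring
  rw [e]
  refine h3.congr_fun fun q => ?_
  rw [integral_const_mul, integral_planeFourier_mul_wave]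
  ring

end WaveSum

/-! ### The Ewald sum of a single kernel -/

/-- The properties of a kernel `K`, its real-space part `R`, the Fourier transforms `Khat` of `K`
and `KFhat` of `K - R`, and the limit `S` of `R - K` at `0` that the Ewald formula rests on. -/
structure EwaldKernel (K R : Plane → ℝ) (Khat KFhat : Plane → ℂ) (S : ℝ) : Prop where
  continuousOn : ContinuousOn R {0}ᶜ
  integrable : Integrable R
  decay : ∃ C, ∀ r, 1 ≤ ‖r‖ → |R r| ≤ C / ‖r‖ ^ 4
  fourier_zero : planeFourier (fun r => (R r : ℂ)) 0 = 0
  fourier : ∀ k, k ≠ 0 → planeFourier (fun r => (R r : ℂ)) k = Khat k - KFhat k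
  zero : KFhat 0 = 0
  conj : ∀ k, KFhat (-k) = (starRingEnd ℂ) (KFhat k)
  decay_hat : ∃ C, ∀ k, 1 ≤ ‖k‖ → ‖KFhat k‖ ≤ C / ‖k‖ ^ 4
  multiplier : ∀ φ : 𝓢(Plane, ℂ), (0 : Plane) ∉ tsupport (φ : Plane → ℂ) →
    ∃ ψ : 𝓢(Plane, ℂ), ∀ k, ψ k = Khat k * φ k
  kernel : HasFourierAwayFromZero K Khat
  self : Tendsto (fun r => R r - K r) (𝓝[≠] 0) (𝓝 S)

/-- `W` is the doubly periodic sum `∑*_p K(y - τ(p))` with mean zero: the conditions of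
`IsDoublyPeriodicSum` for one kernel and one source at the origin, together with the integrability
that makes the pairings additive in the sources. Continuity off the sources is not
a separate field, since it is contained in `starred_value`. -/
structure IsPeriodicSum (L : Fin 2 → ℝ) (K W : Plane → ℝ) : Prop where
  periodic : ∀ y p, W (y - latticeVec L p) = W y
  locallyIntegrable : LocallyIntegrable W
  mean_zero : ∫ y in box L, W y = 0
  integrable : ∀ φ : 𝓢(Plane, ℂ), Integrable fun y => (W y : ℂ) * planeFourier φ y
  integrable_kernel : ∀ φ : 𝓢(Plane, ℂ), (0 : Plane) ∉ tsupport (φ : Plane → ℂ) →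
    ∀ p, Integrable fun y => (K (y - latticeVec L p) : ℂ) * planeFourier φ y
  lattice_sum : ∀ φ : 𝓢(Plane, ℂ), (0 : Plane) ∉ tsupport (φ : Plane → ℂ) →
    HasSum (fun p => ∫ y, (K (y - latticeVec L p) : ℂ) * planeFourier φ y)
      (∫ y, (W y : ℂ) * planeFourier φ y)
  starred_value : ∀ y, Tendsto (fun z => W z - open Classical in if Congruent L y 0 then K (z - y) else 0)
    (𝓝[≠] y) (𝓝 (W y))

open Classical in
/-- The right-hand side of the Ewald formula for a single source at the origin. -/
def ewaldSum (L : Fin 2 → ℝ) (R : Plane → ℝ) (KFhat : Plane → ℂ) (S : ℝ) (y : Plane) : ℝ :=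
  realSum L R y + (waveSum L KFhat y).re + if Congruent L y 0 then S else 0

lemma congruent_sub_latticeVec {L : Fin 2 → ℝ} (y : Plane) (p : Fin 2 → ℤ) :
    Congruent L (y - latticeVec L p) 0 ↔ Congruent L y 0 := by
  simp only [Congruent, sub_zero]
  constructor
  · rintro ⟨q, hq⟩
    exact ⟨q + p, by rw [latticeVec_add, ← hq, sub_add_cancel]⟩
  · rintro ⟨q, hq⟩
    exact ⟨q + -p, by rw [latticeVec_add, latticeVec_neg, ← hq, sub_eq_add_neg]⟩

lemma ae_not_congruent (L : Fin 2 → ℝ) : ∀ᵐ y, ¬ Congruent L y 0 := by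
  have h : {y | ¬ ¬ Congruent L y 0} = range (latticeVec L) := by
    ext y
    simp [Congruent, eq_comm]
  rw [ae_iff, h]
  exact (countable_range _).measure_zero volume

lemma tsupport_modulation_subset {φ ψ : 𝓢(Plane, ℂ)} {a : Plane}
    (h : ∀ k, ψ k = wave a k * φ k) :
    tsupport (ψ : Plane → ℂ) ⊆ tsupport (φ : Plane → ℂ) := by
  have e : (ψ : Plane → ℂ) = fun k => wave a k * φ k := funext h
  rw [e]
  exact tsupport_mul_subset_right

namespace EwaldKernel

variable {L : Fin 2 → ℝ} {K R : Plane → ℝ} {Khat KFhat : Plane → ℂ} {S : ℝ}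

lemma summable_hat (h : EwaldKernel K R Khat KFhat S) (hL : ∀ i, 0 < L i) :
    Summable fun q => ‖KFhat (waveVec L q)‖ := by
  obtain ⟨C, hC⟩ := h.decay_hat
  exact summable_norm_waveVec hL hC

lemma ewaldSum_ae_eq : (fun y => ewaldSum L R KFhat S y)
    =ᵐ[volume] fun y => realSum L R y + (waveSum L KFhat y).re := by
  filter_upwards [ae_not_congruent L] with y hy
  rw [ewaldSum, if_neg hy, add_zero]

lemma locallyIntegrable_ewaldSum (h : EwaldKernel K R Khat KFhat S) (hL : ∀ i, 0 < L i) :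
    LocallyIntegrable (ewaldSum L R KFhat S) := by
  obtain ⟨C, hC⟩ := h.decay
  have h1 := locallyIntegrable_realSum hL h.continuousOn hC h.integrable
  have h2 : LocallyIntegrable fun y => (waveSum L KFhat y).re :=
    (Complex.continuous_re.comp (continuous_waveSum (h.summable_hat hL))).locallyIntegrable
  exact (h1.add h2).congr ewaldSum_ae_eq.symm

lemma ewaldSum_sub_latticeVec (hL : ∀ i, 0 < L i) (y : Plane) (p : Fin 2 → ℤ) :
    ewaldSum L R KFhat S (y - latticeVec L p) = ewaldSum L R KFhat S y := by
  rw [ewaldSum, ewaldSum, realSum_sub_latticeVec, waveSum_sub_latticeVec hL]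
  have := congruent_sub_latticeVec (L := L) y p
  by_cases hC : Congruent L y 0
  · rw [if_pos hC, if_pos (this.2 hC)]
  · rw [if_neg hC, if_neg (mt this.1 hC)]

/-- The Fourier coefficients of the Ewald sum do not depend on the splitting. -/
lemma boxCoeff_ewaldSum (h : EwaldKernel K R Khat KFhat S) (hL : ∀ i, 0 < L i) (q : Fin 2 → ℤ) :
    boxCoeff L (fun y => (ewaldSum L R KFhat S y : ℂ)) q
      = if q = 0 then 0 else (cellArea L : ℂ)⁻¹ * Khat (waveVec L q) := by
  obtain ⟨C, hC⟩ := h.decay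
  have hs := h.summable_hat hL
  have i1 : IntegrableOn (fun y => (realSum L R y : ℂ)) (box L) :=
    (integrableOn_box (locallyIntegrable_realSum hL h.continuousOn hC h.integrable)).ofReal
  have i2 : IntegrableOn (waveSum L KFhat) (box L) :=
    integrableOn_box (continuous_waveSum hs).locallyIntegrable
  have hw : ∀ {f : Plane → ℂ}, IntegrableOn f (box L) →
      IntegrableOn (fun y => f y * wave (-waveVec L q) y) (box L) := fun hf =>
    hf.mul_bdd (c := 1) (continuous_wave_right _).aestronglyMeasurable
      (Eventually.of_forall fun y => (norm_wave _ _).le)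
  have e : boxCoeff L (fun y => (ewaldSum L R KFhat S y : ℂ)) q
      = boxCoeff L (fun y => (realSum L R y : ℂ)) q + boxCoeff L (waveSum L KFhat) q := by
    rw [boxCoeff, boxCoeff, boxCoeff, ← mul_add, ← integral_add (hw i1) (hw i2)]
    congr 1
    refine setIntegral_congr_ae (measurableSet_box L) ?_
    filter_upwards [ewaldSum_ae_eq (L := L) (R := R) (KFhat := KFhat) (S := S)] with y hy _
    rw [hy, Complex.ofReal_add, ofReal_re_waveSum h.conj]
    ring
  rw [e, boxCoeff_realSum hL h.integrable, boxCoeff_waveSum hL hs]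
  by_cases hq : q = 0
  · subst hq
    rw [waveVec_zero, h.fourier_zero, h.zero]
    simp
  · have hk : waveVec L q ≠ 0 := by
      rw [← waveVec_zero L]
      exact fun hh => hq (waveVec_injective hL hh)
    rw [if_neg hq, h.fourier _ hk]
    ring

/-- Pairing `K(· - τ(p))` with `φ̂` gives the Fourier transform of the Schwartz function `K̂ φ` at
`τ(p)`, so the sum over `p` is evaluated by Poisson summation. -/
lemma hasSum_integral_kernel (h : EwaldKernel K R Khat KFhat S) (hL : ∀ i, 0 < L i)
    (φ : 𝓢(Plane, ℂ)) (hφ : (0 : Plane) ∉ tsupport (φ : Plane → ℂ)) :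
    (∀ p, Integrable fun y => (K (y - latticeVec L p) : ℂ) * planeFourier φ y) ∧
    HasSum (fun p => ∫ y, (K (y - latticeVec L p) : ℂ) * planeFourier φ y)
      (∑' q, ((2 * Real.pi) ^ 2 / cellArea L : ℝ) * (Khat (waveVec L q) * φ (waveVec L q))) := by
  obtain ⟨ψ, hψ⟩ := h.multiplier φ hφ
  have key : ∀ p, Integrable (fun y => (K (y - latticeVec L p) : ℂ) * planeFourier φ y) ∧
      ∫ y, (K (y - latticeVec L p) : ℂ) * planeFourier φ y = planeFourier ψ (latticeVec L p) := by
    intro p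
    obtain ⟨χ, hχ, hχ'⟩ := exists_schwartz_modulation φ (latticeVec L p)
    obtain ⟨i1, -, e1⟩ := h.kernel χ fun hh => hφ (tsupport_modulation_subset hχ hh)
    simp only [hχ'] at i1 e1
    have e2 : ∀ y, (K (y - latticeVec L p) : ℂ) * planeFourier φ y
        = (fun y => (K y : ℂ) * planeFourier φ (y + latticeVec L p)) (y - latticeVec L p) := by
      intro y
      simp only [sub_add_cancel]
    simp only [e2]
    refine ⟨i1.comp_sub_right _, ?_⟩
    rw [integral_sub_right_eq_self (fun y => (K y : ℂ) * planeFourier φ (y + latticeVec L p)), e1,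
      planeFourier_eq]
    congr 1
    funext k
    rw [hχ, hψ]
    ring
  refine ⟨fun p => (key p).1, ?_⟩
  simp only [fun p => (key p).2]
  have h1 := poisson_summation hL ψ 0
  simp only [wave_zero_right, mul_one, hψ] at h1
  rw [h1.tsum_eq]
  have hs : Summable fun p => planeFourier ψ (0 - latticeVec L p) := by
    obtain ⟨u, hu, hb⟩ := summable_schwartz_sub_latticeVec hL (schwartzFourier ψ) 0
    refine Summable.of_norm_bounded hu fun p => ?_
    have := hb p 0 (by simp)
    rwa [schwartzFourier_apply] at this
  have h2 := hs.hasSum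
  rw [← (Equiv.neg (Fin 2 → ℤ)).hasSum_iff] at h2
  refine h2.congr_fun fun p => ?_
  rw [Function.comp_apply, Equiv.neg_apply, latticeVec_neg, zero_sub, neg_neg]

/-- The Ewald sum is the doubly periodic sum of the kernel. -/
theorem isPeriodicSum (h : EwaldKernel K R Khat KFhat S) (hL : ∀ i, 0 < L i) :
    IsPeriodicSum L K (ewaldSum L R KFhat S) := by
  have hV : (cellArea L : ℂ) ≠ 0 := by exact_mod_cast (cellArea_pos hL).ne'
  have hper : ∀ y p, ((ewaldSum L R KFhat S (y - latticeVec L p) : ℝ) : ℂ)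
      = (ewaldSum L R KFhat S y : ℂ) := fun y p => by rw [ewaldSum_sub_latticeVec hL]
  have hint : IntegrableOn (fun y => (ewaldSum L R KFhat S y : ℂ)) (box L) :=
    (integrableOn_box (h.locallyIntegrable_ewaldSum hL)).ofReal
  refine ⟨ewaldSum_sub_latticeVec hL, h.locallyIntegrable_ewaldSum hL, ?_,
    fun φ => (hasSum_integral_mul_planeFourier hL hper hint φ).1,
    fun φ hφ => (h.hasSum_integral_kernel hL φ hφ).1, fun φ hφ => ?_, fun y => ?_⟩
  · have h0 := h.boxCoeff_ewaldSum hL 0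
    rw [if_pos rfl, boxCoeff, waveVec_zero, neg_zero] at h0
    simp only [wave_zero_left, mul_one] at h0
    have h1 := (mul_eq_zero.1 h0).resolve_left (inv_ne_zero hV)
    have h2 := (integral_ofReal (𝕜 := ℂ) (f := ewaldSum L R KFhat S)
      (μ := volume.restrict (box L))).symm.trans h1
    exact RCLike.ofReal_eq_zero.1 h2
  · have h1 := (hasSum_integral_mul_planeFourier hL hper hint φ).2
    rw [← h1.tsum_eq]
    have h2 := (h.hasSum_integral_kernel hL φ hφ).2
    convert! h2 using 1
    refine tsum_congr fun q => ?_
    rw [h.boxCoeff_ewaldSum hL]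
    by_cases hq : q = 0
    · rw [if_pos hq, hq, waveVec_zero, image_eq_zero_of_notMem_tsupport hφ]
      simp
    · rw [if_neg hq]
      push_cast
      field_simp
  · obtain ⟨C, hC⟩ := h.decay
    obtain ⟨h1, h2⟩ := tendsto_realSum hL h.continuousOn hC y
    have h3 : Tendsto (fun z => (waveSum L KFhat z).re) (𝓝[≠] y) (𝓝 (waveSum L KFhat y).re) :=
      ((Complex.continuous_re.comp (continuous_waveSum (h.summable_hat hL))).tendsto y).mono_left
        nhdsWithin_le_nhds
    by_cases hC : Congruent L y 0
    · have h4 : Tendsto (fun z => R (z - y) - K (z - y)) (𝓝[≠] y) (𝓝 S) := by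
        refine h.self.comp (tendsto_nhdsWithin_iff.2 ⟨?_, ?_⟩)
        · have : Tendsto (fun z => z - y) (𝓝 y) (𝓝 (y - y)) := (continuous_sub_right y).tendsto y
          rw [sub_self] at this
          exact this.mono_left nhdsWithin_le_nhds
        · filter_upwards [self_mem_nhdsWithin] with z hz
          exact sub_ne_zero.2 hz
      rw [ewaldSum, if_pos hC]
      refine ((h1.add h3).add h4).congr' ?_
      filter_upwards [h2] with z hz
      simp only [ewaldSum, if_pos hC, if_neg hz]
      ring
    · rw [ewaldSum, if_neg hC]
      refine ((h1.add h3).add tendsto_const_nhds).congr' ?_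
      filter_upwards [h2] with z hz
      simp only [ewaldSum, if_neg hC, if_neg hz]
      ring

end EwaldKernel

/-! ### The Stokeslet and the stresslet as Ewald kernels -/

lemma one_sub_hasimotoHat_le {ξ : ℝ} (k : Plane) :
    1 - hasimotoHat ξ k ≤ (‖k‖ ^ 2 / (4 * ξ ^ 2)) ^ 2 := by
  rw [hasimotoHat]
  set s := ‖k‖ ^ 2 / (4 * ξ ^ 2)
  have hs : 0 ≤ s := by positivity
  nlinarith [Real.add_one_le_exp (-s)]

lemma hasimotoHat_mul_pow_le {ξ : ℝ} (hξ : 0 < ξ) (k : Plane) :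
    hasimotoHat ξ k * ‖k‖ ^ 4 ≤ 1024 * ξ ^ 4 := by
  have e : ‖k‖ ^ 4 = 16 * ξ ^ 4 * (‖k‖ ^ 2 / (4 * ξ ^ 2)) ^ 2 := by field_simp; ring
  rw [hasimotoHat, e]
  set s := ‖k‖ ^ 2 / (4 * ξ ^ 2)
  have hs : 0 ≤ s := by positivity
  have h1 := one_add_pow_three_mul_exp_neg_le hs
  have h2 : Real.exp (-(s / 4)) ≤ 1 := Real.exp_le_one_iff.2 (by linarith)
  have h3 := Real.exp_pos (-s)
  have h4 : (1 + s) * s ^ 2 * Real.exp (-s) ≤ (1 + s) ^ 3 * Real.exp (-s) := by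
    gcongr
    nlinarith [mul_nonneg hs hs]
  calc (1 + s) * Real.exp (-s) * (16 * ξ ^ 4 * s ^ 2)
      = 16 * ξ ^ 4 * ((1 + s) * s ^ 2 * Real.exp (-s)) := by ring
    _ ≤ 16 * ξ ^ 4 * 64 := by gcongr; linarith
    _ = _ := by ring

/-- A screened kernel with the Fourier transform `O(k⁻² + k⁻¹)` is covered by the Ewald formula.
The bound makes the Fourier transform of the real-space part vanish at `0`. -/
lemma ScreenedKernel.ewaldKernel {K : Plane → ℝ} {R : ℝ → Plane → ℝ} {P : Plane → ℂ} {a b : ℝ → ℝ}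
    (h : ScreenedKernel K R P a b) {ξ : ℝ} (hξ : 0 < ξ) {KR : Plane → ℝ}
    {Khat KFhat : Plane → ℂ} {S C : ℝ} (hKR : ∀ r, r ≠ 0 → KR r = R ξ r)
    (hKhat : ∀ k, k ≠ 0 → Khat k = P k / ((‖k‖ ^ 4 : ℝ) : ℂ))
    (hKF : ∀ k, KFhat k = (hasimotoHat ξ k : ℂ) * Khat k) (h0 : Khat 0 = 0)
    (hconj : ∀ k, Khat (-k) = (starRingEnd ℂ) (Khat k))
    (hC : ∀ k, ‖Khat k‖ * ‖k‖ ^ 4 ≤ C * (‖k‖ ^ 2 + ‖k‖ ^ 3))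
    (hS : Tendsto (fun r => KR r - K r) (𝓝[≠] 0) (𝓝 S)) :
    EwaldKernel K KR Khat KFhat S := by
  have hsplit := h.isHasimotoSplit hξ hKR hKhat fun k _ => hKF k
  refine ⟨(h.continuousOn ξ hξ).congr hKR, hsplit.real_integrable, ?_, ?_, hsplit.fourier_real, ?_,
    fun k => ?_, ?_, fun φ hφ => ?_, hsplit.fourier, hS⟩
  · obtain ⟨D, hD⟩ := h.decay ξ hξ
    refine ⟨D, fun r hr => ?_⟩
    rw [hKR r (norm_pos_iff.1 (by linarith))]
    exact hD r hr
  · have hc := (continuous_planeFourier (f := fun r => (KR r : ℂ)) hsplit.real_integrable.ofReal).tendsto 0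
    have hz : Tendsto (fun k : Plane => (16 * ξ ^ 4)⁻¹ * (C * (‖k‖ ^ 2 + ‖k‖ ^ 3))) (𝓝 0) (𝓝 0) := by
      have := (by fun_prop : Continuous fun k : Plane =>
        (16 * ξ ^ 4)⁻¹ * (C * (‖k‖ ^ 2 + ‖k‖ ^ 3))).tendsto 0
      simpa using this
    refine tendsto_nhds_unique (hc.mono_left (nhdsWithin_le_nhds (s := {0}ᶜ))) ?_
    refine squeeze_zero_norm' ?_ (hz.mono_left nhdsWithin_le_nhds)
    filter_upwards [self_mem_nhdsWithin] with k hk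
    have e : Khat k - KFhat k = ((1 - hasimotoHat ξ k : ℝ) : ℂ) * Khat k := by
      rw [hKF]; push_cast; ring
    rw [hsplit.fourier_real k hk, e, norm_mul, Complex.norm_real,
      Real.norm_of_nonneg (sub_nonneg.2 (hasimotoHat_le_one ξ k))]
    calc _ ≤ (‖k‖ ^ 2 / (4 * ξ ^ 2)) ^ 2 * ‖Khat k‖ := by
          gcongr; exact one_sub_hasimotoHat_le k
      _ = (16 * ξ ^ 4)⁻¹ * (‖Khat k‖ * ‖k‖ ^ 4) := by field_simp; ring
      _ ≤ _ := mul_le_mul_of_nonneg_left (hC k) (by positivity)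
  · rw [hKF, h0, mul_zero]
  · have : hasimotoHat ξ (-k) = hasimotoHat ξ k := by simp only [hasimotoHat, norm_neg]
    rw [hKF, hKF, hconj, this, map_mul, Complex.conj_ofReal]
  · refine ⟨1024 * ξ ^ 4 * (2 * C), fun k hk => ?_⟩
    have hk0 : 0 < ‖k‖ := by linarith
    have h1 : ‖Khat k‖ ≤ 2 * C := by
      have hC0 : 0 ≤ C := by
        have h2 := hC k
        have h3 : 0 ≤ ‖Khat k‖ * ‖k‖ ^ 4 := by positivity
        have h4 : 0 < ‖k‖ ^ 2 + ‖k‖ ^ 3 := by positivity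
        exact nonneg_of_mul_nonneg_left (h3.trans h2) h4
      have h2 : ‖k‖ ^ 2 + ‖k‖ ^ 3 ≤ 2 * ‖k‖ ^ 4 := by
        have := pow_le_pow_right₀ hk (show 2 ≤ 4 by norm_num)
        have := pow_le_pow_right₀ hk (show 3 ≤ 4 by norm_num)
        linarith
      have h3 : ‖Khat k‖ * ‖k‖ ^ 4 ≤ 2 * C * ‖k‖ ^ 4 := by
        calc _ ≤ C * (2 * ‖k‖ ^ 4) := (hC k).trans (by gcongr)
          _ = _ := by ring
      exact le_of_mul_le_mul_right h3 (by positivity)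
    rw [hKF, norm_mul, Complex.norm_real, Real.norm_of_nonneg (hasimotoHat_nonneg ξ k),
      le_div_iff₀ (by positivity), mul_right_comm]
    exact mul_le_mul (hasimotoHat_mul_pow_le hξ k) h1 (norm_nonneg _) (by positivity)
  · obtain ⟨ψ, hψ⟩ := exists_schwartz_div_norm_pow_four h.temperate φ hφ
    refine ⟨ψ, fun k => ?_⟩
    rw [hψ]
    by_cases hk : k = 0
    · rw [hk, image_eq_zero_of_notMem_tsupport hφ, mul_zero, mul_zero]
    · rw [hKhat k hk]

lemma abs_unitComp_le (k : Plane) (j : Fin 2) : |unitComp k j| ≤ 1 := by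
  rw [unitComp, abs_div, abs_norm]
  exact div_le_one_of_le₀ (abs_coord_le k j) (norm_nonneg k)

lemma unitComp_neg (k : Plane) (j : Fin 2) : unitComp (-k) j = -unitComp k j := by
  rw [unitComp, unitComp, norm_neg, PiLp.neg_apply, neg_div]

lemma ewaldKernel_stokeslet {ξ : ℝ} (hξ : 0 < ξ) (j l : Fin 2) :
    EwaldKernel (stokeslet j l) (stokesletR ξ j l) (stokesletHat j l) (stokesletFHat ξ j l)
      (selfConst ξ * kd j l) := by
  refine (screenedKernel_stokeslet j l).ewaldKernel (C := 2) hξ (fun _ hr => stokesletR_eq hξ j l hr)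
    (fun _ hk => stokesletHat_eq j l hk) (fun k => stokesletFHat_eq ξ j l k) ?_ (fun k => ?_)
    (fun k => ?_) (tendsto_stokesletR_sub hξ j l)
  · simp [stokesletHat]
  · simp only [stokesletHat, unitComp_neg, norm_neg, neg_mul_neg, Complex.conj_ofReal]
  · by_cases hk : k = 0
    · simp [hk]
    have hn : 0 < ‖k‖ := norm_pos_iff.2 hk
    have h1 : |kd j l - unitComp k j * unitComp k l| ≤ 2 := by
      refine (abs_sub _ _).trans ?_
      rw [abs_mul]
      have := mul_le_mul (abs_unitComp_le k j) (abs_unitComp_le k l) (abs_nonneg _) zero_le_one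
      linarith [abs_kd_le j l]
    rw [stokesletHat, Complex.norm_real, Real.norm_eq_abs, abs_div,
      abs_of_pos (by positivity : 0 < ‖k‖ ^ 2)]
    calc |kd j l - unitComp k j * unitComp k l| / ‖k‖ ^ 2 * ‖k‖ ^ 4
        = |kd j l - unitComp k j * unitComp k l| * ‖k‖ ^ 2 := by field_simp
      _ ≤ 2 * (‖k‖ ^ 2 + ‖k‖ ^ 3) := by gcongr; linarith [pow_pos hn 3]

lemma ewaldKernel_stresslet {ξ : ℝ} (hξ : 0 < ξ) (j l m : Fin 2) :
    EwaldKernel (stresslet j l m) (stressletR ξ j l m) (stressletHat j l m) (stressletFHat ξ j l m)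
      0 := by
  refine (screenedKernel_stresslet j l m).ewaldKernel (C := 5) hξ
    (fun _ hr => stressletR_eq hξ j l m hr)
    (fun _ hk => stressletHat_eq j l m hk) (fun k => stressletFHat_eq ξ j l m k) ?_ (fun k => ?_)
    (fun k => ?_) (tendsto_stressletR_sub hξ j l m)
  · simp [stressletHat]
  · have e : stressletSymbol j l m (-k) = -stressletSymbol j l m k := by
      simp only [stressletSymbol, unitComp_neg]; ring
    simp only [stressletHat, e, norm_neg, map_mul, Complex.conj_ofReal, Complex.conj_I]
    push_cast
    ring
  · by_cases hk : k = 0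
    · simp [hk]
    have hn : 0 < ‖k‖ := norm_pos_iff.2 hk
    have hk2 : ∀ a b c : Fin 2, |kd a b * unitComp k c| ≤ 1 := fun a b c => by
      rw [abs_mul]
      exact (mul_le_mul (abs_kd_le a b) (abs_unitComp_le k c) (abs_nonneg _) zero_le_one).trans_eq
        (one_mul _)
    have h3 : |2 * unitComp k j * unitComp k l * unitComp k m| ≤ 2 * 1 * 1 * 1 := by
      rw [abs_mul, abs_mul, abs_mul, abs_two]
      gcongr <;> exact abs_unitComp_le k _
    have h1 : |stressletSymbol j l m k| ≤ 5 := by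
      rw [stressletSymbol]
      refine (abs_sub _ _).trans ?_
      have := abs_add_three (kd j l * unitComp k m) (kd j m * unitComp k l) (kd l m * unitComp k j)
      linarith [hk2 j l m, hk2 j m l, hk2 l m j]
    rw [stressletHat, norm_mul, Complex.norm_I, one_mul, Complex.norm_real, Real.norm_eq_abs,
      abs_div, abs_norm]
    calc |stressletSymbol j l m k| / ‖k‖ * ‖k‖ ^ 4
        = |stressletSymbol j l m k| * ‖k‖ ^ 3 := by field_simp
      _ ≤ 5 * (‖k‖ ^ 2 + ‖k‖ ^ 3) := by gcongr; linarith [pow_pos hn 2]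

/-! ### Uniqueness of doubly periodic sums -/

section Uniqueness

variable {L : Fin 2 → ℝ} {N : ℕ} {x : Fin N → Plane} {K : Fin N → Plane → ℝ} {U U' : Plane → ℝ}

lemma IsDoublyPeriodicSum.periodic_sub (h : IsDoublyPeriodicSum L x K U) (y : Plane)
    (p : Fin 2 → ℤ) : U (y - latticeVec L p) = U y := by
  rw [← h.periodic (y - latticeVec L p) p, sub_add_cancel]

lemma boxCoeff_sub {f g : Plane → ℂ} (hf : IntegrableOn f (box L)) (hg : IntegrableOn g (box L))
    (q : Fin 2 → ℤ) : boxCoeff L (fun y => f y - g y) q = boxCoeff L f q - boxCoeff L g q := by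
  have hw : ∀ {f : Plane → ℂ}, IntegrableOn f (box L) →
      IntegrableOn (fun y => f y * wave (-waveVec L q) y) (box L) := fun hf =>
    hf.mul_bdd (c := 1) (continuous_wave_right _).aestronglyMeasurable
      (Eventually.of_forall fun y => (norm_wave _ _).le)
  simp only [boxCoeff, sub_mul]
  rw [integral_sub (hw hf) (hw hg), mul_sub]

/-- The Fourier coefficients of a doubly periodic sum are determined by the kernels. -/
lemma IsDoublyPeriodicSum.boxCoeff_eq (hL : ∀ i, 0 < L i) (h : IsDoublyPeriodicSum L x K U)
    (h' : IsDoublyPeriodicSum L x K U') (q : Fin 2 → ℤ) :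
    boxCoeff L (fun y => (U y : ℂ)) q = boxCoeff L (fun y => (U' y : ℂ)) q := by
  by_cases hq : q = 0
  · have key : ∀ {U}, IsDoublyPeriodicSum L x K U → boxCoeff L (fun y => (U y : ℂ)) q = 0 := by
      intro U h
      rw [boxCoeff, hq, waveVec_zero, neg_zero]
      simp only [wave_zero_left, mul_one]
      have := integral_ofReal (𝕜 := ℂ) (f := U) (μ := volume.restrict (box L))
      rw [h.mean_zero] at this
      rw [show ∫ y in box L, (U y : ℂ) = 0 from this.trans (by simp), mul_zero]
    rw [key h, key h']
  · obtain ⟨φ, h1, h0, hφ⟩ := exists_schwartz_delta hL q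
    have key : ∀ {U}, IsDoublyPeriodicSum L x K U →
        ∫ y, (U y : ℂ) * planeFourier φ y = (2 * Real.pi : ℂ) ^ 2 * boxCoeff L (fun y => (U y : ℂ)) q :=
      fun {U} h => integral_mul_planeFourier_delta hL (U := fun y => (U y : ℂ))
        (fun y p => by rw [h.periodic_sub]) (integrableOn_box h.locallyIntegrable).ofReal φ h1 h0
    have e := (h.lattice_sum φ (hφ hq)).unique (h'.lattice_sum φ (hφ hq))
    rw [key h, key h'] at e
    exact mul_left_cancel₀ two_pi_sq_ne_zero e

/-- A doubly periodic sum is unique: the difference of two of them is continuous, and all its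
Fourier coefficients vanish. -/
theorem IsDoublyPeriodicSum.unique (hL : ∀ i, 0 < L i) (h : IsDoublyPeriodicSum L x K U)
    (h' : IsDoublyPeriodicSum L x K U') : U = U' := by
  have hc : Continuous fun y => U y - U' y := by
    rw [continuous_iff_continuousAt]
    intro y
    rw [← continuousWithinAt_compl_self]
    refine ((h.starred_value y).sub (h'.starred_value y)).congr fun z => ?_
    ring
  have hae : ∀ᵐ y, U y - U' y = 0 := by
    refine ae_eq_zero_of_boxCoeff_eq_zero hL (D := fun y => U y - U' y)
      (fun y p => by rw [h.periodic_sub, h'.periodic_sub])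
      (h.locallyIntegrable.sub h'.locallyIntegrable) fun q => ?_
    have := boxCoeff_sub (L := L) (f := fun y => (U y : ℂ)) (g := fun y => (U' y : ℂ))
      (integrableOn_box h.locallyIntegrable).ofReal (integrableOn_box h'.locallyIntegrable).ofReal q
    rw [h.boxCoeff_eq hL h' q, sub_self] at this
    simpa only [Complex.ofReal_sub] using this
  have h0 := (hc.ae_eq_iff_eq volume continuous_const (g := fun _ => (0 : ℝ))).1 hae
  funext y
  exact sub_eq_zero.1 (congrFun h0 y)

end Uniqueness

/-! ### Superposition of shifted periodic sums -/

namespace IsPeriodicSum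

variable {L : Fin 2 → ℝ} {K W : Plane → ℝ}

lemma shift_locallyIntegrable (h : IsPeriodicSum L K W) (a : Plane) :
    LocallyIntegrable fun y => W (y - a) := by
  intro y
  obtain ⟨s, hs, hi⟩ := h.locallyIntegrable (y - a)
  refine ⟨(fun y => y - a) ⁻¹' s, (continuous_sub_right a).continuousAt.preimage_mem_nhds hs, ?_⟩
  exact ((measurePreserving_sub_right (volume : Measure Plane) a).integrableOn_comp_preimage
    (measurableEmbedding_subRight a)).2 hi

/-- Shifting a function amounts to modulating the Schwartz function that it is tested against. -/
lemma exists_schwartz_shift (φ : 𝓢(Plane, ℂ)) (a : Plane) : ∃ χ : 𝓢(Plane, ℂ),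
    (∀ k, χ k = wave (-a) k * φ k) ∧ ∀ h : Plane → ℝ,
      (Integrable (fun y => (h y : ℂ) * planeFourier χ y) →
        Integrable fun y => (h (y - a) : ℂ) * planeFourier φ y) ∧
      ∫ y, (h (y - a) : ℂ) * planeFourier φ y = ∫ y, (h y : ℂ) * planeFourier χ y := by
  obtain ⟨χ, h1, h2⟩ := exists_schwartz_modulation φ a
  refine ⟨χ, h1, fun h => ?_⟩
  have e : ∀ y, (h (y - a) : ℂ) * planeFourier φ y
      = (fun y => (h y : ℂ) * planeFourier χ y) (y - a) := by
    intro y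
    simp only [h2, sub_add_cancel]
  simp only [e]
  exact ⟨fun hi => hi.comp_sub_right a,
    integral_sub_right_eq_self (fun y => (h y : ℂ) * planeFourier χ y) a⟩

lemma shift_integrable (h : IsPeriodicSum L K W) (a : Plane) (φ : 𝓢(Plane, ℂ)) :
    Integrable fun y => (W (y - a) : ℂ) * planeFourier φ y := by
  obtain ⟨χ, -, h2⟩ := exists_schwartz_shift φ a
  exact (h2 W).1 (h.integrable χ)

lemma shift_mean_zero (h : IsPeriodicSum L K W) (hL : ∀ i, 0 < L i) (a : Plane) :
    ∫ y in box L, W (y - a) = 0 := by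
  obtain ⟨φ, h1, h0, -⟩ := exists_schwartz_delta hL 0
  obtain ⟨χ, hχ, e⟩ := exists_schwartz_shift φ a
  have hV : (cellArea L : ℂ) ≠ 0 := by exact_mod_cast (cellArea_pos hL).ne'
  -- both means are pairings with functions that isolate the zero wave vector
  have m1 := integral_mul_planeFourier_delta hL (U := fun y => (W (y - a) : ℂ))
    (fun y p => by rw [sub_right_comm, h.periodic])
    (integrableOn_box (h.shift_locallyIntegrable a)).ofReal φ h1 h0
  have m2 := integral_mul_planeFourier_delta hL (U := fun y => (W y : ℂ))
    (fun y p => by rw [h.periodic]) (integrableOn_box h.locallyIntegrable).ofReal χ (q := 0)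
    (by rw [hχ, h1, waveVec_zero, wave_zero_right, mul_one])
    (fun p hp => by rw [hχ, h0 p hp, mul_zero])
  have key : ∀ f : Plane → ℝ, boxCoeff L (fun y => (f y : ℂ)) 0
      = (cellArea L : ℂ)⁻¹ * ((∫ y in box L, f y : ℝ) : ℂ) := by
    intro f
    rw [boxCoeff, waveVec_zero, neg_zero]
    simp only [wave_zero_left, mul_one]
    congr 1
    exact integral_ofReal (𝕜 := ℂ) (f := f) (μ := volume.restrict (box L))
  rw [(e W).2, m2, key, key, h.mean_zero] at m1
  have m3 := mul_left_cancel₀ (inv_ne_zero hV) (mul_left_cancel₀ two_pi_sq_ne_zero m1)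
  exact_mod_cast m3.symm

lemma shift_lattice_sum (h : IsPeriodicSum L K W) (a : Plane) (φ : 𝓢(Plane, ℂ))
    (hφ : (0 : Plane) ∉ tsupport (φ : Plane → ℂ)) :
    (∀ p, Integrable fun y => (K (y - a - latticeVec L p) : ℂ) * planeFourier φ y) ∧
    HasSum (fun p => ∫ y, (K (y - a - latticeVec L p) : ℂ) * planeFourier φ y)
      (∫ y, (W (y - a) : ℂ) * planeFourier φ y) := by
  obtain ⟨χ, hχ, e⟩ := exists_schwartz_shift φ a
  have h0 : (0 : Plane) ∉ tsupport (χ : Plane → ℂ) := fun hh =>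
    hφ (tsupport_modulation_subset hχ hh)
  constructor
  · exact fun p => (e fun y => K (y - latticeVec L p)).1 (h.integrable_kernel χ h0 p)
  · rw [(e W).2]
    refine (h.lattice_sum χ h0).congr_fun fun p => ?_
    exact (e fun y => K (y - latticeVec L p)).2

open Classical in
lemma shift_starred_value (h : IsPeriodicSum L K W) (a y : Plane) :
    Tendsto (fun z => W (z - a) - if Congruent L y a then K (z - y) else 0) (𝓝[≠] y)
      (𝓝 (W (y - a))) := by
  have h1 : Tendsto (fun z => z - a) (𝓝[≠] y) (𝓝[≠] (y - a)) := by
    refine tendsto_nhdsWithin_iff.2 ⟨((continuous_sub_right a).tendsto y).mono_left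
      nhdsWithin_le_nhds, ?_⟩
    filter_upwards [self_mem_nhdsWithin] with z hz
    exact fun hh => hz (sub_left_inj.1 hh)
  have h2 := (h.starred_value (y - a)).comp h1
  refine h2.congr fun z => ?_
  have e : Congruent L (y - a) 0 ↔ Congruent L y a := by simp only [Congruent, sub_zero]
  simp only [Function.comp_apply, sub_sub_sub_cancel_right]
  by_cases hC : Congruent L y a
  · rw [if_pos hC, if_pos (e.2 hC)]
  · rw [if_neg hC, if_neg (mt e.1 hC)]

end IsPeriodicSum

section Superposition

variable {L : Fin 2 → ℝ} {ι : Type*} [Fintype ι] {N : ℕ}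

/-- Superpositions of the periodic sums of single kernels are doubly periodic sums. -/
theorem isDoublyPeriodicSum_superposition (hL : ∀ i, 0 < L i) {K W : ι → Plane → ℝ}
    (h : ∀ i, IsPeriodicSum L (K i) (W i)) (x : Fin N → Plane) (c : Fin N → ι → ℝ) :
    IsDoublyPeriodicSum L x (fun n r => ∑ i, K i r * c n i)
      (fun y => ∑ n, ∑ i, W i (y - x n) * c n i) where
  periodic y p := by
    refine Finset.sum_congr rfl fun n _ => Finset.sum_congr rfl fun i _ => ?_
    rw [← (h i).periodic (y + latticeVec L p - x n) p]
    congr 2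
    abel
  locallyIntegrable := by
    refine locallyIntegrable_finsetSum _ fun n _ => locallyIntegrable_finsetSum _ fun i _ => ?_
    have := ((h i).shift_locallyIntegrable (x n)).smul (c n i)
    refine this.congr (Eventually.of_forall fun y => ?_)
    exact mul_comm _ _
  mean_zero := by
    have hi : ∀ n i, IntegrableOn (fun y => W i (y - x n) * c n i) (box L) := fun n i =>
      (integrableOn_box ((h i).shift_locallyIntegrable (x n))).mul_const _
    rw [integral_finsetSum _ fun n _ => integrable_finsetSum _ fun i _ => hi n i]
    refine Finset.sum_eq_zero fun n _ => ?_
    rw [integral_finsetSum _ fun i _ => hi n i]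
    refine Finset.sum_eq_zero fun i _ => ?_
    rw [integral_mul_const, (h i).shift_mean_zero hL, zero_mul]
  lattice_sum φ hφ := by
    have hW : ∀ n i, Integrable fun y => (W i (y - x n) : ℂ) * planeFourier φ y * (c n i : ℂ) :=
      fun n i => ((h i).shift_integrable (x n) φ).mul_const _
    have hK : ∀ n i p, Integrable fun y =>
        (K i (y - x n - latticeVec L p) : ℂ) * planeFourier φ y * (c n i : ℂ) :=
      fun n i p => (((h i).shift_lattice_sum (x n) φ hφ).1 p).mul_const _
    have e : ∀ (f : Fin N → ι → Plane → ℝ) (y : Plane),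
        ((∑ n, ∑ i, f n i y * c n i : ℝ) : ℂ) * planeFourier φ y
          = ∑ n, ∑ i, (f n i y : ℂ) * planeFourier φ y * (c n i : ℂ) := by
      intro f y
      push_cast
      simp only [Finset.sum_mul]
      refine Finset.sum_congr rfl fun n _ => Finset.sum_congr rfl fun i _ => ?_
      ring
    have e1 : ∫ y, ((∑ n, ∑ i, W i (y - x n) * c n i : ℝ) : ℂ) * planeFourier φ y
        = ∑ n, ∑ i, (∫ y, (W i (y - x n) : ℂ) * planeFourier φ y) * (c n i : ℂ) := by
      simp only [e fun n i y => W i (y - x n)]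
      rw [integral_finsetSum _ fun n _ => integrable_finsetSum _ fun i _ => hW n i]
      refine Finset.sum_congr rfl fun n _ => ?_
      rw [integral_finsetSum _ fun i _ => hW n i]
      refine Finset.sum_congr rfl fun i _ => ?_
      rw [integral_mul_const]
    rw [e1]
    have h1 : HasSum (fun p => ∑ n, ∑ i,
        (∫ y, (K i (y - x n - latticeVec L p) : ℂ) * planeFourier φ y) * (c n i : ℂ))
        (∑ n, ∑ i, (∫ y, (W i (y - x n) : ℂ) * planeFourier φ y) * (c n i : ℂ)) :=
      hasSum_sum fun n _ => hasSum_sum fun i _ =>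
        ((h i).shift_lattice_sum (x n) φ hφ).2.mul_right _
    refine h1.congr_fun fun p => ?_
    simp only [e fun n i y => K i (y - x n - latticeVec L p)]
    rw [integral_finsetSum _ fun n _ => integrable_finsetSum _ fun i _ => hK n i p]
    refine Finset.sum_congr rfl fun n _ => ?_
    rw [integral_finsetSum _ fun i _ => hK n i p]
    refine Finset.sum_congr rfl fun i _ => ?_
    rw [integral_mul_const]
  starred_value y := by
    classical
    have h1 := tendsto_finsetSum Finset.univ fun n (_ : n ∈ Finset.univ) =>
      tendsto_finsetSum Finset.univ fun i (_ : i ∈ Finset.univ) =>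
        ((h i).shift_starred_value (x n) y).mul_const (c n i)
    refine h1.congr fun z => ?_
    rw [← Finset.sum_sub_distrib]
    refine Finset.sum_congr rfl fun n _ => ?_
    by_cases hC : Congruent L y (x n)
    · simp only [if_pos hC, sub_mul, Finset.sum_sub_distrib]
    · simp only [if_neg hC, sub_zero]

lemma starred_sum_mul (R : ι → Plane → ℝ) (c : ι → ℝ) (r : Plane) :
    starred (fun r => ∑ i, R i r * c i) r = ∑ i, starred (R i) r * c i := by
  by_cases hr : r = 0
  · simp [hr]
  · simp only [starred_of_ne hr]

/-- The superposition of the Ewald sums of single kernels has the form of the Ewald formula. -/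
theorem ewaldFormula_superposition (hL : ∀ i, 0 < L i) {K R : ι → Plane → ℝ}
    {Khat KFhat : ι → Plane → ℂ} {S : ι → ℝ}
    (h : ∀ i, EwaldKernel (K i) (R i) (Khat i) (KFhat i) (S i))
    (x : Fin N → Plane) (c : Fin N → ι → ℝ) :
    EwaldFormula L x (fun n r => ∑ i, R i r * c n i) (fun n k => ∑ i, KFhat i k * (c n i : ℂ))
      (fun n => ∑ i, S i * c n i) (fun y => ∑ n, ∑ i, ewaldSum L (R i) (KFhat i) (S i) (y - x n) * c n i) := by
  classical
  intro y
  have hR : ∀ n i, HasSum (fun p => starred (R i) (y - x n - latticeVec L p) * c n i)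
      (realSum L (R i) (y - x n) * c n i) := by
    intro n i
    obtain ⟨C, hC⟩ := (h i).decay
    exact (summable_starred hL (h i).continuousOn hC _).hasSum.mul_right _
  have hF : ∀ n i, HasSum (fun q : {q : Fin 2 → ℤ // q ≠ 0} =>
      KFhat i (waveVec L q) * (c n i : ℂ) * wave (waveVec L q) (y - x n))
      ((∑' q, KFhat i (waveVec L q) * wave (waveVec L q) (y - x n)) * (c n i : ℂ)) := by
    intro n i
    have h1 := (summable_waveSum ((h i).summable_hat hL) (y - x n)).hasSum.mul_right (c n i : ℂ)
    have h2 : Function.support (fun q => KFhat i (waveVec L q) * wave (waveVec L q) (y - x n)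
        * (c n i : ℂ)) ⊆ {q | q ≠ 0} := by
      intro q hq h0
      refine hq ?_
      simp only [h0, waveVec_zero, (h i).zero, zero_mul]
    refine ((hasSum_subtype_iff_of_support_subset h2).2 h1).congr_fun fun q => ?_
    simp only [Function.comp_apply]
    ring
  have hR' : ∀ n, HasSum (fun p => starred (fun r => ∑ i, R i r * c n i) (y - x n - latticeVec L p))
      (∑ i, realSum L (R i) (y - x n) * c n i) := by
    intro n
    simp only [starred_sum_mul]
    exact hasSum_sum fun i _ => hR n i
  have hF' : ∀ n, HasSum (fun q : {q : Fin 2 → ℤ // q ≠ 0} =>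
      (∑ i, KFhat i (waveVec L q) * (c n i : ℂ)) * wave (waveVec L q) (y - x n))
      (∑ i, (∑' q, KFhat i (waveVec L q) * wave (waveVec L q) (y - x n)) * (c n i : ℂ)) := by
    intro n
    simp only [Finset.sum_mul]
    exact hasSum_sum fun i _ => hF n i
  refine ⟨fun n => (hR' n).summable, fun n => (hF' n).summable, ?_⟩
  have e1 := (hasSum_sum fun n (_ : n ∈ Finset.univ) => hR' n).tsum_eq
  have e2 := (hasSum_sum fun n (_ : n ∈ Finset.univ) => hF' n).tsum_eq
  have e3 : ∀ n i, ((ewaldSum L (R i) (KFhat i) (S i) (y - x n) * c n i : ℝ) : ℂ)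
      = ((realSum L (R i) (y - x n) * c n i : ℝ) : ℂ)
        + (cellArea L : ℂ)⁻¹ * ((∑' q, KFhat i (waveVec L q) * wave (waveVec L q) (y - x n)) * (c n i : ℂ))
        + (((if Congruent L y (x n) then S i * c n i else 0) : ℝ) : ℂ) := by
    intro n i
    have h1 := ofReal_re_waveSum (L := L) (h i).conj (y - x n)
    have h2 : Congruent L (y - x n) 0 ↔ Congruent L y (x n) := by simp only [Congruent, sub_zero]
    rw [ewaldSum, Complex.ofReal_mul, Complex.ofReal_add, Complex.ofReal_add, h1, waveSum]
    by_cases hC : Congruent L y (x n)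
    · rw [if_pos hC, if_pos (h2.2 hC)]
      push_cast
      ring
    · rw [if_neg hC, if_neg (mt h2.1 hC)]
      push_cast
      ring
  have e4 : ((∑ n, ∑ i, ewaldSum L (R i) (KFhat i) (S i) (y - x n) * c n i : ℝ) : ℂ)
      = ((∑ n, ∑ i, realSum L (R i) (y - x n) * c n i : ℝ) : ℂ)
        + (cellArea L : ℂ)⁻¹ * ∑ n, ∑ i,
          (∑' q, KFhat i (waveVec L q) * wave (waveVec L q) (y - x n)) * (c n i : ℂ)
        + ((∑ n, ∑ i, (if Congruent L y (x n) then S i * c n i else 0) : ℝ) : ℂ) := by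
    simp only [Complex.ofReal_sum, e3, Finset.sum_add_distrib, Finset.mul_sum]
  have e5 : ∀ n, ∑ i, (if Congruent L y (x n) then S i * c n i else 0)
      = if Congruent L y (x n) then ∑ i, S i * c n i else 0 := by
    intro n
    by_cases hC : Congruent L y (x n)
    · simp only [if_pos hC]
    · simp only [if_neg hC, Finset.sum_const_zero]
  simp only [e5] at e4
  rw [← e1, ← e2] at e4
  rw [e4, cellArea, ← one_div]
  rfl

end Superposition

/-- Existence, uniqueness and the Ewald formula for a family of kernels that can be split for
each value of the screening parameter. -/
theorem existsUnique_and_ewaldFormula {ι : Type*} [Fintype ι] {L : Fin 2 → ℝ} (hL : ∀ i, 0 < L i)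
    {N : ℕ} (x : Fin N → Plane) (c : Fin N → ι → ℝ) {K : ι → Plane → ℝ} {R : ℝ → ι → Plane → ℝ}
    {Khat : ι → Plane → ℂ} {KFhat : ℝ → ι → Plane → ℂ} {S : ℝ → ι → ℝ}
    (h : ∀ ξ, 0 < ξ → ∀ i, EwaldKernel (K i) (R ξ i) (Khat i) (KFhat ξ i) (S ξ i)) :
    (∃! U : Plane → ℝ, IsDoublyPeriodicSum L x (fun n r => ∑ i, K i r * c n i) U) ∧
    ∀ U : Plane → ℝ, IsDoublyPeriodicSum L x (fun n r => ∑ i, K i r * c n i) U →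
      ∀ ξ : ℝ, 0 < ξ → EwaldFormula L x (fun n r => ∑ i, R ξ i r * c n i)
        (fun n k => ∑ i, KFhat ξ i k * (c n i : ℂ)) (fun n => ∑ i, S ξ i * c n i) U := by
  have hW := fun ξ (hξ : (0 : ℝ) < ξ) =>
    isDoublyPeriodicSum_superposition hL (fun i => (h ξ hξ i).isPeriodicSum hL) x c
  refine ⟨⟨_, hW 1 one_pos, fun U hU => hU.unique hL (hW 1 one_pos)⟩, fun U hU ξ hξ => ?_⟩
  rw [hU.unique hL (hW ξ hξ)]
  exact ewaldFormula_superposition hL (h ξ hξ) x c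

end

end Ewald2D

theorem mainTheorem1 :
    -- the unscreened kernels in terms of the biharmonic Green's function
    (∀ r : Plane, r ≠ 0 →
      (∀ j l, stokeslet j l r = kd j l * lap biharm r - pd j (pd l biharm) r) ∧
      (∀ j l m, stresslet j l m r =
        kd j l * pd m (lap biharm) r + kd j m * pd l (lap biharm) r
          + kd l m * pd j (lap biharm) r - 2 * pd j (pd l (pd m biharm)) r)) ∧
    -- the splits of the kernels
    (∀ ξ : ℝ, 0 < ξ →
      (MeasureTheory.Integrable (hasimoto ξ) ∧
        ∀ k, planeFourier (fun r => (hasimoto ξ r : ℂ)) k = (hasimotoHat ξ k : ℂ)) ∧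
      -- biharmonic and Laplace Green's functions
      IsHasimotoSplit ξ biharm (biharmR ξ) biharmHat (biharmFHat ξ) ∧
      IsHasimotoSplit ξ lapl (laplR ξ) laplHat (laplFHat ξ) ∧
      (∀ r, biharmR ξ r = 1 / (16 * Real.pi * ξ ^ 2) *
        (ξ ^ 2 * ‖r‖ ^ 2 * expInt (ξ ^ 2 * ‖r‖ ^ 2) - Real.exp (-(ξ ^ 2 * ‖r‖ ^ 2)))) ∧
      (∀ r, r ≠ 0 → laplR ξ r = 1 / (4 * Real.pi) *
        (-Real.exp (-(ξ ^ 2 * ‖r‖ ^ 2)) + expInt (ξ ^ 2 * ‖r‖ ^ 2))) ∧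
      ContDiffOn ℝ ∞ (biharmR ξ) {0}ᶜ ∧
      ContDiffOn ℝ ∞ (laplR ξ) {0}ᶜ ∧
      (∀ r, r ≠ 0 → lap (biharmR ξ) r = laplR ξ r) ∧
      -- Stokeslet and stresslet
      (∀ j l, IsHasimotoSplit ξ (stokeslet j l) (stokesletR ξ j l)
        (stokesletHat j l) (stokesletFHat ξ j l)) ∧
      (∀ j l m, IsHasimotoSplit ξ (stresslet j l m) (stressletR ξ j l m)
        (stressletHat j l m) (stressletFHat ξ j l m)) ∧
      (∀ j l r, r ≠ 0 → stokesletR ξ j l r = 1 / (4 * Real.pi) *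
        (kd j l * (expInt (ξ ^ 2 * ‖r‖ ^ 2) / 2 - Real.exp (-(ξ ^ 2 * ‖r‖ ^ 2)))
          + r j * r l / ‖r‖ ^ 2 * Real.exp (-(ξ ^ 2 * ‖r‖ ^ 2)))) ∧
      (∀ j l m r, r ≠ 0 → stressletR ξ j l m r =
        1 / (2 * Real.pi) * Real.exp (-(ξ ^ 2 * ‖r‖ ^ 2)) *
          (ξ ^ 2 * (kd j l * r m + kd j m * r l + kd l m * r j)
            - 2 * (1 + ξ ^ 2 * ‖r‖ ^ 2) * (r j * r l * r m / ‖r‖ ^ 4))) ∧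
      -- the stresslet split is symmetric in all indices
      (∀ j l m r, r ≠ 0 → stressletR ξ j l m r = stressletR ξ l j m r ∧
        stressletR ξ j l m r = stressletR ξ j m l r) ∧
      (∀ j l m k, stressletFHat ξ j l m k = stressletFHat ξ l j m k ∧
        stressletFHat ξ j l m k = stressletFHat ξ j m l k) ∧
      -- the self-interaction limits
      (∀ j l, Filter.Tendsto (fun r => stokesletR ξ j l r - stokeslet j l r)
        (nhdsWithin 0 {0}ᶜ) (nhds (selfConst ξ * kd j l))) ∧
      (∀ j l m, Filter.Tendsto (fun r => stressletR ξ j l m r - stresslet j l m r)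
        (nhdsWithin 0 {0}ᶜ) (nhds 0))) ∧
    -- the Ewald formulas for the doubly periodic sums
    (∀ (L : Fin 2 → ℝ), (∀ i, 0 < L i) →
      ∀ (N : ℕ) (x f ν : Fin N → Plane) (j : Fin 2),
      (∃! U : Plane → ℝ,
        IsDoublyPeriodicSum L x (fun n r => ∑ l, stokeslet j l r * f n l) U) ∧
      (∀ U : Plane → ℝ,
        IsDoublyPeriodicSum L x (fun n r => ∑ l, stokeslet j l r * f n l) U →
        ∀ ξ : ℝ, 0 < ξ →
          EwaldFormula L x
            (fun n r => ∑ l, stokesletR ξ j l r * f n l)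
            (fun n k => ∑ l, stokesletFHat ξ j l k * ((f n l : ℝ) : ℂ))
            (fun n => selfConst ξ * f n j) U) ∧
      (∃! U : Plane → ℝ,
        IsDoublyPeriodicSum L x (fun n r => ∑ l, ∑ m, stresslet j l m r * f n l * ν n m) U) ∧
      (∀ U : Plane → ℝ,
        IsDoublyPeriodicSum L x
          (fun n r => ∑ l, ∑ m, stresslet j l m r * f n l * ν n m) U →
        ∀ ξ : ℝ, 0 < ξ →
          EwaldFormula L x
            (fun n r => ∑ l, ∑ m, stressletR ξ j l m r * f n l * ν n m)
            (fun n k => ∑ l, ∑ m,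
              stressletFHat ξ j l m k * ((f n l : ℝ) : ℂ) * ((ν n m : ℝ) : ℂ))
            (fun _ => 0) U)) := by
  refine ⟨fun r hr => ⟨fun j l => stokeslet_eq_biharm j l hr,
    fun j l m => stresslet_eq_biharm j l m hr⟩, fun ξ hξ => ⟨⟨integrable_hasimoto hξ,
    planeFourier_hasimoto hξ⟩, isHasimotoSplit_biharm hξ, isHasimotoSplit_lapl hξ,
    congrFun (biharmR_eq_biharmTail hξ), fun r hr => laplR_eq_laplTail hξ hr,
    contDiffOn_biharmR hξ, contDiffOn_laplR hξ, fun r hr => lap_biharmR hξ hr,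
    isHasimotoSplit_stokeslet hξ, isHasimotoSplit_stresslet hξ,
    fun j l r hr => stokesletR_eq hξ j l hr, fun j l m r hr => stressletR_eq hξ j l m hr,
    fun j l m r hr => stressletR_symm hξ j l m hr, stressletFHat_symm ξ,
    tendsto_stokesletR_sub hξ, tendsto_stressletR_sub hξ⟩, fun L hL N x f ν j => ?_⟩
  have hG := existsUnique_and_ewaldFormula hL x (fun n l => f n l)
    fun ξ hξ l => ewaldKernel_stokeslet hξ j l
  have hT := existsUnique_and_ewaldFormula hL x (fun n (i : Fin 2 × Fin 2) => f n i.1 * ν n i.2)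
    fun ξ hξ i => ewaldKernel_stresslet hξ j i.1 i.2
  have eS : ∀ ξ, (fun n => ∑ l, selfConst ξ * kd j l * f n l) = fun n => selfConst ξ * f n j := by
    intro ξ
    funext n
    simp [kd]
  simp only [eS] at hG
  simp only [Fintype.sum_prod_type, Complex.ofReal_mul, ← mul_assoc, zero_mul,
    Finset.sum_const_zero] at hT
  exact ⟨hG.1, hG.2, hT.1, hT.2⟩
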